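/- **Theorem.** Let $\Sigma=\mathbb D^2\setminus\{p_1,\dots,p_n\}$ be a closed disk with $n\ge 0$ interior punctures. Let $C(\Sigma)$ be the set of homotopy classes of unoriented, non-contractible simple closed curves in $\Sigma$, and $\mathbb Z C(\Sigma)$ the free abelian group on it. Identify $H_1(\Sigma;\mathbb Z)$ with $\mathbb Z^n$ through the basis of counterclockwise loops around the punctures (so that the coordinates of a closed curve are its winding numbers), partially ordered componentwise. For a simple closed curve $c$ let $[c]\in H_1(\Sigma;\mathbb Z)$ be its class when it is oriented counterclockwise, and let $h:\mathbb Z C(\Sigma)\to H_1(\Sigma;\mathbb Z)$ be the linear extension of $c\mapsto[c]$. Write $\mathbb Z[q^{\pm1},x^{\pm1}]$ and $\mathbb Z[q^{\pm1},y^{\pm1}]$ for the Laurent polynomial rings in $q$ and in one variable for each basis element of $\mathbb Z C(\Sigma)$, respectively of $H_1(\Sigma;\mathbb Z)$, with monomials $q^jx^v$ ($v\in\mathbb Z C(\Sigma)$) and $q^jy^v$ ($v\in H_1(\Sigma;\mathbb Z)$). For an oriented link $L\subset\Sigma\times[0,1]$ with diagram $D\subset\Sigma$, let $(\mathrm{CKh}(D),\partial)$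 be the Khovanov complex of $D$ over $\mathbb Q$, with basis the enhanced states $s=\{(C_i,s_i)\}_i$ (resolutions of $D$ with a sign on each circle $C_i$) and with its homological and quantum gradings. Put $\mathrm g^\Sigma(s)=\sum_i s_i[C_i]\in H_1(\Sigma;\mathbb Z)$ and $\Phi(s)=\sum_i s_i C_i\in\mathbb Z C(\Sigma)$, where contractible circles contribute $0$ to $\Phi$. Order $\mathbb Z C(\Sigma)$ by: $\alpha\trianglelefteq\beta$ if and only if $\alpha=\beta$ or the coefficient sum of $\alpha$ is smaller than that of $\beta$. The differential $\partial$ respects the filtrations of $\mathrm{CKh}(D)$ induced by $\mathrm g^\Sigma$ and by $\Phi$. Let $\mathrm{MKh}(L)$ and $\widetilde{\mathrm{APS}}(L)$ be the homologies of the associated graded complexes for $\mathrm g^\Sigma$ and for $\Phi$, graded by the homological degree $i$, the quantum degree $j$ and $v\in H_1(\Sigma;\mathbb Z)$, respectively $v\in\mathbb Z C(\Sigma)$, and let $$\chi(\widetilde{\mathrm{APS}}(L))=\sum_{i,j,v}(-1)^iq^jx^v\,\mathrm{rk}\,\widetilde{\mathrm{APS}}^{i,j,v}(L),\qquad \chi(\mathrm{MKh}(L))=\sum_{i,j,v}(-1)^iq^jy^v\,\mathrm{rk}\,\mathrm{MKh}^{i,j,v}(L),$$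 which are finite sums. Then $h$ induces a ring map $\chi_h:\mathbb Z[q^{\pm1},x^{\pm1}]\to\mathbb Z[q^{\pm1},y^{\pm1}]$, namely the unique ring homomorphism with $\chi_h(q)=q$ and $\chi_h(x_c)=y^{h(c)}$ for all $c\in C(\Sigma)$, and for every such link $L$ and diagram $D$ one has $\chi_h(\chi(\widetilde{\mathrm{APS}}(L)))=\chi(\mathrm{MKh}(L))$. -/

import Mathlib

open scoped unitInterval

namespace Multipunctured

noncomputable section

/-! ## Closed curves and winding numbers -/

/-- The closed curve `S¹ → X` traced by a closed path; `S¹` is `ℝ / ℤ`. -/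
def circleOfPath {X : Type*} [TopologicalSpace X] {x : X} (γ : Path x x) : C(UnitAddCircle, X) where
  toFun := AddCircle.liftIco 1 0 γ.extend
  continuous_toFun :=
    AddCircle.liftIco_zero_continuous (by simp) γ.continuous_extend.continuousOn

/-- Orientation reversal of the circle. -/
def circleNeg : C(UnitAddCircle, UnitAddCircle) := ⟨fun t => -t, continuous_neg⟩

/-- `γ` winds `k` times (counterclockwise) around `p`: it can be written as `p + exp θ` with `θ`
continuous on `[0,1]` and with total increment `2 π i k`. -/
def HasWinding (γ : UnitAddCircle → ℂ) (p : ℂ) (k : ℤ) : Prop :=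
  ∃ θ : C(I, ℂ), (∀ t : I, γ ((t : ℝ) : UnitAddCircle) = p + Complex.exp (θ t)) ∧
    θ 1 - θ 0 = 2 * Real.pi * Complex.I * k

open Classical in
/-- The winding number of a closed curve around a point that it avoids. -/
def winding (γ : UnitAddCircle → ℂ) (p : ℂ) : ℤ :=
  if h : ∃ k, HasWinding γ p k then h.choose else 0

theorem HasWinding.unique {γ : UnitAddCircle → ℂ} {p : ℂ} {k l : ℤ}
    (hk : HasWinding γ p k) (hl : HasWinding γ p l) : k = l := by
  obtain ⟨θ, hθ, hθk⟩ := hk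
  obtain ⟨η, hη, hηl⟩ := hl
  have hexp : ∀ t, Complex.exp (θ t) = Complex.exp (η t) := fun t => by
    have := (hθ t).symm.trans (hη t)
    simpa using this
  have h0 : Complex.exp (η 0 + (θ 0 - η 0)) = Complex.exp (η 0) := by simpa using hexp 0
  have key : (fun t => η t + (θ 0 - η 0)) = (fun t => θ t) := by
    refine Complex.isCoveringMap_exp.eq_of_comp_eq (by fun_prop) (by fun_prop) ?_ (0 : I) (by simp)
    funext t
    apply Subtype.ext
    simp only [Function.comp_apply]
    rw [Complex.exp_add, hexp t]
    have : Complex.exp (θ 0 - η 0) = 1 := by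
      rw [Complex.exp_sub, hexp 0, div_self (Complex.exp_ne_zero _)]
    rw [this, mul_one]
  have h1 : η 1 + (θ 0 - η 0) = θ 1 := congrFun key 1
  have h2 : (2 * Real.pi * Complex.I : ℂ) * k = 2 * Real.pi * Complex.I * l := by
    rw [← hθk, ← hηl, ← h1]; ring
  have := mul_left_cancel₀ Complex.two_pi_I_ne_zero h2
  exact_mod_cast this

theorem HasWinding.winding_eq {γ : UnitAddCircle → ℂ} {p : ℂ} {k : ℤ}
    (hk : HasWinding γ p k) : winding γ p = k := by
  have h : ∃ k, HasWinding γ p k := ⟨k, hk⟩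
  rw [winding, dif_pos h]
  exact h.choose_spec.unique hk

theorem HasWinding.neg {γ : UnitAddCircle → ℂ} {p : ℂ} {k : ℤ}
    (hk : HasWinding γ p k) : HasWinding (fun t => γ (-t)) p (-k) := by
  obtain ⟨θ, hθ, hθk⟩ := hk
  refine ⟨θ.comp ⟨unitInterval.symm, unitInterval.continuous_symm⟩, fun t => ?_, ?_⟩
  · have := hθ (unitInterval.symm t)
    simp only [ContinuousMap.comp_apply, ContinuousMap.coe_mk]
    rw [← this]
    congr 1
    rw [unitInterval.coe_symm_eq, sub_eq_add_neg, AddCircle.coe_add, AddCircle.coe_neg]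
    have h1 : ((1 : ℝ) : UnitAddCircle) = 0 := AddCircle.coe_period 1
    rw [h1, zero_add]
  · simp only [ContinuousMap.comp_apply, ContinuousMap.coe_mk, unitInterval.symm_one,
      unitInterval.symm_zero]
    push_cast
    linear_combination -hθk

theorem winding_neg (γ : UnitAddCircle → ℂ) (p : ℂ) :
    winding (fun t => γ (-t)) p = -winding γ p := by
  by_cases h : ∃ k, HasWinding γ p k
  · obtain ⟨k, hk⟩ := h
    rw [hk.winding_eq, hk.neg.winding_eq]
  · have h' : ¬ ∃ k, HasWinding (fun t => γ (-t)) p k := by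
      rintro ⟨k, hk⟩
      exact h ⟨-k, by simpa using hk.neg⟩
    rw [winding, winding, dif_neg h, dif_neg h', neg_zero]

/-- Winding numbers do not change along a homotopy that avoids the point. -/
theorem HasWinding.of_homotopy {p : ℂ} (H : C(I × UnitAddCircle, ℂ)) (hH : ∀ x, H x ≠ p) {k : ℤ}
    (hk : HasWinding (fun t => H (0, t)) p k) : HasWinding (fun t => H (1, t)) p k := by
  obtain ⟨θ, hθ, hθk⟩ := hk
  let G : C(I × I, {z : ℂ // z ≠ 0}) :=
    ⟨fun x => ⟨H (x.1, ((x.2 : ℝ) : UnitAddCircle)) - p, sub_ne_zero.2 (hH _)⟩, by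
      refine Continuous.subtype_mk (Continuous.sub (H.continuous.comp ?_) continuous_const) _
      exact continuous_fst.prodMk
        ((AddCircle.continuous_mk' 1).comp (continuous_subtype_val.comp continuous_snd))⟩
  have hG0 : ∀ a, G (0, a) = (⟨_, (θ a).exp_ne_zero⟩ : {z : ℂ // z ≠ 0}) := fun a => by
    apply Subtype.ext
    have := hθ a
    simp only [G, ContinuousMap.coe_mk]
    simp only at this
    rw [this]; ring
  let Θ := Complex.isCoveringMap_exp.liftHomotopy G θ hG0
  have hΘ : ∀ s t : I, H (s, ((t : ℝ) : UnitAddCircle)) = p + Complex.exp (Θ (s, t)) := fun s t => by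
    have := congrFun (Complex.isCoveringMap_exp.liftHomotopy_lifts G θ hG0) (s, t)
    have := congrArg Subtype.val this
    simp only [Function.comp_apply, G, ContinuousMap.coe_mk] at this
    simp only [Θ]
    rw [this]; ring
  have hΘ0 : ∀ a, Θ (0, a) = θ a := Complex.isCoveringMap_exp.liftHomotopy_zero G θ hG0
  have key : (fun s : I => Θ (s, 1)) = (fun s => Θ (s, 0) + 2 * Real.pi * Complex.I * k) := by
    refine Complex.isCoveringMap_exp.eq_of_comp_eq (by fun_prop) (by fun_prop) ?_ (0 : I) ?_
    · funext s
      apply Subtype.ext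
      simp only [Function.comp_apply]
      have e1 := hΘ s 1
      have e0 := hΘ s 0
      have h1 : (((1 : I) : ℝ) : UnitAddCircle) = (((0 : I) : ℝ) : UnitAddCircle) := by
        simp [AddCircle.coe_period]
      rw [h1, e0] at e1
      have e2 : Complex.exp (Θ (s, 0)) = Complex.exp (Θ (s, 1)) := by simpa using e1
      rw [Complex.exp_add, ← e2]
      have e3 : Complex.exp (2 * Real.pi * Complex.I * k) = 1 := by
        rw [mul_comm]; exact Complex.exp_int_mul_two_pi_mul_I k
      rw [e3, mul_one]
    · simp only [hΘ0]
      rw [← hθk]; ring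
  refine ⟨⟨fun t => Θ (1, t), by fun_prop⟩, fun t => hΘ 1 t, ?_⟩
  have := congrFun key 1
  simp only [ContinuousMap.coe_mk] at this ⊢
  rw [this]; ring

/-! ## The punctured disk, its curve classes, and the map to first homology -/

/-- The positions of `n` punctures in the open unit disk. -/
structure PuncturedDisk (n : ℕ) where
  puncture : Fin n → ℂ
  injective : Function.Injective puncture
  norm_lt : ∀ i, ‖puncture i‖ < 1

/-- The surface: the closed unit disk without the punctures. -/
def PuncturedDisk.carrier {n : ℕ} (X : PuncturedDisk n) : Set ℂ :=
  {z | ‖z‖ ≤ 1 ∧ ∀ i, z ≠ X.puncture i}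

section Curves

variable {n : ℕ} (X : PuncturedDisk n)

/-- The class of a closed curve in the first homology of the surface, in the basis given by the
counterclockwise loops around the punctures: its coordinates are the winding numbers. -/
def orientedClass (γ : C(UnitAddCircle, X.carrier)) : Fin n → ℤ :=
  fun i => winding (fun t => (γ t : ℂ)) (X.puncture i)

/-- The homology class of an unoriented simple closed curve, given its counterclockwise
orientation. A simple closed curve winds at most once around each puncture, and in the same
direction around all the punctures that it encloses; so the counterclockwise orientation is the one
with nonnegative winding numbers, and its class consists of their absolute values. -/
def positiveClass (γ : C(UnitAddCircle, X.carrier)) : Fin n → ℤ :=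
  fun i => |orientedClass X γ i|

variable {X} in
theorem orientedClass_eq_of_homotopic {γ δ : C(UnitAddCircle, X.carrier)}
    (h : γ.Homotopic δ) : orientedClass X γ = orientedClass X δ := by
  have aux : ∀ {γ δ : C(UnitAddCircle, X.carrier)}, γ.Homotopic δ → ∀ i k,
      HasWinding (fun t => (γ t : ℂ)) (X.puncture i) k →
      HasWinding (fun t => (δ t : ℂ)) (X.puncture i) k := by
    rintro γ δ ⟨F⟩ i k hk
    have := HasWinding.of_homotopy (p := X.puncture i) (k := k)
      ⟨fun x => (F x : ℂ), by fun_prop⟩ (fun x => (F x).2.2 i) (by simpa using hk)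
    simpa using this
  funext i
  have : ∀ k, HasWinding (fun t => (γ t : ℂ)) (X.puncture i) k ↔
      HasWinding (fun t => (δ t : ℂ)) (X.puncture i) k :=
    fun k => ⟨aux h i k, aux h.symm i k⟩
  have e : HasWinding (fun t => (γ t : ℂ)) (X.puncture i) =
      HasWinding (fun t => (δ t : ℂ)) (X.puncture i) := funext fun k => propext (this k)
  unfold orientedClass winding
  rw [e]

variable {X} in
theorem orientedClass_neg (γ : C(UnitAddCircle, X.carrier)) :
    orientedClass X (γ.comp circleNeg) = -orientedClass X γ := by
  funext i
  exact winding_neg (fun t => (γ t : ℂ)) (X.puncture i)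

/-- A (parametrized) simple closed curve in the surface that is not contractible. -/
structure EssentialCurve where
  toMap : C(UnitAddCircle, X.carrier)
  injective : Function.Injective toMap
  essential : ¬ toMap.Nullhomotopic

variable {X} in
/-- Two curves are homotopic as unoriented closed curves. -/
def UnorientedHomotopic (γ δ : C(UnitAddCircle, X.carrier)) : Prop :=
  γ.Homotopic δ ∨ γ.Homotopic (δ.comp circleNeg)

theorem comp_circleNeg_circleNeg (γ : C(UnitAddCircle, X.carrier)) :
    (γ.comp circleNeg).comp circleNeg = γ := by
  ext t; simp [circleNeg]

instance curveSetoid : Setoid (EssentialCurve X) where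
  r γ δ := UnorientedHomotopic γ.toMap δ.toMap
  iseqv := by
    have flip : ∀ {γ δ : C(UnitAddCircle, X.carrier)},
        γ.Homotopic δ → (γ.comp circleNeg).Homotopic (δ.comp circleNeg) :=
      fun h => h.comp (.refl circleNeg)
    refine ⟨fun γ => Or.inl (.refl _), ?_, ?_⟩
    · rintro γ δ (h | h)
      · exact Or.inl h.symm
      · have := flip h
        rw [comp_circleNeg_circleNeg] at this
        exact Or.inr this.symm
    · rintro γ δ ε (h | h) (h' | h')
      · exact Or.inl (h.trans h')
      · exact Or.inr (h.trans h')
      · exact Or.inr (h.trans (flip h'))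
      · have := flip h'
        rw [comp_circleNeg_circleNeg] at this
        exact Or.inl (h.trans this)

/-- `C(Σ)`: homotopy classes of unoriented nontrivial simple closed curves. -/
def CurveClass : Type := Quotient (curveSetoid X)

variable {X} in
/-- The class in first homology of an element of `C(Σ)`. -/
def CurveClass.homology : CurveClass X → (Fin n → ℤ) :=
  Quotient.lift (fun γ => positiveClass X γ.toMap) (by
    rintro γ δ (h | h)
    · funext i
      simp only [positiveClass, orientedClass_eq_of_homotopic h]
    · funext i
      simp only [positiveClass, orientedClass_eq_of_homotopic h, orientedClass_neg, Pi.neg_apply,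
        abs_neg])

/-- `ℤ C(Σ)`: the free abelian group on `C(Σ)`. -/
def CurveGroup : Type := CurveClass X →₀ ℤ

instance : AddCommGroup (CurveGroup X) := inferInstanceAs (AddCommGroup (CurveClass X →₀ ℤ))

variable {X} in
/-- A basis element of `ℤ C(Σ)`. -/
def CurveGroup.of (c : CurveClass X) : CurveGroup X := Finsupp.single c 1

variable {X} in
/-- The sum of the coefficients. -/
def CurveGroup.coeffSum (a : CurveGroup X) : ℤ := Finsupp.sum a fun _ k => k

/-- The partial order on `ℤ C(Σ)`: `a` is below `b` if and only if `a = b`, or the coefficient sum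
of `a` is smaller than that of `b`. -/
instance : PartialOrder (CurveGroup X) where
  le a b := a = b ∨ a.coeffSum < b.coeffSum
  le_refl a := Or.inl rfl
  le_trans := by
    rintro a b c (rfl | h) (rfl | h')
    · exact Or.inl rfl
    · exact Or.inr h'
    · exact Or.inr h
    · exact Or.inr (h.trans h')
  le_antisymm := by
    rintro a b (h | h) (h' | h')
    · exact h
    · exact h
    · exact h'.symm
    · exact absurd (h.trans h') (lt_irrefl _)

/-- The map `h : ℤ C(Σ) → H₁(Σ; ℤ) = ℤⁿ`, the linear extension of `c ↦ [c]`. -/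
def hurewicz : CurveGroup X →+ (Fin n → ℤ) :=
  (Finsupp.linearCombination ℤ (CurveClass.homology (X := X))).toAddMonoidHom

open Classical in
variable {X} in
/-- The element of `ℤ C(Σ)` given by a simple closed curve: the basis element of its class, or zero
if the curve is contractible. -/
def curveElement (γ : C(UnitAddCircle, X.carrier)) : CurveGroup X :=
  if h : Function.Injective γ ∧ ¬ γ.Nullhomotopic then
    CurveGroup.of (Quotient.mk (curveSetoid X) ⟨γ, h.1, h.2⟩)
  else 0

end Curves

/-! ## Link diagrams in the punctured disk -/

/-- The crossings of a link diagram, in order. Crossing `i` sits in a round disk ("box") with centre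
`center i` and radius `‖axis i‖`, and inside the box the diagram consists of the two diameters with
the end points `center i + axis i * I ^ k`, `k = 0, 1, 2, 3` (in counterclockwise order). The strand
through the ends `0, 2` is the overcrossing strand, the strand through `1, 3` passes under it. -/
structure Crossings {n : ℕ} (X : PuncturedDisk n) where
  num : ℕ
  center : Fin num → ℂ
  axis : Fin num → ℂ
  axis_ne : ∀ i, axis i ≠ 0
  box_subset : ∀ i, Metric.closedBall (center i) ‖axis i‖ ⊆ X.carrier
  box_disjoint : ∀ i j, i ≠ j →
    Disjoint (Metric.closedBall (center i) ‖axis i‖) (Metric.closedBall (center j) ‖axis j‖)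

namespace Crossings

variable {n : ℕ} {X : PuncturedDisk n} (K : Crossings X)

/-- The four ends at all the crossings. -/
abbrev End : Type := Fin K.num × ZMod 4

/-- The position of an end in the plane. -/
def pos (a : K.End) : ℂ := K.center a.1 + K.axis a.1 * Complex.I ^ a.2.val

theorem pos_mem_box (a : K.End) : K.pos a ∈ Metric.closedBall (K.center a.1) ‖K.axis a.1‖ := by
  simp [pos]

/-- The position of an end as a point of the surface. -/
def pt (a : K.End) : X.carrier := ⟨K.pos a, K.box_subset _ (K.pos_mem_box a)⟩

/-- The straight segment between two ends at the same crossing. -/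
def chord (i : Fin K.num) (k l : ZMod 4) : Path (K.pt (i, k)) (K.pt (i, l)) where
  toFun t := ⟨AffineMap.lineMap (K.pos (i, k)) (K.pos (i, l)) (t : ℝ), K.box_subset i
    ((convex_closedBall (K.center i) ‖K.axis i‖).lineMap_mem (K.pos_mem_box (i, k))
      (K.pos_mem_box (i, l)) t.2)⟩
  continuous_toFun := by
    refine Continuous.subtype_mk ?_ _
    exact AffineMap.lineMap_continuous.comp continuous_subtype_val
  source' := by ext; simp [pt]
  target' := by ext; simp [pt]

/-- The pairing of the ends in the resolution `ρ` of the crossings (`false` for the `0`-resolution,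
`true` for the `1`-resolution). The `0`-resolution, which merges the two regions swept out by
rotating the overstrand counterclockwise to the understrand, joins `1, 2` and `3, 0`; the
`1`-resolution joins `0, 1` and `2, 3`. -/
def smooth (ρ : Fin K.num → Bool) (a : K.End) : K.End :=
  (a.1, (if ρ a.1 then 1 else 3) - a.2)

theorem smooth_smooth (ρ : Fin K.num → Bool) (a : K.End) : K.smooth ρ (K.smooth ρ a) = a :=
  Prod.ext rfl (sub_sub_cancel _ a.2)

/-- The arc that replaces the crossing in the resolution `ρ`, starting from the end `a`. -/
def smoothArc (ρ : Fin K.num → Bool) (a : K.End) : Path (K.pt a) (K.pt (K.smooth ρ a)) :=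
  K.chord a.1 a.2 _

end Crossings

/-- An oriented link diagram in the punctured disk: crossings, pairwise disjoint simple arcs that
join their ends outside the boxes, and simple closed components without crossings. -/
structure Diagram {n : ℕ} (X : PuncturedDisk n) extends Crossings X where
  /-- the other end of the arc that starts at a given end -/
  opp : toCrossings.End → toCrossings.End
  opp_opp : ∀ a, opp (opp a) = a
  opp_ne : ∀ a, opp a ≠ a
  arc : ∀ a, Path (toCrossings.pt a) (toCrossings.pt (opp a))
  arc_opp : ∀ a t, arc (opp a) t = arc a (unitInterval.symm t)
  arc_injective : ∀ a, Function.Injective (arc a)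
  arc_box : ∀ a t i, (arc a t : ℂ) ∈ Metric.closedBall (center i) ‖axis i‖ → t = 0 ∨ t = 1
  arc_disjoint : ∀ a b, b ≠ a → b ≠ opp a → Disjoint (Set.range (arc a)) (Set.range (arc b))
  /-- the number of components without crossings -/
  numFree : ℕ
  free : Fin numFree → C(UnitAddCircle, X.carrier)
  free_injective : ∀ i, Function.Injective (free i)
  free_disjoint : ∀ i j, i ≠ j → Disjoint (Set.range (free i)) (Set.range (free j))
  free_arc : ∀ i a, Disjoint (Set.range (free i)) (Set.range (arc a))
  free_box : ∀ i t j, (free i t : ℂ) ∉ Metric.closedBall (center j) ‖axis j‖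
  /-- the orientation: whether the strand at an end is directed away from the crossing -/
  out : toCrossings.End → Bool
  out_opp : ∀ a, out (opp a) = !out a
  out_across : ∀ i k, out (i, k + 2) = !out (i, k)

namespace Diagram

variable {n : ℕ} {X : PuncturedDisk n} (D : Diagram X)

/-- A choice of resolution at every crossing. -/
abbrev Resolution : Type := Fin D.num → Bool

/-- Following an arc and then a resolved crossing. -/
def next (ρ : D.Resolution) (a : D.End) : D.End := D.smooth ρ (D.opp a)

theorem next_injective (ρ : D.Resolution) : Function.Injective (D.next ρ) := by
  intro a b h
  have h1 := congrArg (D.smooth ρ) h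
  simp only [next, Crossings.smooth_smooth] at h1
  have h2 := congrArg D.opp h1
  rwa [D.opp_opp, D.opp_opp] at h2

/-- The path from the end `a` along its arc and the following resolved crossing. -/
def step (ρ : D.Resolution) (a : D.End) : Path (D.pt a) (D.pt (D.next ρ a)) :=
  (D.arc a).trans (D.smoothArc ρ (D.opp a))

/-- The path of `m + 1` steps from the end `a` along the resolved diagram. -/
def walk (ρ : D.Resolution) (a : D.End) :
    (m : ℕ) → Path (D.pt a) (D.pt ((D.next ρ)^[m + 1] a))
  | 0 => D.step ρ a
  | m + 1 => ((walk ρ a m).trans (D.step ρ _)).cast rfl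
      (by rw [Function.iterate_succ_apply' (D.next ρ) (m + 1) a])

theorem iterate_period (ρ : D.Resolution) (a : D.End) :
    (D.next ρ)^[Function.minimalPeriod (D.next ρ) a - 1 + 1] a = a := by
  have h : 0 < Function.minimalPeriod (D.next ρ) a :=
    Function.minimalPeriod_pos_of_mem_periodicPts
      ((D.next_injective ρ).mem_periodicPts a)
  rw [Nat.sub_add_cancel h]
  exact Function.iterate_minimalPeriod

/-- The closed curve in the resolved diagram that passes through the end `a`. -/
def loop (ρ : D.Resolution) (a : D.End) : C(UnitAddCircle, X.carrier) :=
  circleOfPath ((D.walk ρ a (Function.minimalPeriod (D.next ρ) a - 1)).cast rfl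
    (by rw [D.iterate_period ρ a]))

/-- Two ends are neighbours on the same circle of the resolved diagram. -/
def Adjacent (ρ : D.Resolution) (a b : D.End) : Prop := b = D.opp a ∨ b = D.smooth ρ a

/-- The circles of the resolved diagram. -/
abbrev Circles (ρ : D.Resolution) : Type := Quot (D.Adjacent ρ) ⊕ Fin D.numFree

/-- The circle through a given end. -/
abbrev circleAt (ρ : D.Resolution) (a : D.End) : D.Circles ρ := Sum.inl (Quot.mk _ a)

/-- A parametrization of a circle of the resolved diagram. -/
def circleCurve (ρ : D.Resolution) : D.Circles ρ → C(UnitAddCircle, X.carrier)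
  | Sum.inl c => D.loop ρ c.out
  | Sum.inr i => D.free i

instance (ρ : D.Resolution) : Fintype (D.Circles ρ) := Fintype.ofFinite _

/-- Enhanced states: a resolution of the diagram with a sign on every circle. -/
abbrev State : Type := (ρ : D.Resolution) × (D.Circles ρ → ℤˣ)

instance : Fintype D.State := Fintype.ofFinite _

/-! ### Gradings -/

/-- A crossing is positive if the overstrand and the understrand, in this order, are directed along
a positively oriented frame. -/
def IsPositive (i : Fin D.num) : Prop := D.out (i, 0) = D.out (i, 1)

instance : DecidablePred D.IsPositive := fun i => decEq (D.out (i, 0)) (D.out (i, 1))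

/-- The number of positive crossings. -/
def numPos : ℕ := (Finset.univ.filter fun i => D.IsPositive i).card

/-- The number of negative crossings. -/
def numNeg : ℕ := (Finset.univ.filter fun i => ¬ D.IsPositive i).card

/-- The writhe. -/
def writhe : ℤ := D.numPos - D.numNeg

/-- The number of crossings with the `1`-resolution. -/
def weight (ρ : D.Resolution) : ℕ := (Finset.univ.filter fun i => ρ i = true).card

/-- The homological grading of an enhanced state. -/
def homDegree (x : D.State) : ℤ := D.weight x.1 - D.numNeg

/-- The quantum grading of an enhanced state. -/
def quantumDegree (x : D.State) : ℤ :=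
  ∑ c, (x.2 c : ℤ) + (D.weight x.1 - D.numNeg + D.writhe)

/-- The multipunctured grading: the sum of the signed homology classes of the circles. -/
def homologyDegree (x : D.State) : Fin n → ℤ :=
  ∑ c, (x.2 c : ℤ) • positiveClass X (D.circleCurve x.1 c)

/-- The grading by `ℤ C(Σ)`: the sum of the signed classes of the nontrivial circles. -/
def curveDegree (x : D.State) : CurveGroup X :=
  ∑ c, (x.2 c : ℤ) • curveElement (D.circleCurve x.1 c)

/-! ### The Khovanov complex -/

/-- The underlying vector space of the Khovanov complex. -/
abbrev CKh : Type := D.State →₀ ℚ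

/-- The coefficient of `v_c` in the merge of `v_a` and `v_b`. -/
def mergeCoeff (a b c : ℤˣ) : ℚ :=
  if (a = 1 ∧ b = 1 ∧ c = 1) ∨ (a = 1 ∧ b = -1 ∧ c = -1) ∨ (a = -1 ∧ b = 1 ∧ c = -1) then 1 else 0

/-- The coefficient of `v_b ⊗ v_c` in the split of `v_a`. -/
def splitCoeff (a b c : ℤˣ) : ℚ :=
  if (a = 1 ∧ b = 1 ∧ c = -1) ∨ (a = 1 ∧ b = -1 ∧ c = 1) ∨ (a = -1 ∧ b = -1 ∧ c = -1) then 1 else 0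

/-- The signs of `x` and `y` agree on all the circles that do not pass through crossing `j`. -/
def AgreeAway (j : Fin D.num) (x y : D.State) : Prop :=
  (∀ a : D.End, (∀ k, D.circleAt x.1 a ≠ D.circleAt x.1 (j, k)) →
    x.2 (D.circleAt x.1 a) = y.2 (D.circleAt y.1 a)) ∧
  ∀ i, x.2 (Sum.inr i) = y.2 (Sum.inr i)

open Classical in
/-- The coefficient of `y` in the merge or split of `x`, where crossing `j` has the `0`-resolution
in `x` and the `1`-resolution in `y`. The two arcs at the crossing pass through the ends `1` and `3`,
both in `x` and in `y`. -/
def edgeCoeff (j : Fin D.num) (x y : D.State) : ℚ :=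
  if D.AgreeAway j x y then
    if D.circleAt x.1 (j, 1) ≠ D.circleAt x.1 (j, 3) ∧
        D.circleAt y.1 (j, 1) = D.circleAt y.1 (j, 3) then
      mergeCoeff (x.2 (D.circleAt x.1 (j, 1))) (x.2 (D.circleAt x.1 (j, 3)))
        (y.2 (D.circleAt y.1 (j, 1)))
    else if D.circleAt x.1 (j, 1) = D.circleAt x.1 (j, 3) ∧
        D.circleAt y.1 (j, 1) ≠ D.circleAt y.1 (j, 3) then
      splitCoeff (x.2 (D.circleAt x.1 (j, 1))) (y.2 (D.circleAt y.1 (j, 1)))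
        (y.2 (D.circleAt y.1 (j, 3)))
    else 0
  else 0

/-- The matrix coefficient of the Khovanov differential from `x` to `y`, with the standard sign. -/
def diffCoeff (x y : D.State) : ℚ :=
  ∑ j, if x.1 j = false ∧ y.1 = Function.update x.1 j true then
    (-1) ^ (Finset.univ.filter fun i => i < j ∧ x.1 i = true).card * D.edgeCoeff j x y
  else 0

/-- The Khovanov differential. -/
def diff : D.CKh →ₗ[ℚ] D.CKh :=
  Finsupp.linearCombination ℚ fun x => ∑ y, Finsupp.single y (D.diffCoeff x y)

/-- The piece of the Khovanov complex of homological degree `i` and quantum degree `j`. -/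
def bidegree (i j : ℤ) : Submodule ℚ D.CKh :=
  Finsupp.supported ℚ ℚ {x | D.homDegree x = i ∧ D.quantumDegree x = j}

end Diagram

/-! ## Filtrations by a partially ordered set and the associated graded complex -/

section Filtration

variable {B P : Type*} [PartialOrder P] (g : B → P)

/-- The filtration induced by a grading `g` of the basis `B`. -/
def filt (a : P) : Submodule ℚ (B →₀ ℚ) := Finsupp.supported ℚ ℚ {x | g x ≤ a}

/-- The sum of all the strictly smaller steps of the filtration. -/
def filtLT (a : P) : Submodule ℚ (B →₀ ℚ) := ⨆ b, ⨆ (_ : b < a), filt g b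

/-- The associated graded module in degree `a`. -/
abbrev Gr (a : P) : Type _ := filt g a ⧸ (filtLT g a).submoduleOf (filt g a)

/-- The linear map `d` respects the filtration. -/
def IsFiltered (d : (B →₀ ℚ) →ₗ[ℚ] (B →₀ ℚ)) : Prop := ∀ a, ∀ x ∈ filt g a, d x ∈ filt g a

variable {g} {d : (B →₀ ℚ) →ₗ[ℚ] (B →₀ ℚ)}

theorem IsFiltered.filtLT (hd : IsFiltered g d) (a : P) :
    ∀ x ∈ filtLT g a, d x ∈ filtLT g a := by
  suffices h : Multipunctured.filtLT g a ≤ (Multipunctured.filtLT g a).comap d from h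
  refine iSup_le fun b => iSup_le fun hb x hx => ?_
  exact (le_iSup₂_of_le (f := fun b (_ : b < a) => filt g b) b hb le_rfl) (hd b x hx)

/-- The differential of the associated graded complex in degree `a`. -/
def grDiff (hd : IsFiltered g d) (a : P) : Gr g a →ₗ[ℚ] Gr g a :=
  Submodule.mapQ _ _ (d.restrict (hd a)) fun x hx => hd.filtLT a x hx

variable (g) in
/-- The part of the associated graded module in degree `a` that comes from a submodule `W`. -/
def grPart (a : P) (W : Submodule ℚ (B →₀ ℚ)) : Submodule ℚ (Gr g a) :=
  (W.submoduleOf (filt g a)).map (Submodule.mkQ _)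

/-- The part of the homology of the associated graded complex in degree `a` that is represented by
cycles in the part of the complex coming from `W`. -/
abbrev GrHomology (hd : IsFiltered g d) (a : P) (W : Submodule ℚ (B →₀ ℚ)) : Type _ :=
  ↥(LinearMap.ker (grDiff hd a) ⊓ grPart g a W) ⧸
    (LinearMap.range (grDiff hd a)).submoduleOf (LinearMap.ker (grDiff hd a) ⊓ grPart g a W)

end Filtration

/-! ## The two homologies and their Euler characteristics -/

/-- Laurent polynomials in `q` and in one variable for each basis element of a free abelian group
`V`, as the group ring of `ℤ × V`: the basis element `(j, v)` is the monomial `q ^ j x ^ v`. -/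
abbrev Laurent (V : Type*) [AddCommGroup V] : Type _ := AddMonoidAlgebra ℤ (ℤ × V)

/-- The monomial `q ^ j x ^ v`. -/
def monomial {V : Type*} [AddCommGroup V] (j : ℤ) (v : V) : Laurent V :=
  AddMonoidAlgebra.single (j, v) 1

/-- The Euler characteristic of a triply graded family of ranks that is finitely supported. -/
def eulerChar {V : Type*} [AddCommGroup V] (rk : ℤ → ℤ → V → ℕ) : Laurent V :=
  ∑ᶠ t : ℤ × ℤ × V, ((t.1.negOnePow : ℤ) * (rk t.1 t.2.1 t.2.2 : ℤ)) • monomial t.2.1 t.2.2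

/-- Only finitely many of the ranks are nonzero. -/
def FinitelySupported {V : Type*} (rk : ℤ → ℤ → V → ℕ) : Prop :=
  {t : ℤ × ℤ × V | rk t.1 t.2.1 t.2.2 ≠ 0}.Finite

namespace Diagram

variable {n : ℕ} {X : PuncturedDisk n} (D : Diagram X)

/-- The differential squares to zero and has degree one with respect to the homological grading and
degree zero with respect to the quantum grading. -/
def IsComplex : Prop :=
  D.diff ∘ₗ D.diff = 0 ∧ ∀ i j, ∀ x ∈ D.bidegree i j, D.diff x ∈ D.bidegree (i + 1) j

/-- The multipunctured Khovanov homology in homological degree `i`, quantum degree `j` and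
multipunctured degree `v`. -/
abbrev MKh (h : IsFiltered D.homologyDegree D.diff) (i j : ℤ) (v : Fin n → ℤ) : Type :=
  GrHomology h v (D.bidegree i j)

/-- The variant of the homology of Asaeda, Przytycki and Sikora in homological degree `i`, quantum
degree `j` and degree `v` in `ℤ C(Σ)`. -/
abbrev APS (h : IsFiltered D.curveDegree D.diff) (i j : ℤ) (v : CurveGroup X) : Type :=
  GrHomology h v (D.bidegree i j)

/-- The ranks of the multipunctured Khovanov homology. -/
def rankMKh (h : IsFiltered D.homologyDegree D.diff) (i j : ℤ) (v : Fin n → ℤ) : ℕ :=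
  Module.finrank ℚ (D.MKh h i j v)

/-- The ranks of the variant of the homology of Asaeda, Przytycki and Sikora. -/
def rankAPS (h : IsFiltered D.curveDegree D.diff) (i j : ℤ) (v : CurveGroup X) : ℕ :=
  Module.finrank ℚ (D.APS h i j v)

end Diagram

end

end Multipunctured

/-!
The ring map `χ` is the map of group rings induced by `hurewicz`, and it is the only one because the
exponents `(1, 0)` and `(0, c)` generate the group of exponents. The Euler characteristic of the
homology of an associated graded complex is that of the complex itself (`eulerChar_grHomology`), so
each of the two Euler characteristics is the sum of `± q ^ j x ^ v` over the enhanced states, where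
`v` is the degree of the state. The classes of the circles of a state in `ℤ C(Σ)` are mapped to their
homology classes (`hurewicz_curveDegree`), so `χ` matches the two sums term by term.

What takes work is that all of this is well defined: the differential squares to zero, preserves the
bidegree and respects both filtrations. It rests on two facts about the resolutions of a diagram.

* Planarity (`circleAt_ne_of_circleAt_eq`): changing the resolution of a crossing always merges two
  circles or splits one. Otherwise both resolutions would have all four ends of the crossing on a
  single circle, so the ends would be joined to their opposite ends by two disjoint paths outside the
  round box of the crossing. The end points of these paths alternate on the boundary of the box, and
  a comparison of logarithms along them excludes that (`exists_eq_of_alternating`).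
* Pairs of pants (`exists_pants`): when two circles are merged, there are closed paths `a`, `b` at a
  common base point such that the two circles are freely homotopic to `a` and `b` and the new circle
  to `a * b`. For both gradings this gives the triangle inequalities among the degrees of the three
  curves, and these are exactly the inequalities that are needed for the filtrations, one for each
  entry of the merge and split maps. For `ℤ C(Σ)` the case of a contractible boundary curve matters:
  the other two are then homotopic as unoriented curves, because a freely contractible loop is trivial
  in the fundamental group.

That each circle of a resolution is a simple closed curve (`circleCurve_injective`), so that it has a
class in `ℤ C(Σ)`, and that its class does not depend on the end at which it is started
(`loop_unorientedHomotopic`), follows from the description of circles as orbits of the dihedral group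
that is generated by the pairing of the ends by arcs and the pairing by the resolution.

For the faces of the cube of resolutions, the module of a resolution is regarded as a cyclic module
over the commuting operators `mulPoint`, generated by the state with all signs positive; the edge maps
commute with these operators, so it is enough to compare the two ways around a face on one state. A
merge sends the generator to the generator, and a split at `j` multiplies it by the sum of the
operators at the two strands of `j`.
-/

namespace Multipunctured

noncomputable section

/-! ### Euler characteristics of associated graded complexes -/

section Euler

variable {B P : Type*} [PartialOrder P] (g : B → P)

theorem filtLT_eq_supported (a : P) :
    filtLT g a = Finsupp.supported ℚ ℚ {x | g x < a} := by
  apply le_antisymm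
  · exact iSup₂_le fun b hb => Finsupp.supported_mono fun x hx => lt_of_le_of_lt hx hb
  · rw [Finsupp.supported_eq_span_single, Submodule.span_le]
    rintro _ ⟨x, hx, rfl⟩
    exact Submodule.mem_iSup_of_mem (g x) (Submodule.mem_iSup_of_mem hx
      (Finsupp.single_mem_supported ℚ 1 (le_refl (g x))))

theorem gr_mk_eq_mk {a : P} (x y : filt g a) :
    (Submodule.Quotient.mk x : Gr g a) = Submodule.Quotient.mk y ↔
      (x : B →₀ ℚ) - y ∈ filtLT g a :=
  Submodule.Quotient.eq _

/-- The span of the basis elements of bidegree `(i, j)`. -/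
def bigraded (hom q : B → ℤ) (i j : ℤ) : Submodule ℚ (B →₀ ℚ) :=
  Finsupp.supported ℚ ℚ {x | hom x = i ∧ q x = j}

variable (hom q : B → ℤ)

/-- The basis elements of bidegree `(i, j)` and of degree `a` with respect to `g`. -/
def triset {V : Type*} (g : B → V) (i j : ℤ) (a : V) : Set B :=
  {x | hom x = i ∧ q x = j ∧ g x = a}

/-- The inclusion of the span of the basis elements of tridegree `(i, j, a)` into the associated
graded module. -/
def trisetToGr (i j : ℤ) (a : P) : Finsupp.supported ℚ ℚ (triset hom q g i j a) →ₗ[ℚ] Gr g a :=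
  (Submodule.mkQ _).comp (Submodule.inclusion
    (Finsupp.supported_mono fun _ hx => le_of_eq hx.2.2))

theorem trisetToGr_injective (i j : ℤ) (a : P) :
    Function.Injective (trisetToGr g hom q i j a) := by
  rw [← LinearMap.ker_eq_bot, LinearMap.ker_eq_bot']
  rintro ⟨x, hx⟩ h
  have h' : x ∈ filtLT g a := by
    have := (gr_mk_eq_mk g _ 0).1 h
    rwa [ZeroMemClass.coe_zero, sub_zero] at this
  rw [filtLT_eq_supported] at h'
  have : x ∈ Finsupp.supported ℚ ℚ (triset hom q g i j a ∩ {x | g x < a}) := by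
    rw [Finsupp.supported_inter]; exact ⟨hx, h'⟩
  have he : triset hom q g i j a ∩ {x | g x < a} = ∅ := by
    ext y
    simp only [triset, Set.mem_inter_iff, Set.mem_ofPred_eq, Set.mem_empty_iff_false, iff_false]
    rintro ⟨⟨-, -, h⟩, h'⟩
    exact h'.ne h
  rw [he, Finsupp.supported_empty, Submodule.mem_bot] at this
  exact Subtype.ext this

open Classical in
theorem range_trisetToGr (i j : ℤ) (a : P) :
    LinearMap.range (trisetToGr g hom q i j a) = grPart g a (bigraded hom q i j) := by
  apply le_antisymm
  · rintro _ ⟨⟨x, hx⟩, rfl⟩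
    refine ⟨_, ?_, rfl⟩
    exact fun y hy => ⟨(hx hy).1, (hx hy).2.1⟩
  · rintro _ ⟨⟨x, hx⟩, hw, rfl⟩
    replace hw : x ∈ bigraded hom q i j := hw
    refine ⟨⟨x.filter (fun y => g y = a), ?_⟩, ?_⟩
    · intro y hy
      have hy' : y ∈ x.support ∧ g y = a := by simpa using hy
      have := hw hy'.1
      exact ⟨this.1, this.2, hy'.2⟩
    · refine (gr_mk_eq_mk g _ _).2 ?_
      rw [filtLT_eq_supported]
      intro y hy
      have hne : x.filter (fun y => g y = a) y - x y ≠ 0 := Finsupp.mem_support_iff.1 hy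
      have hya : g y ≠ a := fun h => hne (by rw [Finsupp.filter_apply, if_pos h, sub_self])
      rw [Finsupp.filter_apply, if_neg hya, zero_sub, neg_ne_zero] at hne
      exact lt_of_le_of_ne (hx (Finsupp.mem_support_iff.2 hne)) hya

theorem finrank_grPart [Finite B] (i j : ℤ) (a : P) :
    Module.finrank ℚ (grPart g a (bigraded hom q i j)) = (triset hom q g i j a).ncard := by
  classical
  rw [← range_trisetToGr, LinearMap.finrank_range_of_inj (trisetToGr_injective g hom q i j a),
    (Finsupp.supportedEquivFinsupp (M := ℚ) (R := ℚ) (triset hom q g i j a)).finrank_eq]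
  have : Fintype (triset hom q g i j a) := Fintype.ofFinite _
  rw [Module.finrank_finsupp_self, Set.ncard_eq_toFinset_card', Set.toFinset_card]

variable {g hom q} {d : (B →₀ ℚ) →ₗ[ℚ] (B →₀ ℚ)} (hd : IsFiltered g d)

theorem grDiff_mk (a : P) (x : filt g a) :
    grDiff hd a (Submodule.Quotient.mk x) = Submodule.Quotient.mk ⟨d x, hd a x x.2⟩ :=
  rfl

theorem grDiff_comp_grDiff (h2 : d ∘ₗ d = 0) (a : P) (x : Gr g a) :
    grDiff hd a (grDiff hd a x) = 0 := by
  obtain ⟨x, rfl⟩ := Submodule.mkQ_surjective _ x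
  have h : d (d x) = 0 := LinearMap.congr_fun h2 x
  rw [Submodule.mkQ_apply, grDiff_mk, grDiff_mk]
  simp only [h]
  rfl

open Classical in
/-- The differential of the associated graded complex preserves the bigrading, so that its image
in each bidegree is the image of one bidegree. -/
theorem range_grDiff_inf_grPart
    (hW : ∀ i j, ∀ x ∈ bigraded hom q i j, d x ∈ bigraded hom q (i + 1) j) (a : P) (i j : ℤ) :
    LinearMap.range (grDiff hd a) ⊓ grPart g a (bigraded hom q (i + 1) j) =
      (grPart g a (bigraded hom q i j)).map (grDiff hd a) := by
  have hcomm : ∀ x : B →₀ ℚ, d (x.filter fun y => hom y = i ∧ q y = j) =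
      (d x).filter fun y => hom y = i + 1 ∧ q y = j := by
    intro x
    induction x using Finsupp.induction_linear with
    | zero => simp only [Finsupp.filter_zero, map_zero]
    | add x y hx hy => rw [Finsupp.filter_add, map_add, hx, hy, map_add, Finsupp.filter_add]
    | single b r =>
      have hb : d (Finsupp.single b r) ∈ bigraded hom q (hom b + 1) (q b) :=
        hW _ _ _ (Finsupp.single_mem_supported ℚ r ⟨rfl, rfl⟩)
      by_cases h : hom b = i ∧ q b = j
      · rw [Finsupp.filter_single_of_pos (fun y => hom y = i ∧ q y = j) h]
        rw [h.1, h.2] at hb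
        symm
        rw [Finsupp.filter_eq_self_iff]
        intro y hy
        exact hb (Finsupp.mem_support_iff.2 hy)
      · rw [Finsupp.filter_single_of_neg (fun y => hom y = i ∧ q y = j) h, map_zero]
        symm
        rw [Finsupp.filter_eq_zero_iff]
        rintro y ⟨hy1, hy2⟩
        by_contra hne
        have := hb (Finsupp.mem_support_iff.2 hne)
        simp only [Set.mem_ofPred_eq] at this
        exact h ⟨by linarith [this.1], this.2.symm.trans hy2⟩
  apply le_antisymm
  · rintro _ ⟨⟨x, rfl⟩, ⟨w, hw, hwx⟩⟩
    obtain ⟨⟨x, hx⟩, rfl⟩ := Submodule.mkQ_surjective _ x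
    obtain ⟨w, hwa⟩ := w
    replace hw : w ∈ bigraded hom q (i + 1) j := hw
    have hxf : x.filter (fun y => hom y = i ∧ q y = j) ∈ filt g a := by
      intro y hy
      exact hx (Finset.mem_filter.1 (by rwa [Finset.mem_coe, Finsupp.support_filter] at hy)).1
    refine ⟨Submodule.mkQ _ ⟨_, hxf⟩, ⟨⟨_, hxf⟩, ?_, rfl⟩, ?_⟩
    · intro y hy
      by_contra h
      refine Finsupp.mem_support_iff.1 hy ?_
      exact if_neg h
    · -- modulo lower filtration steps, `d x` agrees with `w`, which is fixed by the projection
      rw [← hwx]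
      rw [Submodule.mkQ_apply, Submodule.mkQ_apply, grDiff_mk, gr_mk_eq_mk,
        filtLT_eq_supported] at hwx
      rw [Submodule.mkQ_apply, Submodule.mkQ_apply, grDiff_mk, gr_mk_eq_mk, filtLT_eq_supported]
      intro y hy
      have hne : (d x).filter (fun y => hom y = i + 1 ∧ q y = j) y - w y ≠ 0 := by
        have : (d (x.filter fun y => hom y = i ∧ q y = j)) y - w y ≠ 0 := by simpa using hy
        rwa [hcomm] at this
      by_cases h : hom y = i + 1 ∧ q y = j
      · rw [Finsupp.filter_apply, if_pos h] at hne
        refine hwx (Finsupp.mem_support_iff.2 ?_)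
        change w y - d x y ≠ 0
        intro h0; apply hne; linarith
      · rw [Finsupp.filter_apply, if_neg h, zero_sub, neg_ne_zero] at hne
        exact absurd (hw (Finsupp.mem_support_iff.2 hne)) h
  · rintro _ ⟨_, ⟨w, hw, rfl⟩, rfl⟩
    exact ⟨⟨_, rfl⟩, ⟨d.restrict (hd a) w, hW _ _ _ hw, rfl⟩⟩

/-- The rank of the differential of the associated graded complex on one tridegree. -/
def grRank (hom q : B → ℤ) (i j : ℤ) (a : P) : ℕ :=
  Module.finrank ℚ ((grPart g a (bigraded hom q i j)).map (grDiff hd a))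

theorem finrank_grHomology [Finite B] (h2 : d ∘ₗ d = 0)
    (hW : ∀ i j, ∀ x ∈ bigraded hom q i j, d x ∈ bigraded hom q (i + 1) j) (a : P) (i j : ℤ) :
    Module.finrank ℚ (GrHomology hd a (bigraded hom q i j)) + grRank hd hom q (i - 1) j a +
      grRank hd hom q i j a = (triset hom q g i j a).ncard := by
  rw [← finrank_grPart]
  set δ := grDiff hd a with hδ
  set G := grPart g a (bigraded hom q i j) with hG
  have e1 : Module.finrank ℚ (GrHomology hd a (bigraded hom q i j)) +
      Module.finrank ℚ ((LinearMap.range δ).submoduleOf (LinearMap.ker δ ⊓ G)) =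
      Module.finrank ℚ ↥(LinearMap.ker δ ⊓ G) := Submodule.finrank_quotient_add_finrank _
  have e2 : Module.finrank ℚ ((LinearMap.range δ).submoduleOf (LinearMap.ker δ ⊓ G)) =
      grRank hd hom q (i - 1) j a := by
    have hle : LinearMap.range δ ⊓ G ≤ LinearMap.ker δ ⊓ G := by
      rintro _ ⟨⟨x, rfl⟩, hx⟩
      exact ⟨grDiff_comp_grDiff hd h2 a x, hx⟩
    have : (LinearMap.range δ).submoduleOf (LinearMap.ker δ ⊓ G) =
        (LinearMap.range δ ⊓ G).submoduleOf (LinearMap.ker δ ⊓ G) := by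
      ext ⟨x, hx⟩
      exact ⟨fun h => ⟨h, hx.2⟩, fun h => h.1⟩
    rw [this, (Submodule.submoduleOfEquivOfLe hle).finrank_eq, grRank,
      ← range_grDiff_inf_grPart hd hW]
    rw [sub_add_cancel]
  have e3 : Module.finrank ℚ (G.map δ) + Module.finrank ℚ ↥(LinearMap.ker δ ⊓ G) =
      Module.finrank ℚ G := by
    have := LinearMap.finrank_range_add_finrank_ker (δ.domRestrict G)
    rw [LinearMap.range_domRestrict] at this
    rw [← this, LinearMap.ker_domRestrict, inf_comm]
    congr 1
    have h3 : (LinearMap.ker δ).submoduleOf G = (G ⊓ LinearMap.ker δ).submoduleOf G := by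
      ext ⟨x, hx⟩
      exact ⟨fun h => ⟨hx, h⟩, fun h => h.2⟩
    exact ((Submodule.submoduleOfEquivOfLe (inf_le_left : G ⊓ LinearMap.ker δ ≤ G)).finrank_eq.symm.trans
      (by rw [← h3]; rfl))
  rw [← e3, ← e1, e2]
  change _ = grRank hd hom q i j a + _
  omega

theorem finite_tridegrees [Finite B] {V : Type*} (g : B → V) :
    {t : ℤ × ℤ × V | (∃ x, (hom x, q x, g x) = t)}.Finite :=
  Set.finite_range fun x => (hom x, q x, g x)

theorem ncard_triset_ne_zero {V : Type*} {g : B → V} {i j : ℤ} {a : V} (h : (triset hom q g i j a).ncard ≠ 0) :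
    ∃ x, (hom x, q x, g x) = (i, j, a) := by
  obtain ⟨x, hx⟩ := Set.nonempty_of_ncard_ne_zero h
  exact ⟨x, by rw [hx.1, hx.2.1, hx.2.2]⟩

theorem finitelySupported_grHomology [Finite B] (h2 : d ∘ₗ d = 0)
    (hW : ∀ i j, ∀ x ∈ bigraded hom q i j, d x ∈ bigraded hom q (i + 1) j) :
    FinitelySupported fun i j a => Module.finrank ℚ (GrHomology hd a (bigraded hom q i j)) := by
  refine (finite_tridegrees (hom := hom) (q := q) g).subset ?_
  rintro ⟨i, j, a⟩ h
  apply ncard_triset_ne_zero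
  have := finrank_grHomology hd h2 hW a i j
  simp only [Set.mem_ofPred_eq] at h
  omega

/-- The Euler characteristic of the homology of the associated graded complex is the one of the
complex itself. -/
theorem eulerChar_grHomology {V : Type*} [AddCommGroup V] [PartialOrder V] [Fintype B]
    {g : B → V} (hd : IsFiltered g d) (h2 : d ∘ₗ d = 0)
    (hW : ∀ i j, ∀ x ∈ bigraded hom q i j, d x ∈ bigraded hom q (i + 1) j) :
    eulerChar (fun i j a => Module.finrank ℚ (GrHomology hd a (bigraded hom q i j))) =
      ∑ x, ((hom x).negOnePow : ℤ) • monomial (q x) (g x) := by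
  classical
  let N : ℤ × ℤ × V → ℕ := fun t => (triset hom q g t.1 t.2.1 t.2.2).ncard
  let r : ℤ × ℤ × V → ℕ := fun t => grRank hd hom q t.1 t.2.1 t.2.2
  let sh : ℤ × ℤ × V ≃ ℤ × ℤ × V := (Equiv.subRight (1 : ℤ)).prodCongr (Equiv.refl _)
  let m : ℤ × ℤ × V → Laurent V := fun t => (t.1.negOnePow : ℤ) • monomial t.2.1 t.2.2
  have hfin := finite_tridegrees (hom := hom) (q := q) g
  have hN : ∀ t, N t ≠ 0 → t ∈ {t : ℤ × ℤ × V | (∃ x, (hom x, q x, g x) = t)} :=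
    fun t ht => ncard_triset_ne_zero ht
  have hrk := fun t : ℤ × ℤ × V => finrank_grHomology hd h2 hW t.2.2 t.1 t.2.1
  have hr : ∀ t, r t ≠ 0 → t ∈ {t : ℤ × ℤ × V | (∃ x, (hom x, q x, g x) = t)} := by
    intro t ht
    apply hN
    have := hrk t
    simp only [N, r] at *
    omega
  have hsN : (Function.support fun t => (N t : ℤ) • m t).Finite :=
    hfin.subset fun t ht => hN t fun h => ht (by simp [h])
  have hsr : (Function.support fun t => (r t : ℤ) • m t).Finite :=
    hfin.subset fun t ht => hr t fun h => ht (by simp [h])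
  have hm : ∀ t, m (sh t) = -m t := by
    intro t
    simp only [m, sh, Equiv.prodCongr_apply, Prod.map_fst, Prod.map_snd, Equiv.subRight_apply,
      Equiv.refl_apply, ← neg_smul]
    congr 1
    simp [Int.negOnePow_sub]
  have hsr' : (Function.support fun t => (r (sh t) : ℤ) • m (sh t)).Finite :=
    hsr.preimage (f := sh) (sh.injective.injOn)
  have key : eulerChar (fun i j a => Module.finrank ℚ (GrHomology hd a (bigraded hom q i j))) =
      ∑ᶠ t, ((N t : ℤ) • m t - (r t : ℤ) • m t + (r (sh t) : ℤ) • m (sh t)) := by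
    refine finsum_congr fun t => ?_
    have := hrk t
    rw [hm, smul_neg, ← sub_eq_add_neg, ← sub_smul, ← sub_smul]
    simp only [m]
    rw [smul_smul, mul_comm]
    congr 2
    simp only [N, r, sh, Equiv.prodCongr_apply, Prod.map_fst, Prod.map_snd, Equiv.subRight_apply,
      Equiv.refl_apply]
    omega
  rw [key, finsum_add_distrib ((hsN.union hsr).subset (Function.support_sub _ _)) hsr',
    finsum_sub_distrib hsN hsr, finsum_comp_equiv sh (f := fun t => (r t : ℤ) • m t),
    sub_add_cancel]
  have hsum : (fun t => (N t : ℤ) • m t) =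
      fun t => ∑ x, if (hom x, q x, g x) = t then m t else 0 := by
    funext t
    rw [← Finset.sum_filter, Finset.sum_const, ← natCast_zsmul]
    congr 2
    simp only [N]
    rw [Set.ncard_eq_toFinset_card']
    congr 1
    ext x
    rw [Set.mem_toFinset]
    simp [triset, Prod.ext_iff]
  rw [hsum, finsum_sum_comm]
  · refine Finset.sum_congr rfl fun x _ => ?_
    rw [finsum_eq_single _ (hom x, q x, g x) (fun t ht => if_neg ht.symm), if_pos rfl]
  · intro x _
    refine (Set.finite_singleton (hom x, q x, g x)).subset fun t ht => ?_
    by_contra h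
    exact ht (if_neg fun h' => h h'.symm)

end Euler

/-! ### Closed curves traced by closed paths -/

section CirclePaths

variable {X : Type*} [TopologicalSpace X] {x y : X}

theorem circleOfPath_coe (γ : Path x x) {t : ℝ} (ht : t ∈ Set.Icc (0 : ℝ) 1) :
    circleOfPath γ (t : UnitAddCircle) = γ.extend t := by
  rcases ht.2.lt_or_eq with h | rfl
  · exact AddCircle.liftIco_zero_coe_apply (f := γ.extend) ⟨ht.1, h⟩
  · have h1 : ((1 : ℝ) : UnitAddCircle) = ((0 : ℝ) : UnitAddCircle) := by
      simp [AddCircle.coe_period]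
    have h0 : circleOfPath γ ((0 : ℝ) : UnitAddCircle) = γ.extend 0 :=
      AddCircle.liftIco_zero_coe_apply (f := γ.extend) ⟨le_rfl, one_pos⟩
    rw [h1, h0]
    simp

theorem circleOfPath_coe_I (γ : Path x x) (t : I) :
    circleOfPath γ ((t : ℝ) : UnitAddCircle) = γ t := by
  rw [circleOfPath_coe γ t.2, Path.extend_apply γ t.2]

theorem circle_ext {f g : C(UnitAddCircle, X)}
    (h : ∀ t : I, f ((t : ℝ) : UnitAddCircle) = g ((t : ℝ) : UnitAddCircle)) : f = g := by
  ext z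
  obtain ⟨t, ht, rfl⟩ := (AddCircle.coe_image_Icc_eq (p := (1 : ℝ)) (a := 0)).symm ▸
    Set.mem_univ z
  exact h ⟨t, by simpa using ht⟩

theorem circleOfPath_injective {γ : Path x x} (h : Set.InjOn γ {t | t ≠ 1}) :
    Function.Injective (circleOfPath γ) := by
  have key : ∀ z : UnitAddCircle, ∃ t : I, t ≠ 1 ∧ ((t : ℝ) : UnitAddCircle) = z := by
    intro z
    obtain ⟨t, ht, rfl⟩ := (AddCircle.coe_image_Ico_eq (p := (1 : ℝ)) (a := 0)).symm ▸
      Set.mem_univ z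
    rw [zero_add] at ht
    exact ⟨⟨t, ht.1, ht.2.le⟩, fun h => ht.2.ne (congrArg Subtype.val h), rfl⟩
  intro z w hzw
  obtain ⟨s, hs, rfl⟩ := key z
  obtain ⟨t, ht, rfl⟩ := key w
  rw [circleOfPath_coe_I, circleOfPath_coe_I] at hzw
  rw [h hs ht hzw]

theorem circleOfPath_homotopic {γ δ : Path x x} (h : γ.Homotopic δ) :
    (circleOfPath γ).Homotopic (circleOfPath δ) := by
  obtain ⟨H⟩ := h
  -- for each parameter on the circle, the track of that point under the homotopy
  let G : C(I, C(I, X)) := (H.toContinuousMap.comp .prodSwap).curry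
  have hG : ∀ t s : I, G t s = H (s, t) := fun _ _ => rfl
  let Γ : C(UnitAddCircle, C(I, X)) :=
    ⟨AddCircle.liftIco 1 0 (fun t => G (Set.projIcc 0 1 zero_le_one t)),
      AddCircle.liftIco_zero_continuous (by
        ext s
        rw [Set.projIcc_left, Set.projIcc_right]
        change H (s, 0) = H (s, 1)
        rw [Path.Homotopy.source, Path.Homotopy.target])
        (G.continuous.comp continuous_projIcc).continuousOn⟩
  have hΓ : ∀ t s : I, Γ ((t : ℝ) : UnitAddCircle) s = H (s, t) := by
    intro t s
    rcases eq_or_ne t 1 with rfl | ht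
    · have h1 : (((1 : I) : ℝ) : UnitAddCircle) = ((0 : ℝ) : UnitAddCircle) := by
        simp [AddCircle.coe_period]
      rw [h1]
      change AddCircle.liftIco 1 0 (fun t => G (Set.projIcc 0 1 zero_le_one t)) _ s = _
      rw [AddCircle.liftIco_zero_coe_apply ⟨le_rfl, one_pos⟩, Set.projIcc_left]
      change H (s, 0) = H (s, 1)
      rw [Path.Homotopy.source, Path.Homotopy.target]
    · change AddCircle.liftIco 1 0 (fun t => G (Set.projIcc 0 1 zero_le_one t)) _ s = _
      rw [AddCircle.liftIco_zero_coe_apply ⟨t.2.1, lt_of_le_of_ne t.2.2 fun h => ht (Subtype.ext h)⟩,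
        Set.projIcc_of_mem _ t.2]
      rfl
  have e0 : ∀ z, Γ z 0 = circleOfPath γ z := by
    have : (⟨fun z => Γ z 0, by fun_prop⟩ : C(UnitAddCircle, X)) = circleOfPath γ := by
      apply circle_ext
      intro t
      rw [circleOfPath_coe_I]
      simp [hΓ]
    exact fun z => DFunLike.congr_fun this z
  have e1 : ∀ z, Γ z 1 = circleOfPath δ z := by
    have : (⟨fun z => Γ z 1, by fun_prop⟩ : C(UnitAddCircle, X)) = circleOfPath δ := by
      apply circle_ext
      intro t
      rw [circleOfPath_coe_I]
      simp [hΓ]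
    exact fun z => DFunLike.congr_fun this z
  exact ⟨⟨Γ.uncurry.comp .prodSwap, fun z => e0 z, fun z => e1 z⟩⟩

theorem circleOfPath_congr {γ δ : Path x x}
    (h : Path.Homotopic.Quotient.mk γ = Path.Homotopic.Quotient.mk δ) :
    (circleOfPath γ).Homotopic (circleOfPath δ) :=
  circleOfPath_homotopic (Path.Homotopic.Quotient.exact h)

/-- Moving the base point along a closed curve is a rotation of the circle by a half turn. -/
theorem circleOfPath_trans_comm (a : Path x y) (b : Path y x) :
    (circleOfPath (a.trans b)).Homotopic (circleOfPath (b.trans a)) := by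
  let rot : C(I × UnitAddCircle, UnitAddCircle) :=
    ⟨fun z => z.2 + (((z.1 : ℝ) / 2 : ℝ) : UnitAddCircle), by
      refine continuous_snd.add ((AddCircle.continuous_mk' 1).comp ?_)
      fun_prop⟩
  refine ⟨⟨(circleOfPath (a.trans b)).comp rot, fun z => ?_, fun z => ?_⟩⟩
  · simp [rot]
  · have : (circleOfPath (a.trans b)).comp (rot.comp ⟨fun z => (1, z), by fun_prop⟩) =
        circleOfPath (b.trans a) := by
      apply circle_ext
      intro t
      have ht := t.2
      rw [circleOfPath_coe_I, ← Path.extend_apply _ t.2]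
      simp only [ContinuousMap.comp_apply, ContinuousMap.coe_mk, rot, Set.Icc.coe_one]
      rw [← AddCircle.coe_add]
      rcases le_total (t : ℝ) (1 / 2) with h | h
      · rw [circleOfPath_coe _ ⟨by linarith [ht.1], by linarith⟩,
          Path.extend_trans_of_half_le _ _ (by linarith [ht.1]),
          Path.extend_trans_of_le_half _ _ h]
        congr 1
        ring
      · have e : (((t : ℝ) + 1 / 2 : ℝ) : UnitAddCircle) = (((t : ℝ) - 1 / 2 : ℝ) : UnitAddCircle) := by
          have : (t : ℝ) + 1 / 2 = ((t : ℝ) - 1 / 2) + 1 := by ring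
          rw [this]
          exact AddCircle.coe_add_period 1 _
        rw [e, circleOfPath_coe _ ⟨by linarith, by linarith [ht.2]⟩,
          Path.extend_trans_of_le_half _ _ (by linarith [ht.2]),
          Path.extend_trans_of_half_le _ _ h]
        congr 1
        ring
    exact DFunLike.congr_fun this z

theorem circleOfPath_symm (γ : Path x x) :
    circleOfPath γ.symm = (circleOfPath γ).comp circleNeg := by
  apply circle_ext
  intro t
  rw [circleOfPath_coe_I]
  change γ (unitInterval.symm t) = _
  rw [← circleOfPath_coe_I]
  simp only [ContinuousMap.comp_apply, circleNeg, ContinuousMap.coe_mk, unitInterval.coe_symm_eq]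
  congr 1
  rw [sub_eq_add_neg, AddCircle.coe_add, AddCircle.coe_neg]
  have h1 : ((1 : ℝ) : UnitAddCircle) = 0 := AddCircle.coe_period 1
  rw [h1, zero_add]

theorem circleOfPath_refl (x : X) : circleOfPath (Path.refl x) = ContinuousMap.const _ x := by
  apply circle_ext
  intro t
  rw [circleOfPath_coe_I]
  rfl

/-- A closed path whose closed curve is freely nullhomotopic is trivial in the fundamental group. -/
theorem mk_eq_refl_of_nullhomotopic {γ : Path x x} (h : (circleOfPath γ).Nullhomotopic) :
    Path.Homotopic.Quotient.mk γ = Path.Homotopic.Quotient.refl x := by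
  obtain ⟨z, ⟨F⟩⟩ := h
  let p : Path (((0 : I) : ℝ) : UnitAddCircle) (((1 : I) : ℝ) : UnitAddCircle) :=
    ⟨⟨fun t : I => ((t : ℝ) : UnitAddCircle),
      (AddCircle.continuous_mk' 1).comp continuous_subtype_val⟩, rfl, rfl⟩
  have hp1 : (((1 : I) : ℝ) : UnitAddCircle) = (((0 : I) : ℝ) : UnitAddCircle) := by
    simp [AddCircle.coe_period]
  have key : ∀ (z₁ : UnitAddCircle) (h : z₁ = (((0 : I) : ℝ) : UnitAddCircle))
      (p : Path (((0 : I) : ℝ) : UnitAddCircle) z₁),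
      Path.Homotopic.Quotient.mk ((p.map (map_continuous (circleOfPath γ))).cast rfl
        (congrArg (circleOfPath γ) h.symm)) = Path.Homotopic.Quotient.refl _ := by
    rintro _ rfl p
    have h1 := Path.Homotopic.Quotient.eq.2 (Path.Homotopic.map_trans_evalAt F p)
    simp only [Path.Homotopic.Quotient.mk_trans] at h1
    have h2 : p.map (map_continuous (ContinuousMap.const UnitAddCircle z)) =
        Path.refl (ContinuousMap.const UnitAddCircle z (((0 : I) : ℝ) : UnitAddCircle)) := by
      ext t; rfl
    have h3 := congrArg (fun q => q.trans
      (Path.Homotopic.Quotient.mk (F.evalAt (((0 : I) : ℝ) : UnitAddCircle))).symm) h1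
    simp only [Path.Homotopic.Quotient.trans_assoc, Path.Homotopic.Quotient.trans_symm,
      Path.Homotopic.Quotient.trans_refl] at h3
    refine Eq.trans (b := Path.Homotopic.Quotient.mk (p.map (map_continuous (circleOfPath γ)))) rfl
      (h3.trans ?_)
    rw [h2, Path.Homotopic.Quotient.mk_refl, Path.Homotopic.Quotient.refl_trans,
      Path.Homotopic.Quotient.trans_symm]
  have h := key _ hp1 p
  have hx : circleOfPath γ (((0 : I) : ℝ) : UnitAddCircle) = x := by
    rw [circleOfPath_coe_I, γ.source]
  have h' := congrArg (fun q => q.cast hx.symm hx.symm) h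
  have e1 : ((p.map (map_continuous (circleOfPath γ))).cast rfl
      (congrArg (circleOfPath γ) hp1.symm)).cast hx.symm hx.symm = γ := by
    ext t
    exact circleOfPath_coe_I γ t
  have e2 : (Path.refl (circleOfPath γ (((0 : I) : ℝ) : UnitAddCircle))).cast hx.symm hx.symm =
      Path.refl x := by
    ext t
    exact hx
  simp only [← Path.Homotopic.Quotient.mk_cast, ← Path.Homotopic.Quotient.mk_refl] at h'
  rw [e1, e2] at h'
  exact h'

/-! ### Conjugate loops and their inverses -/

theorem circleNeg_homotopic {f g : C(UnitAddCircle, X)} (h : f.Homotopic g) :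
    (f.comp circleNeg).Homotopic (g.comp circleNeg) :=
  h.comp (.refl circleNeg)

theorem nullhomotopic_of_homotopic {f g : C(UnitAddCircle, X)} (h : f.Homotopic g)
    (hg : g.Nullhomotopic) : f.Nullhomotopic := by
  obtain ⟨z, hz⟩ := hg
  exact ⟨z, h.trans hz⟩

theorem nullhomotopic_comp_circleNeg {f : C(UnitAddCircle, X)} (hf : f.Nullhomotopic) :
    (f.comp circleNeg).Nullhomotopic := by
  obtain ⟨z, hz⟩ := hf
  exact ⟨z, circleNeg_homotopic hz⟩

end CirclePaths

/-! ### Logarithms along paths -/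

/-- `γ` can be written as `exp θ` with `θ` continuous and with total increment `δ`. -/
def HasLogIncrement (γ : I → ℂ) (δ : ℂ) : Prop :=
  ∃ θ : C(I, ℂ), (∀ t, γ t = Complex.exp (θ t)) ∧ θ 1 - θ 0 = δ

theorem hasWinding_iff_hasLogIncrement {γ : UnitAddCircle → ℂ} {p : ℂ} {k : ℤ} :
    HasWinding γ p k ↔ HasLogIncrement (fun t : I => γ ((t : ℝ) : UnitAddCircle) - p)
      (2 * Real.pi * Complex.I * k) := by
  simp only [HasWinding, HasLogIncrement, sub_eq_iff_eq_add']

theorem exists_hasLogIncrement (γ : C(I, ℂ)) (h : ∀ t, γ t ≠ 0) : ∃ δ, HasLogIncrement γ δ := by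
  let G : C(I, {z : ℂ // z ≠ 0}) := ⟨fun t => ⟨γ t, h t⟩, by fun_prop⟩
  have h0 : G 0 = ⟨Complex.exp (Complex.log (γ 0)), Complex.exp_ne_zero _⟩ :=
    Subtype.ext (Complex.exp_log (h 0)).symm
  obtain ⟨θ, hθ, -⟩ := Complex.isCoveringMap_exp.exists_path_lifts G _ h0
  exact ⟨_, θ, fun t => congrArg Subtype.val (congrFun hθ t).symm, rfl⟩

theorem exists_hasWinding (γ : C(UnitAddCircle, ℂ)) (p : ℂ) (h : ∀ t, γ t ≠ p) :
    ∃ k, HasWinding γ p k := by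
  obtain ⟨δ, θ, hθ, hδ⟩ := exists_hasLogIncrement
    ⟨fun t : I => γ ((t : ℝ) : UnitAddCircle) - p,
      (γ.continuous.comp ((AddCircle.continuous_mk' 1).comp continuous_subtype_val)).sub
        continuous_const⟩ fun t => sub_ne_zero.2 (h _)
  have h1 : (((1 : I) : ℝ) : UnitAddCircle) = (((0 : I) : ℝ) : UnitAddCircle) := by
    simp [AddCircle.coe_period]
  have : Complex.exp (θ 1) = Complex.exp (θ 0) := by
    rw [← hθ, ← hθ]
    change γ _ - p = γ _ - p
    rw [h1]
  obtain ⟨k, hk⟩ := Complex.exp_eq_exp_iff_exists_int.1 this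
  refine ⟨k, hasWinding_iff_hasLogIncrement.2 ⟨θ, hθ, ?_⟩⟩
  rw [hk]
  ring

theorem HasLogIncrement.trans {a b c : ℂ} {γ : Path a b} {δ : Path b c} {u v : ℂ}
    (hγ : HasLogIncrement γ u) (hδ : HasLogIncrement δ v) :
    HasLogIncrement (γ.trans δ) (u + v) := by
  obtain ⟨θ, hθ, hu⟩ := hγ
  obtain ⟨η, hη, hv⟩ := hδ
  have hexp : Complex.exp (θ 1 - η 0) = 1 := by
    rw [Complex.exp_sub, ← hθ, ← hη, γ.target, δ.source, div_self]
    rw [← γ.target, hθ]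
    exact Complex.exp_ne_zero _
  let p : Path (θ 0) (θ 1) := ⟨θ, rfl, rfl⟩
  let q : Path (θ 1) (η 1 + (θ 1 - η 0)) := ⟨⟨fun t => η t + (θ 1 - η 0), by fun_prop⟩, by simp, rfl⟩
  refine ⟨(p.trans q).toContinuousMap, fun t => ?_, ?_⟩
  · change (γ.trans δ) t = Complex.exp ((p.trans q) t)
    rw [Path.trans_apply, Path.trans_apply]
    split_ifs with h
    · exact hθ _
    · change _ = Complex.exp (η _ + (θ 1 - η 0))
      rw [Complex.exp_add, hexp, mul_one]
      exact hη _
  · change (p.trans q) 1 - (p.trans q) 0 = _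
    rw [Path.target, Path.source, ← hu, ← hv]
    ring

section Winding

variable {n : ℕ} {X : PuncturedDisk n}

theorem exists_hasWinding_puncture (γ : C(UnitAddCircle, X.carrier)) (i : Fin n) :
    ∃ k, HasWinding (fun t => (γ t : ℂ)) (X.puncture i) k :=
  exists_hasWinding ⟨fun t => (γ t : ℂ), by fun_prop⟩ _ fun t => (γ t).2.2 i

/-- Homology classes are additive for the concatenation of closed paths. -/
theorem orientedClass_trans {x : X.carrier} (a b : Path x x) :
    orientedClass X (circleOfPath (a.trans b)) =
      orientedClass X (circleOfPath a) + orientedClass X (circleOfPath b) := by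
  funext i
  obtain ⟨k, hk⟩ := exists_hasWinding_puncture (circleOfPath a) i
  obtain ⟨l, hl⟩ := exists_hasWinding_puncture (circleOfPath b) i
  have hf : Continuous fun z : X.carrier => (z : ℂ) - X.puncture i := by fun_prop
  have key : HasWinding (fun t => (circleOfPath (a.trans b) t : ℂ)) (X.puncture i) (k + l) := by
    rw [hasWinding_iff_hasLogIncrement] at hk hl ⊢
    simp only [circleOfPath_coe_I] at hk hl ⊢
    have := HasLogIncrement.trans (γ := a.map hf) (δ := b.map hf) hk hl
    rw [← Path.map_trans] at this
    have e : (2 * Real.pi * Complex.I * ((k + l : ℤ) : ℂ) : ℂ) =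
      2 * Real.pi * Complex.I * k + 2 * Real.pi * Complex.I * l := by push_cast; ring
    rw [e]
    exact this
  simp only [orientedClass, Pi.add_apply]
  rw [key.winding_eq, hk.winding_eq, hl.winding_eq]

theorem orientedClass_const (x : X.carrier) :
    orientedClass X (ContinuousMap.const _ x) = 0 := by
  have h := orientedClass_trans (Path.refl x) (Path.refl x)
  rw [Path.refl_trans_refl, circleOfPath_refl] at h
  simpa using h

theorem positiveClass_of_nullhomotopic {γ : C(UnitAddCircle, X.carrier)} (h : γ.Nullhomotopic) :
    positiveClass X γ = 0 := by
  obtain ⟨x, hx⟩ := h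
  funext i
  rw [positiveClass, orientedClass_eq_of_homotopic hx, orientedClass_const]
  simp

theorem positiveClass_congr {γ δ : C(UnitAddCircle, X.carrier)} (h : UnorientedHomotopic γ δ) :
    positiveClass X γ = positiveClass X δ := by
  funext i
  rcases h with h | h
  · simp only [positiveClass, orientedClass_eq_of_homotopic h]
  · simp only [positiveClass, orientedClass_eq_of_homotopic h, orientedClass_neg, Pi.neg_apply,
      abs_neg]

end Winding

/-! ### Planarity: paths with interlaced end points on a circle -/

theorem HasLogIncrement.div {γ δ : I → ℂ} {u v : ℂ} (hγ : HasLogIncrement γ u)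
    (hδ : HasLogIncrement δ v) : HasLogIncrement (fun t => γ t / δ t) (u - v) := by
  obtain ⟨θ, hθ, rfl⟩ := hγ
  obtain ⟨η, hη, rfl⟩ := hδ
  refine ⟨θ - η, fun t => ?_, ?_⟩
  · simp only [hθ, hη, ← Complex.exp_sub]
    rfl
  · simp only [ContinuousMap.sub_apply]
    ring

/-- A path in the closed right half plane without the origin has the principal logarithm. -/
theorem hasLogIncrement_of_re_nonneg {γ : I → ℂ} (hγ : Continuous γ) (h0 : ∀ t, γ t ≠ 0)
    (hre : ∀ t, 0 ≤ (γ t).re) : HasLogIncrement γ (Complex.log (γ 1) - Complex.log (γ 0)) := by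
  refine ⟨⟨fun t => Complex.log (γ t), hγ.clog fun t => ?_⟩, fun t => (Complex.exp_log (h0 t)).symm,
    rfl⟩
  rw [Complex.mem_slitPlane_iff]
  rcases (hre t).lt_or_eq with h | h
  · exact Or.inl h
  · exact Or.inr fun him => h0 t (Complex.ext h.symm him)

theorem HasLogIncrement.neg {γ : I → ℂ} {u : ℂ} (h : HasLogIncrement γ u) :
    HasLogIncrement (fun t => -γ t) u := by
  obtain ⟨θ, hθ, rfl⟩ := h
  refine ⟨⟨fun t => θ t + Real.pi * Complex.I, by fun_prop⟩, fun t => ?_, ?_⟩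
  · simp only [ContinuousMap.coe_mk]
    rw [Complex.exp_add, Complex.exp_pi_mul_I, hθ]
    ring
  · simp

/-- Inversion of the roles of the inside and the outside of the unit circle: the real part of the
Cayley transform has the sign of `‖u‖ ^ 2 - 1`. -/
theorem cayley_re (u : ℂ) :
    ((u - Complex.I) / (u + Complex.I)).re =
      (Complex.normSq u - 1) / Complex.normSq (u + Complex.I) := by
  rw [Complex.div_re, ← add_div]
  congr 1
  simp [Complex.normSq_apply]
  ring

/-- Two paths in the plane that stay outside a round disk and whose end points alternate on its
boundary circle intersect. Otherwise the first one, closed up by a diameter, would have the same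
winding number around both end points of the second one; but the quotient of the distance vectors
to these end points runs from `-I` to `I` in the right half plane along the path and back in the
left half plane along the diameter, so that the winding numbers differ by one. -/
theorem exists_eq_of_alternating {c w : ℂ} (hw : w ≠ 0) (P : Path (c + w) (c - w))
    (Q : Path (c + w * Complex.I) (c - w * Complex.I)) (hP : ∀ t, ‖w‖ ≤ ‖P t - c‖)
    (hQ : ∀ t, ‖w‖ ≤ ‖Q t - c‖) : ∃ s t, P s = Q t := by
  by_contra! hPQ
  have hw' : ‖w‖ ≠ 0 := norm_ne_zero_iff.2 hw
  -- the diameter back to the start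
  let diam : Path (c - w) (c + w) :=
    ⟨⟨fun t => c + w * ((2 * (t : ℝ) - 1 : ℝ) : ℂ), by fun_prop⟩, by simp [sub_eq_add_neg],
      by simp only [Set.Icc.coe_one]; norm_num⟩
  have hd : ∀ t, diam t = c + w * ((2 * (t : ℝ) - 1 : ℝ) : ℂ) := fun _ => rfl
  let M : ℂ → ℂ := fun z => (z - (c + w * Complex.I)) / (z - (c - w * Complex.I))
  have hM : ∀ u : ℂ, M (c + w * u) = (u - Complex.I) / (u + Complex.I) := by
    intro u
    simp only [M]
    rw [show c + w * u - (c + w * Complex.I) = w * (u - Complex.I) by ring,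
      show c + w * u - (c - w * Complex.I) = w * (u + Complex.I) by ring,
      mul_div_mul_left _ _ hw]
  have hu : ∀ z, z = c + w * ((z - c) / w) := fun z => by field_simp; ring
  have hMre : ∀ z, ‖w‖ ≤ ‖z - c‖ → 0 ≤ (M z).re := by
    intro z hz
    rw [hu z, hM, cayley_re]
    refine div_nonneg ?_ (Complex.normSq_nonneg _)
    rw [Complex.normSq_eq_norm_sq, norm_div, div_pow, sub_nonneg,
      one_le_div (by positivity)]
    gcongr
  have hMre' : ∀ z, ‖z - c‖ ≤ ‖w‖ → 0 ≤ (-M z).re := by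
    intro z hz
    rw [Complex.neg_re, neg_nonneg, hu z, hM, cayley_re]
    refine div_nonpos_of_nonpos_of_nonneg ?_ (Complex.normSq_nonneg _)
    rw [Complex.normSq_eq_norm_sq, norm_div, div_pow, sub_nonpos,
      div_le_one (by positivity)]
    gcongr
  have hP1 : ∀ t, P t - (c + w * Complex.I) ≠ 0 := fun t h =>
    hPQ t 0 (by rw [Q.source]; linear_combination h)
  have hP3 : ∀ t, P t - (c - w * Complex.I) ≠ 0 := fun t h =>
    hPQ t 1 (by rw [Q.target]; linear_combination h)
  have hdI : ∀ (t : I) (z : ℂ), z = Complex.I ∨ z = -Complex.I → diam t ≠ c + w * z := by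
    intro t z hz h
    rw [hd] at h
    have h1 : ((2 * (t : ℝ) - 1 : ℝ) : ℂ) = z := mul_left_cancel₀ hw (add_left_cancel h)
    have h2 := congrArg Complex.im h1
    rcases hz with rfl | rfl <;> simp at h2
  have hd1 : ∀ t, diam t - (c + w * Complex.I) ≠ 0 := fun t h =>
    hdI t _ (Or.inl rfl) (by linear_combination h)
  have hd3 : ∀ t, diam t - (c - w * Complex.I) ≠ 0 := fun t h =>
    hdI t _ (Or.inr rfl) (by linear_combination h)
  have hdn : ∀ t, ‖diam t - c‖ ≤ ‖w‖ := by
    intro t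
    rw [hd, add_sub_cancel_left, norm_mul, Complex.norm_real, Real.norm_eq_abs]
    refine mul_le_of_le_one_right (norm_nonneg _) (abs_le.2 ⟨?_, ?_⟩)
    · linarith [t.2.1]
    · linarith [t.2.2]
  have hM1 : M (c + w) = -Complex.I := by
    have := hM 1
    rw [mul_one] at this
    rw [this, div_eq_iff (by intro h; have := congrArg Complex.im h; simp at this)]
    linear_combination Complex.I_sq
  have hM2 : M (c - w) = Complex.I := by
    have := hM (-1)
    rw [mul_neg, mul_one, ← sub_eq_add_neg] at this
    rw [this, div_eq_iff (by intro h; have := congrArg Complex.im h; simp at this)]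
    linear_combination -Complex.I_sq
  let MP : Path (M (c + w)) (M (c - w)) :=
    ⟨⟨fun t => M (P t), (P.continuous.sub continuous_const).div
      (P.continuous.sub continuous_const) hP3⟩, by simp, by simp⟩
  let Md : Path (M (c - w)) (M (c + w)) :=
    ⟨⟨fun t => M (diam t), (diam.continuous.sub continuous_const).div
      (diam.continuous.sub continuous_const) hd3⟩, by simp, by simp⟩
  have i1 : HasLogIncrement MP (Real.pi * Complex.I) := by
    have := hasLogIncrement_of_re_nonneg MP.continuous (fun t => div_ne_zero (hP1 t) (hP3 t))
      fun t => hMre _ (hP t)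
    have e : Complex.log (M (c - w)) - Complex.log (M (c + w)) = Real.pi * Complex.I := by
      rw [hM1, hM2, Complex.log_I, Complex.log_neg_I]
      ring
    rwa [MP.source, MP.target, e] at this
  have i2 : HasLogIncrement Md (Real.pi * Complex.I) := by
    have := (hasLogIncrement_of_re_nonneg (γ := fun t => -Md t) Md.continuous.neg
      (fun t => neg_ne_zero.2 (div_ne_zero (hd1 t) (hd3 t))) fun t => hMre' _ (hdn t)).neg
    have e : Complex.log (-M (c + w)) - Complex.log (-M (c - w)) = Real.pi * Complex.I := by
      rw [hM1, hM2, neg_neg, Complex.log_I, Complex.log_neg_I]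
      ring
    rw [Md.source, Md.target, e] at this
    simpa only [neg_neg] using this
  have i3 := i1.trans i2
  -- the closed curve avoids the second path
  have hγQ : ∀ (s : I) (z : UnitAddCircle), circleOfPath (P.trans diam) z ≠ Q s := by
    intro s z
    have hz : circleOfPath (P.trans diam) z ∈ Set.range (P.trans diam) := by
      obtain ⟨t, ht, rfl⟩ := (AddCircle.coe_image_Icc_eq (p := (1 : ℝ)) (a := 0)).symm ▸
        Set.mem_univ z
      rw [zero_add] at ht
      exact ⟨⟨t, ht⟩, (circleOfPath_coe_I (P.trans diam) ⟨t, ht⟩).symm⟩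
    rw [Path.trans_range] at hz
    rcases hz with ⟨t, ht⟩ | ⟨t, ht⟩
    · rw [← ht]; exact hPQ t s
    · rw [← ht]
      intro h
      have h1 : ‖diam t - c‖ = ‖w‖ := le_antisymm (hdn t) (h ▸ hQ s)
      rw [hd, add_sub_cancel_left, norm_mul, Complex.norm_real, Real.norm_eq_abs,
        mul_eq_left₀ hw'] at h1
      rcases eq_or_eq_neg_of_abs_eq h1 with h2 | h2
      · apply hPQ 0 s
        rw [← h, hd, h2, P.source]
        push_cast
        ring
      · apply hPQ 1 s
        rw [← h, hd, h2, P.target]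
        push_cast
        ring
  obtain ⟨k, hk⟩ := exists_hasWinding (circleOfPath (P.trans diam)) (Q 0) (hγQ 0)
  let H : C(I × UnitAddCircle, ℂ) := ⟨fun x => circleOfPath (P.trans diam) x.2 - Q x.1, by fun_prop⟩
  have j1 : HasWinding (fun t => H (0, t)) 0 k := by
    rw [hasWinding_iff_hasLogIncrement] at hk ⊢
    simpa only [H, ContinuousMap.coe_mk, sub_zero] using hk
  have j2 := HasWinding.of_homotopy H (fun x => sub_ne_zero.2 (hγQ x.1 x.2)) j1
  rw [hasWinding_iff_hasLogIncrement] at j1 j2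
  have j3 := j1.div j2
  rw [sub_self] at j3
  have e : ∀ t, (MP.trans Md) t = M ((P.trans diam) t) := by
    intro t
    rw [Path.trans_apply, Path.trans_apply]
    split_ifs <;> rfl
  have k0 : HasWinding (circleOfPath (MP.trans Md)) 0 0 := by
    rw [hasWinding_iff_hasLogIncrement]
    simp only [H, ContinuousMap.coe_mk, sub_zero, circleOfPath_coe_I, Q.source, Q.target] at j3
    simp only [sub_zero, circleOfPath_coe_I, e, Int.cast_zero, mul_zero]
    exact j3
  have k1 : HasWinding (circleOfPath (MP.trans Md)) 0 1 := by
    rw [hasWinding_iff_hasLogIncrement]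
    simp only [sub_zero, circleOfPath_coe_I, Int.cast_one, mul_one]
    convert! i3 using 1
    ring
  exact zero_ne_one (k0.unique k1)

/-! ### Orbits of the product of two involutions -/

section Dihedral

variable {T : Type*} {α β : T → T}

theorem iterate_involution_left (i : ℕ) (x : T) :
    α ((fun x => β (α x))^[i] x) = (fun x => α (β x))^[i] (α x) := by
  have h : Function.Semiconj α (fun x => β (α x)) (fun x => α (β x)) := fun x => rfl
  exact (h.iterate_right i) x

theorem iterate_involution_right (hβ : ∀ x, β (β x) = x) (i : ℕ) (x : T) :
    β ((fun x => β (α x))^[i] x) = (fun x => α (β x))^[i] (β x) := by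
  have h : Function.Semiconj β (fun x => β (α x)) (fun x => α (β x)) := fun x => by simp [hβ]
  exact (h.iterate_right i) x

theorem iterate_involution_inv (hα : ∀ x, α (α x) = x) (hβ : ∀ x, β (β x) = x) (i : ℕ) (x : T) :
    (fun x => α (β x))^[i] ((fun x => β (α x))^[i] x) = x := by
  have h : Function.LeftInverse (fun x => α (β x)) (fun x => β (α x)) := fun x => by simp [hα, hβ]
  exact h.iterate i x

theorem involution_mul_injective (hα : ∀ x, α (α x) = x) (hβ : ∀ x, β (β x) = x) :
    Function.Injective fun x => β (α x) :=
  Function.LeftInverse.injective (g := fun x => α (β x)) fun x => by simp [hα, hβ]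

theorem minimalPeriod_pos_of_finite [Finite T] {f : T → T} (hf : Function.Injective f) (a : T) :
    0 < Function.minimalPeriod f a :=
  Function.minimalPeriod_pos_of_mem_periodicPts (hf.mem_periodicPts a)

theorem exists_iterate_eq_of_iterate_eq [Finite T] {f : T → T} (hf : Function.Injective f)
    {a b : T} {i : ℕ} (h : f^[i] a = b) : ∃ k, f^[k] b = a := by
  refine ⟨i * (Function.minimalPeriod f a - 1), ?_⟩
  have hN := minimalPeriod_pos_of_finite hf a
  rw [← h, ← Function.iterate_add_apply]
  have : i * (Function.minimalPeriod f a - 1) + i = i * Function.minimalPeriod f a := by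
    obtain ⟨m, hm⟩ : ∃ m, Function.minimalPeriod f a = m + 1 := ⟨_, (Nat.sub_add_cancel hN).symm⟩
    rw [hm, Nat.add_sub_cancel]; ring
  rw [this]
  exact (Function.isPeriodicPt_minimalPeriod f a).const_mul i

/-- If neither involution has a fixed point, the two directions of an orbit stay apart. -/
theorem iterate_ne_involution (hα : ∀ x, α (α x) = x) (hβ : ∀ x, β (β x) = x)
    (hα' : ∀ x, α x ≠ x) (hβ' : ∀ x, β x ≠ x) (a : T) (i k : ℕ) :
    (fun x => β (α x))^[i] a ≠ α ((fun x => β (α x))^[k] a) := by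
  intro h
  rw [iterate_involution_left (α := α)] at h
  have h1 : α a = (fun x => β (α x))^[k + i] a := by
    apply ((involution_mul_injective hβ hα).iterate k)
    rw [Function.iterate_add_apply, iterate_involution_inv hα hβ, h]
  rcases Nat.even_or_odd' (k + i) with ⟨l, hl | hl⟩
  · apply hα' ((fun x => β (α x))^[l] a)
    rw [iterate_involution_left (α := α), h1, hl, two_mul, Function.iterate_add_apply,
      iterate_involution_inv hα hβ]
  · have h2 : α ((fun x => β (α x))^[l] a) = (fun x => β (α x))^[l + 1] a := by
      rw [iterate_involution_left (α := α), h1, hl, two_mul, add_assoc, Function.iterate_add_apply,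
        iterate_involution_inv hα hβ]
    rw [Function.iterate_succ_apply'] at h2
    exact hβ' _ h2.symm

variable [Finite T]

/-- The orbit of a fixed point of `β` is closed under both involutions. -/
theorem orbit_closed_left (hα : ∀ x, α (α x) = x) (hβ : ∀ x, β (β x) = x) {a b : T}
    (ha : β a = a) (hb : ∃ i, (fun x => β (α x))^[i] a = b) :
    ∃ i, (fun x => β (α x))^[i] a = α b := by
  obtain ⟨i, rfl⟩ := hb
  have hf := involution_mul_injective hα hβ
  rw [iterate_involution_left (α := α)]
  have h : (fun x => α (β x))^[i] (α a) = (fun x => α (β x))^[i + 1] a := by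
    rw [Function.iterate_succ_apply, ha]
  rw [h]
  obtain ⟨k, hk⟩ := exists_iterate_eq_of_iterate_eq hf
    (a := (fun x => α (β x))^[i + 1] a) (b := a) (i := i + 1)
    (iterate_involution_inv hβ hα (i + 1) a)
  exact ⟨k, hk⟩

theorem orbit_closed_right (hα : ∀ x, α (α x) = x) (hβ : ∀ x, β (β x) = x) {a b : T}
    (ha : β a = a) (hb : ∃ i, (fun x => β (α x))^[i] a = b) :
    ∃ i, (fun x => β (α x))^[i] a = β b := by
  obtain ⟨i, hi⟩ := orbit_closed_left hα hβ ha hb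
  refine ⟨i + 1, ?_⟩
  rw [Function.iterate_succ_apply', hi, hα]

/-- If `α` has no fixed points, the orbit of a fixed point of `β` contains another one. -/
theorem exists_other_fixed (hα : ∀ x, α (α x) = x) (hβ : ∀ x, β (β x) = x)
    (hα' : ∀ x, α x ≠ x) {a : T} (ha : β a = a) :
    ∃ b, b ≠ a ∧ β b = b ∧ ∃ i, (fun x => β (α x))^[i] a = b := by
  have hN := minimalPeriod_pos_of_finite (involution_mul_injective hα hβ) a
  have hp : (fun x => β (α x))^[Function.minimalPeriod (fun x => β (α x)) a] a = a :=
    Function.iterate_minimalPeriod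
  rcases Nat.even_or_odd' (Function.minimalPeriod (fun x => β (α x)) a) with ⟨m, hm | hm⟩
  · refine ⟨(fun x => β (α x))^[m] a, fun h => ?_, ?_, m, rfl⟩
    · exact Function.not_isPeriodicPt_of_pos_of_lt_minimalPeriod (by omega) (by omega) h
    · rw [iterate_involution_right hβ, ha]
      rw [hm, two_mul, Function.iterate_add_apply] at hp
      nth_rewrite 1 [← hp]
      rw [iterate_involution_inv hα hβ]
  · exfalso
    apply hα' ((fun x => β (α x))^[m] a)
    have h : (fun x => α (β x))^[m] (α a) = (fun x => α (β x))^[m + 1] a := by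
      rw [Function.iterate_succ_apply, ha]
    rw [iterate_involution_left (α := α), h]
    conv_lhs => rw [← hp, hm, show 2 * m + 1 = (m + 1) + m by ring,
      Function.iterate_add_apply (fun x => β (α x))]
    exact iterate_involution_inv hα hβ (m + 1) _

/-- The orbit of a fixed point of `β` contains at most one other fixed point. -/
theorem other_fixed_unique (hα : ∀ x, α (α x) = x) (hβ : ∀ x, β (β x) = x)
    {a b c : T} (ha : β a = a)
    (hb : β b = b) (hba : b ≠ a) (hbi : ∃ i, (fun x => β (α x))^[i] a = b)
    (hc : β c = c) (hca : c ≠ a) (hci : ∃ i, (fun x => β (α x))^[i] a = c) : b = c := by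
  have key : ∀ b, β b = b → b ≠ a → ∀ i, (fun x => β (α x))^[i] a = b →
      ∃ m, Function.minimalPeriod (fun x => β (α x)) a = 2 * m ∧
        i % (2 * m) = m := by
    intro b hb hba i hi
    have h1 : Function.IsPeriodicPt (fun x => β (α x)) (i + i) a := by
      rw [Function.IsPeriodicPt, Function.IsFixedPt, Function.iterate_add_apply]
      have := iterate_involution_right (α := α) hβ i a
      rw [ha, hi, hb] at this
      rw [hi, this, iterate_involution_inv hβ hα]
    have h2 := h1.minimalPeriod_dvd
    have h3 : ¬ Function.minimalPeriod (fun x => β (α x)) a ∣ i := fun h => by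
      apply hba
      rw [← hi]
      exact Function.isPeriodicPt_iff_minimalPeriod_dvd.2 h
    have hN := minimalPeriod_pos_of_finite (involution_mul_injective hα hβ) a
    rcases Nat.even_or_odd' (Function.minimalPeriod (fun x => β (α x)) a) with ⟨m, hm | hm⟩
    · refine ⟨m, hm, ?_⟩
      rw [hm] at h2 h3 hN
      obtain ⟨q, hq⟩ := h2
      have hi' : i = m * q := by nlinarith
      rcases Nat.even_or_odd' q with ⟨r, rfl | rfl⟩
      · exact absurd ⟨r, by rw [hi']; ring⟩ h3
      · rw [hi', show m * (2 * r + 1) = m + 2 * m * r by ring, Nat.add_mul_mod_self_left]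
        exact Nat.mod_eq_of_lt (by omega)
    · rw [hm] at h2 h3
      rw [← two_mul] at h2
      exact absurd (Nat.Coprime.dvd_of_dvd_mul_left (by simp) h2) h3
  obtain ⟨i, hi⟩ := hbi
  obtain ⟨k, hk⟩ := hci
  obtain ⟨m, hm, him⟩ := key b hb hba i hi
  obtain ⟨m', hm', hkm⟩ := key c hc hca k hk
  have : m = m' := by omega
  subst this
  rw [← hi, ← hk, ← Function.iterate_mod_minimalPeriod_eq (n := i),
    ← Function.iterate_mod_minimalPeriod_eq (n := k), hm, him, hkm]

end Dihedral

/-! ### The geometry of a resolved crossing -/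

namespace Crossings

variable {n : ℕ} {X : PuncturedDisk n} (K : Crossings X)

theorem norm_pos_sub_center (a : K.End) : ‖K.pos a - K.center a.1‖ = ‖K.axis a.1‖ := by
  simp [pos]

theorem fst_eq_of_mem_box {z : ℂ} {i j : Fin K.num}
    (hi : z ∈ Metric.closedBall (K.center i) ‖K.axis i‖)
    (hj : z ∈ Metric.closedBall (K.center j) ‖K.axis j‖) : i = j := by
  by_contra h
  exact Set.disjoint_left.1 (K.box_disjoint i j h) hi hj

/-- A linear functional that is constant on each of the two chords in the box of a resolved
crossing, with the values `1` and `-1`. -/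
def side (ρ : Fin K.num → Bool) (i : Fin K.num) (z : ℂ) : ℝ :=
  ((z - K.center i) / K.axis i * (if ρ i then 1 - Complex.I else 1 + Complex.I)).re

theorem side_pos_eq_iff (ρ : Fin K.num → Bool) (i : Fin K.num) (k l : ZMod 4) :
    K.side ρ i (K.pos (i, k)) = K.side ρ i (K.pos (i, l)) ↔
      l = k ∨ l = (if ρ i then 1 else 3) - k := by
  have h : ∀ k, (K.pos (i, k) - K.center i) / K.axis i = Complex.I ^ k.val := fun k => by
    simp only [pos, add_sub_cancel_left]
    exact mul_div_cancel_left₀ _ (K.axis_ne i)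
  have v0 : (0 : ZMod 4).val = 0 := rfl
  have v1 : (1 : ZMod 4).val = 1 := rfl
  have v2 : (2 : ZMod 4).val = 2 := rfl
  have v3 : (3 : ZMod 4).val = 3 := rfl
  have c : ∀ k : ZMod 4, k = 0 ∨ k = 1 ∨ k = 2 ∨ k = 3 := by decide
  simp only [side, h]
  rcases c k with rfl | rfl | rfl | rfl <;> rcases c l with rfl | rfl | rfl | rfl <;>
    cases ρ i <;>
    simp [v0, v1, v2, v3, pow_succ] <;> norm_num <;> decide

theorem side_lineMap (ρ : Fin K.num → Bool) (i : Fin K.num) (z w : ℂ) (t : ℝ) :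
    K.side ρ i (AffineMap.lineMap z w t) =
      AffineMap.lineMap (K.side ρ i z) (K.side ρ i w) t := by
  simp only [side, AffineMap.lineMap_apply_module, Complex.real_smul, smul_eq_mul]
  rw [← Complex.re_ofReal_mul, ← Complex.re_ofReal_mul, ← Complex.add_re]
  congr 1
  push_cast
  ring

theorem smoothArc_coe (ρ : Fin K.num → Bool) (a : K.End) (t : I) :
    (K.smoothArc ρ a t : ℂ) = AffineMap.lineMap (K.pos (a.1, a.2))
      (K.pos (a.1, (if ρ a.1 then 1 else 3) - a.2)) (t : ℝ) :=
  rfl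

theorem side_smoothArc (ρ : Fin K.num → Bool) (a : K.End) (t : I) :
    K.side ρ a.1 (K.smoothArc ρ a t : ℂ) = K.side ρ a.1 (K.pos a) := by
  rw [smoothArc_coe, side_lineMap, ← (K.side_pos_eq_iff ρ a.1 a.2 _).2 (Or.inr rfl)]
  simp

theorem smoothArc_mem_box (ρ : Fin K.num → Bool) (a : K.End) (t : I) :
    (K.smoothArc ρ a t : ℂ) ∈ Metric.closedBall (K.center a.1) ‖K.axis a.1‖ := by
  have h1 := K.pos_mem_box (a.1, a.2)
  have h2 := K.pos_mem_box (a.1, (if ρ a.1 then 1 else 3) - a.2)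
  rw [smoothArc_coe]
  exact (convex_closedBall (K.center a.1) ‖K.axis a.1‖).lineMap_mem h1 h2 t.2

theorem smooth_ne (ρ : Fin K.num → Bool) (a : K.End) : K.smooth ρ a ≠ a := by
  intro h
  have h2 := congrArg Prod.snd h
  simp only [smooth] at h2
  revert h2
  generalize a.2 = k
  revert k
  cases ρ a.1 <;> decide

theorem eq_or_eq_smooth_of_side_eq (ρ : Fin K.num → Bool) {a b : K.End} (h1 : b.1 = a.1)
    (h : K.side ρ a.1 (K.pos a) = K.side ρ a.1 (K.pos b)) : b = a ∨ b = K.smooth ρ a := by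
  obtain ⟨i, k⟩ := a
  obtain ⟨j, l⟩ := b
  obtain rfl : j = i := h1
  rcases (K.side_pos_eq_iff ρ j k l).1 h with rfl | rfl
  · exact Or.inl rfl
  · exact Or.inr rfl

theorem pos_injective : Function.Injective K.pos := by
  intro a b h
  have h1 : b.1 = a.1 := K.fst_eq_of_mem_box (h ▸ K.pos_mem_box b) (K.pos_mem_box a)
  -- the two resolutions pair a given end with different ends
  have h2 := K.eq_or_eq_smooth_of_side_eq (fun _ => false) h1 (by rw [h])
  have h3 := K.eq_or_eq_smooth_of_side_eq (fun _ => true) h1 (by rw [h])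
  rcases h2 with h2 | h2
  · exact h2.symm
  rcases h3 with h3 | h3
  · exact h3.symm
  exfalso
  have h4 := congrArg Prod.snd (h2.symm.trans h3)
  have h5 : ∀ k : ZMod 4, (3 : ZMod 4) - k ≠ 1 - k := by decide
  exact h5 a.2 h4

theorem eq_or_eq_smooth_of_smoothArc_eq_pos (ρ : Fin K.num → Bool) {a b : K.End} {t : I}
    (h : (K.smoothArc ρ a t : ℂ) = K.pos b) : b = a ∨ b = K.smooth ρ a := by
  have h1 : b.1 = a.1 := K.fst_eq_of_mem_box (K.pos_mem_box b) (h ▸ K.smoothArc_mem_box ρ a t)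
  exact K.eq_or_eq_smooth_of_side_eq ρ h1 (by rw [← h, side_smoothArc])

theorem eq_or_eq_smooth_of_smoothArc_eq (ρ : Fin K.num → Bool) {a b : K.End} {s t : I}
    (h : (K.smoothArc ρ a s : ℂ) = K.smoothArc ρ b t) : b = a ∨ b = K.smooth ρ a := by
  have h1 : b.1 = a.1 :=
    K.fst_eq_of_mem_box (K.smoothArc_mem_box ρ b t) (h ▸ K.smoothArc_mem_box ρ a s)
  refine K.eq_or_eq_smooth_of_side_eq ρ h1 ?_
  rw [← K.side_smoothArc ρ a s, h, ← h1, side_smoothArc]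

theorem smoothArc_injective (ρ : Fin K.num → Bool) (a : K.End) :
    Function.Injective (K.smoothArc ρ a) := by
  intro s t h
  have h' : AffineMap.lineMap (K.pos (a.1, a.2)) (K.pos (a.1, (if ρ a.1 then 1 else 3) - a.2))
      (s : ℝ) = AffineMap.lineMap (K.pos (a.1, a.2))
        (K.pos (a.1, (if ρ a.1 then 1 else 3) - a.2)) (t : ℝ) := congrArg Subtype.val h
  have hne : K.pos (a.1, a.2) ≠ K.pos (a.1, (if ρ a.1 then 1 else 3) - a.2) := fun he =>
    K.smooth_ne ρ a (K.pos_injective he).symm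
  exact Subtype.ext (AffineMap.lineMap_injective ℝ hne h')

end Crossings

namespace Diagram

variable {n : ℕ} {X : PuncturedDisk n} (D : Diagram X)

/-! ### Circles of a resolution as orbits -/

theorem circleAt_opp (ρ : D.Resolution) (a : D.End) :
    D.circleAt ρ (D.opp a) = D.circleAt ρ a :=
  congrArg Sum.inl (Quot.sound (r := D.Adjacent ρ) (Or.inl rfl)).symm

theorem circleAt_smooth (ρ : D.Resolution) (a : D.End) :
    D.circleAt ρ (D.smooth ρ a) = D.circleAt ρ a :=
  congrArg Sum.inl (Quot.sound (r := D.Adjacent ρ) (Or.inr rfl)).symm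

theorem circleAt_iterate (ρ : D.Resolution) (a : D.End) (m : ℕ) :
    D.circleAt ρ ((D.next ρ)^[m] a) = D.circleAt ρ a := by
  induction m with
  | zero => rfl
  | succ m ih => rw [Function.iterate_succ_apply', next, circleAt_smooth, circleAt_opp, ih]

/-- A set of ends that is closed under passing to neighbours contains whole circles. -/
theorem mem_of_circleAt_eq {ρ : D.Resolution} (S : Set D.End) (hopp : ∀ a ∈ S, D.opp a ∈ S)
    (hsmooth : ∀ a ∈ S, D.smooth ρ a ∈ S) {a b : D.End} (h : D.circleAt ρ a = D.circleAt ρ b)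
    (ha : a ∈ S) : b ∈ S := by
  have h' : (Quot.mk (D.Adjacent ρ) a) = Quot.mk _ b := Sum.inl.inj h
  have key : ∀ a b, D.Adjacent ρ a b → (a ∈ S) = (b ∈ S) := by
    rintro a b (rfl | rfl)
    · exact propext ⟨hopp a, fun h => by simpa [D.opp_opp] using hopp _ h⟩
    · exact propext ⟨hsmooth a, fun h => by simpa [D.smooth_smooth] using hsmooth _ h⟩
  have := congrArg (Quot.lift (fun a => a ∈ S) key) h'
  exact this.mp ha

theorem iterate_next_ne_opp (ρ : D.Resolution) (a : D.End) (i k : ℕ) :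
    (D.next ρ)^[i] a ≠ D.opp ((D.next ρ)^[k] a) :=
  iterate_ne_involution D.opp_opp (D.smooth_smooth ρ) D.opp_ne (D.smooth_ne ρ) a i k

/-! ### Planarity of the resolved diagram -/

/-- The involution that joins the ends in the boxes other than box `j` and fixes the ends of
crossing `j`. -/
def smoothOutside (ρ : D.Resolution) (j : Fin D.num) (a : D.End) : D.End :=
  if a.1 = j then a else D.smooth ρ a

theorem smoothOutside_smoothOutside (ρ : D.Resolution) (j : Fin D.num) (a : D.End) :
    D.smoothOutside ρ j (D.smoothOutside ρ j a) = a := by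
  unfold smoothOutside
  by_cases h : a.1 = j
  · simp [h]
  · have h' : (D.smooth ρ a).1 ≠ j := h
    simp [h, h', D.smooth_smooth]

theorem smoothOutside_eq_self_iff (ρ : D.Resolution) (j : Fin D.num) (a : D.End) :
    D.smoothOutside ρ j a = a ↔ a.1 = j := by
  unfold smoothOutside
  by_cases h : a.1 = j
  · simp [h]
  · simp [h, D.smooth_ne]

/-- The ends that are joined to `a` outside the box of crossing `j`. -/
def outerOrbit (ρ : D.Resolution) (j : Fin D.num) (a : D.End) : Set D.End :=
  {b | ∃ i, (fun x => D.smoothOutside ρ j (D.opp x))^[i] a = b}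

/-- The part of the resolved diagram outside the box of crossing `j` that runs through the ends
in `S`. -/
def outerPart (ρ : D.Resolution) (j : Fin D.num) (S : Set D.End) : Set X.carrier :=
  {z | ∃ a ∈ S, z ∈ Set.range (D.arc a) ∨ (a.1 ≠ j ∧ z ∈ Set.range (D.smoothArc ρ a))}

theorem joinedIn_outerPart (ρ : D.Resolution) (j : Fin D.num) {a b : D.End} (ha : a.1 = j)
    (hb : b ∈ D.outerOrbit ρ j a) :
    JoinedIn (D.outerPart ρ j (D.outerOrbit ρ j a)) (D.pt a) (D.pt b) := by
  obtain ⟨i, rfl⟩ := hb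
  induction i with
  | zero =>
    exact JoinedIn.refl ⟨a, ⟨0, rfl⟩, Or.inl ⟨0, (D.arc a).source⟩⟩
  | succ i ih =>
    refine ih.trans ?_
    rw [Function.iterate_succ_apply']
    have hmem : (fun x => D.smoothOutside ρ j (D.opp x))^[i] a ∈ D.outerOrbit ρ j a := ⟨i, rfl⟩
    generalize (fun x => D.smoothOutside ρ j (D.opp x))^[i] a = c at hmem
    have h1 : JoinedIn (D.outerPart ρ j (D.outerOrbit ρ j a)) (D.pt c) (D.pt (D.opp c)) :=
      ⟨D.arc c, fun t => ⟨c, hmem, Or.inl ⟨t, rfl⟩⟩⟩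
    refine h1.trans ?_
    have hmem' : D.opp c ∈ D.outerOrbit ρ j a :=
      orbit_closed_left D.opp_opp (D.smoothOutside_smoothOutside ρ j)
        ((D.smoothOutside_eq_self_iff ρ j a).2 ha) hmem
    by_cases h : (D.opp c).1 = j
    · rw [(D.smoothOutside_eq_self_iff ρ j _).2 h]
      exact JoinedIn.refl ⟨_, hmem', Or.inl ⟨0, (D.arc _).source⟩⟩
    · have e : D.smoothOutside ρ j (D.opp c) = D.smooth ρ (D.opp c) := if_neg h
      rw [e]
      exact ⟨D.smoothArc ρ _, fun t => ⟨_, hmem', Or.inr ⟨h, t, rfl⟩⟩⟩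

theorem arc_mem_box {a : D.End} {t : I} {i : Fin D.num}
    (h : (D.arc a t : ℂ) ∈ Metric.closedBall (D.center i) ‖D.axis i‖) :
    ∃ b, (b = a ∨ b = D.opp a) ∧ b.1 = i ∧ (D.arc a t : ℂ) = D.pos b := by
  rcases D.arc_box a t i h with rfl | rfl
  · have e : (D.arc a 0 : ℂ) = D.pos a := by rw [(D.arc a).source]; rfl
    rw [e] at h
    exact ⟨a, Or.inl rfl, D.fst_eq_of_mem_box (D.pos_mem_box a) h, e⟩
  · have e : (D.arc a 1 : ℂ) = D.pos (D.opp a) := by rw [(D.arc a).target]; rfl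
    rw [e] at h
    exact ⟨D.opp a, Or.inr rfl, D.fst_eq_of_mem_box (D.pos_mem_box _) h, e⟩

theorem norm_le_of_mem_outerPart {ρ : D.Resolution} {j : Fin D.num} {S : Set D.End}
    {z : X.carrier} (hz : z ∈ D.outerPart ρ j S) : ‖D.axis j‖ ≤ ‖(z : ℂ) - D.center j‖ := by
  by_contra! h
  have hz' : (z : ℂ) ∈ Metric.closedBall (D.center j) ‖D.axis j‖ := by
    rw [mem_closedBall_iff_norm]; exact h.le
  obtain ⟨a, -, ⟨t, rfl⟩ | ⟨ha, t, rfl⟩⟩ := hz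
  · obtain ⟨b, -, rfl, hb⟩ := D.arc_mem_box hz'
    rw [hb, D.norm_pos_sub_center] at h
    exact h.false
  · exact ha (D.fst_eq_of_mem_box (D.smoothArc_mem_box ρ a t) hz')

theorem disjoint_outerPart {ρ : D.Resolution} {j : Fin D.num} {S T : Set D.End}
    (hS : ∀ a ∈ S, D.opp a ∈ S) (hS' : ∀ a ∈ S, D.smoothOutside ρ j a ∈ S)
    (hT : ∀ a ∈ T, D.opp a ∈ T) (hT' : ∀ a ∈ T, D.smoothOutside ρ j a ∈ T) (h : Disjoint S T) :
    Disjoint (D.outerPart ρ j S) (D.outerPart ρ j T) := by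
  have hne : ∀ a ∈ S, ∀ b ∈ T, b ≠ a := fun a ha b hb e => Set.disjoint_left.1 h ha (e ▸ hb)
  have hsm : ∀ (S : Set D.End), (∀ a ∈ S, D.smoothOutside ρ j a ∈ S) → ∀ a ∈ S, a.1 ≠ j →
      D.smooth ρ a ∈ S := fun S hS a ha haj => by
    have := hS a ha
    rwa [smoothOutside, if_neg haj] at this
  have mixed : ∀ (S T : Set D.End), (∀ a ∈ S, D.opp a ∈ S) →
      (∀ a ∈ T, D.smoothOutside ρ j a ∈ T) → (∀ a ∈ S, ∀ b ∈ T, b ≠ a) → ∀ a ∈ S, ∀ b ∈ T,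
      b.1 ≠ j → ∀ s t, D.arc a s ≠ D.smoothArc ρ b t := by
    intro S T hS hT hne a ha b hb hbj s t he
    have he' : (D.arc a s : ℂ) = D.smoothArc ρ b t := congrArg Subtype.val he
    obtain ⟨c, hc, -, hc'⟩ := D.arc_mem_box (he' ▸ D.smoothArc_mem_box ρ b t)
    have hcS : c ∈ S := by
      rcases hc with rfl | rfl
      · exact ha
      · exact hS _ ha
    rcases D.eq_or_eq_smooth_of_smoothArc_eq_pos ρ (he'.symm.trans hc') with rfl | rfl
    · exact hne _ hcS _ hb rfl
    · exact hne _ hcS _ (hsm T hT _ hb hbj) rfl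
  rw [Set.disjoint_left]
  rintro z ⟨a, ha, ⟨s, hs⟩ | ⟨haj, s, hs⟩⟩ ⟨b, hb, ⟨t, ht⟩ | ⟨hbj, t, ht⟩⟩
  · exact Set.disjoint_left.1 (D.arc_disjoint a b (hne a ha b hb) (hne _ (hS a ha) b hb))
      ⟨s, hs⟩ ⟨t, ht⟩
  · exact mixed S T hS hT' hne a ha b hb hbj s t (hs.trans ht.symm)
  · exact mixed T S hT hS' (fun a ha b hb => (hne b hb a ha).symm) b hb a ha haj t s
      (ht.trans hs.symm)
  · have he : (D.smoothArc ρ a s : ℂ) = D.smoothArc ρ b t :=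
      congrArg Subtype.val (hs.trans ht.symm)
    rcases D.eq_or_eq_smooth_of_smoothArc_eq ρ he with rfl | rfl
    · exact hne _ ha _ hb rfl
    · exact hne _ (hsm S hS' _ ha haj) _ hb rfl

/-- The arcs of the resolved diagram outside a box do not join opposite ends of the crossing. -/
theorem not_joined_opposite (ρ : D.Resolution) (j : Fin D.num)
    (h02 : ((j, 2) : D.End) ∈ D.outerOrbit ρ j (j, 0))
    (h13 : ((j, 3) : D.End) ∈ D.outerOrbit ρ j (j, 1))
    (h : Disjoint (D.outerOrbit ρ j (j, 0)) (D.outerOrbit ρ j (j, 1))) : False := by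
  have cl : ∀ k : ZMod 4, (∀ a ∈ D.outerOrbit ρ j (j, k), D.opp a ∈ D.outerOrbit ρ j (j, k)) ∧
      ∀ a ∈ D.outerOrbit ρ j (j, k), D.smoothOutside ρ j a ∈ D.outerOrbit ρ j (j, k) := fun k =>
    ⟨fun a => orbit_closed_left D.opp_opp (D.smoothOutside_smoothOutside ρ j)
        ((D.smoothOutside_eq_self_iff ρ j (j, k)).2 rfl),
      fun a => orbit_closed_right D.opp_opp (D.smoothOutside_smoothOutside ρ j)
        ((D.smoothOutside_eq_self_iff ρ j (j, k)).2 rfl)⟩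
  have hdisj := D.disjoint_outerPart (cl 0).1 (cl 0).2 (cl 1).1 (cl 1).2 h
  obtain ⟨P, hP⟩ := D.joinedIn_outerPart ρ j rfl h02
  obtain ⟨Q, hQ⟩ := D.joinedIn_outerPart ρ j rfl h13
  have v0 : (0 : ZMod 4).val = 0 := rfl
  have v1 : (1 : ZMod 4).val = 1 := rfl
  have v2 : (2 : ZMod 4).val = 2 := rfl
  have v3 : (3 : ZMod 4).val = 3 := rfl
  have p0 : D.center j + D.axis j = (D.pt (j, 0) : ℂ) := by
    simp [Crossings.pt, Crossings.pos]
  have p2 : D.center j - D.axis j = (D.pt (j, 2) : ℂ) := by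
    simp [Crossings.pt, Crossings.pos, v2, sub_eq_add_neg]
  have p1 : D.center j + D.axis j * Complex.I = (D.pt (j, 1) : ℂ) := by
    simp [Crossings.pt, Crossings.pos, v1]
  have p3 : D.center j - D.axis j * Complex.I = (D.pt (j, 3) : ℂ) := by
    simp [Crossings.pt, Crossings.pos, v3, pow_succ, sub_eq_add_neg]
  obtain ⟨s, t, hst⟩ := exists_eq_of_alternating (D.axis_ne j)
    ((P.map continuous_subtype_val).cast p0 p2) ((Q.map continuous_subtype_val).cast p1 p3)
    (fun t => D.norm_le_of_mem_outerPart (hP t)) (fun t => D.norm_le_of_mem_outerPart (hQ t))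
  exact Set.disjoint_left.1 hdisj (hP s) (Subtype.ext hst ▸ hQ t)

/-- The ends of crossing `j` that are joined to an end `a` of it outside its box: `a` itself and
exactly one other end. -/
theorem exists_partner (ρ : D.Resolution) (j : Fin D.num) {a : D.End} (ha : a.1 = j) :
    ∃ b, b ≠ a ∧ b.1 = j ∧ b ∈ D.outerOrbit ρ j a ∧
      ∀ c ∈ D.outerOrbit ρ j a, c.1 = j → c = a ∨ c = b := by
  have ha' := (D.smoothOutside_eq_self_iff ρ j a).2 ha
  obtain ⟨b, hba, hb, hbo⟩ := exists_other_fixed D.opp_opp (D.smoothOutside_smoothOutside ρ j)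
    D.opp_ne ha'
  refine ⟨b, hba, (D.smoothOutside_eq_self_iff ρ j b).1 hb, hbo, fun c hc hcj => ?_⟩
  by_cases hca : c = a
  · exact Or.inl hca
  · exact Or.inr (other_fixed_unique D.opp_opp (D.smoothOutside_smoothOutside ρ j) ha'
      ((D.smoothOutside_eq_self_iff ρ j c).2 hcj) hca hc hb hba hbo)

/-- If the two ends of a resolved crossing are joined outside its box, they are the only ends of
the crossing on their circle. -/
theorem circleAt_ne_of_joined {ρ ρ' : D.Resolution} {j : Fin D.num} {a b c : D.End}
    (hρ : ∀ i, i ≠ j → ρ i = ρ' i) (ha : a.1 = j)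
    (hb : b = D.smooth ρ' a) (hbo : b ∈ D.outerOrbit ρ j a)
    (hab : ∀ c ∈ D.outerOrbit ρ j a, c.1 = j → c = a ∨ c = b) (hcj : c.1 = j) (hca : c ≠ a)
    (hcb : c ≠ b) : D.circleAt ρ' a ≠ D.circleAt ρ' c := by
  intro h
  have ha' := (D.smoothOutside_eq_self_iff ρ j a).2 ha
  have hc : c ∈ D.outerOrbit ρ j a := by
    refine D.mem_of_circleAt_eq (D.outerOrbit ρ j a)
      (fun x hx => orbit_closed_left D.opp_opp (D.smoothOutside_smoothOutside ρ j) ha' hx)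
      (fun x hx => ?_) h ⟨0, rfl⟩
    by_cases hxj : x.1 = j
    · rcases hab x hx hxj with rfl | rfl
      · rwa [← hb]
      · rw [hb, D.smooth_smooth]
        exact ⟨0, rfl⟩
    · have := orbit_closed_right D.opp_opp (D.smoothOutside_smoothOutside ρ j) ha' hx
      rw [smoothOutside, if_neg hxj] at this
      have e : D.smooth ρ' x = D.smooth ρ x := by
        simp only [Crossings.smooth, hρ x.1 hxj]
      rwa [e]
  rcases hab c hc hcj with h | h
  · exact hca h
  · exact hcb h

/-- Changing the resolution of one crossing never keeps its two strands on a single circle: the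
number of circles changes. -/
theorem circleAt_ne_of_circleAt_eq {ρ ρ' : D.Resolution} {j : Fin D.num}
    (hρ : ∀ i, i ≠ j → ρ i = ρ' i) (hj : ρ j ≠ ρ' j)
    (h : D.circleAt ρ (j, 1) = D.circleAt ρ (j, 3)) :
    D.circleAt ρ' (j, 1) ≠ D.circleAt ρ' (j, 3) := by
  intro h'
  have hρ' : ∀ i, i ≠ j → ρ i = ρ i := fun _ _ => rfl
  have four : ∀ k : ZMod 4, k = 0 ∨ k = 1 ∨ k = 2 ∨ k = 3 := by decide
  have hf := involution_mul_injective D.opp_opp (D.smoothOutside_smoothOutside ρ j)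
  -- an end is not joined outside the box to a neighbour of it
  have main : ∀ a b c : D.End, a.1 = j → b ∈ D.outerOrbit ρ j a →
      (∀ c ∈ D.outerOrbit ρ j a, c.1 = j → c = a ∨ c = b) → c.1 = j → c ≠ a → c ≠ b →
      D.circleAt ρ a = D.circleAt ρ c → D.circleAt ρ' a = D.circleAt ρ' c →
      b ≠ D.smooth ρ a ∧ b ≠ D.smooth ρ' a := fun a b c ha hbo hab hcj hca hcb e e' =>
    ⟨fun hb => D.circleAt_ne_of_joined hρ' ha hb hbo hab hcj hca hcb e,
      fun hb => D.circleAt_ne_of_joined hρ ha hb hbo hab hcj hca hcb e'⟩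
  have sm : ∀ k : ZMod 4, ∀ b : D.End, b.1 = j → b ≠ (j, k) → b ≠ D.smooth ρ (j, k) →
      b ≠ D.smooth ρ' (j, k) → b = (j, k + 2) := by
    rintro k ⟨i, l⟩ rfl hl
    simp only [Crossings.smooth, ne_eq, Prod.mk.injEq, true_and] at hl ⊢
    have : ∀ k l : ZMod 4, l ≠ k → l ≠ 1 - k → l ≠ 3 - k → l = k + 2 := by decide
    intro h1 h2
    cases e : ρ i <;> cases e' : ρ' i <;> simp only [e, e'] at h1 h2 hj
    · exact absurd rfl hj
    · exact this k l hl h2 h1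
    · exact this k l hl h1 h2
    · exact absurd rfl hj
  -- all four ends are on the same circle, in both resolutions
  have all : ∀ (τ : D.Resolution), D.circleAt τ (j, 1) = D.circleAt τ (j, 3) → ∀ k l : ZMod 4,
      D.circleAt τ (j, k) = D.circleAt τ (j, l) := by
    intro τ hτ
    have key : ∀ k : ZMod 4, D.circleAt τ (j, k) = D.circleAt τ (j, 1) := by
      intro k
      have e := D.circleAt_smooth τ (j, k)
      simp only [Crossings.smooth] at e
      rcases four k with rfl | rfl | rfl | rfl
      · cases h : τ j <;> simp only [h] at e <;> rw [← e]
        · exact hτ.symm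
        · rfl
      · rfl
      · cases h : τ j <;> simp only [h] at e <;> rw [← e]
        · rfl
        · exact hτ.symm
      · exact hτ.symm
    intro k l
    rw [key k, key l]
  have partner : ∀ k : ZMod 4, ((j, k + 2) : D.End) ∈ D.outerOrbit ρ j (j, k) ∧
      ∀ c ∈ D.outerOrbit ρ j (j, k), c.1 = j → c = (j, k) ∨ c = (j, k + 2) := by
    intro k
    obtain ⟨b, hba, hbj, hbo, hab⟩ := D.exists_partner ρ j (a := (j, k)) rfl
    obtain ⟨l, hl1, hl2⟩ : ∃ l : ZMod 4, l ≠ k ∧ l ≠ b.2 := by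
      have : ∀ k m : ZMod 4, ∃ l, l ≠ k ∧ l ≠ m := by decide
      exact this k b.2
    obtain ⟨n1, n2⟩ := main (j, k) b (j, l) rfl hbo hab rfl (fun e => hl1 (congrArg Prod.snd e))
      (fun e => hl2 (congrArg Prod.snd e)) (all ρ h k l) (all ρ' h' k l)
    have hb := sm k b hbj hba n1 n2
    subst hb
    exact ⟨hbo, hab⟩
  refine D.not_joined_opposite ρ j (partner 0).1 (partner 1).1 ?_
  rw [Set.disjoint_left]
  rintro x ⟨i, hi⟩ ⟨k, hk⟩
  have : ((j, 1) : D.End) ∈ D.outerOrbit ρ j (j, 0) := by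
    obtain ⟨m, hm⟩ := exists_iterate_eq_of_iterate_eq hf hk
    refine ⟨m + i, ?_⟩
    rw [Function.iterate_add_apply, hi, hm]
  rcases (partner 0).2 _ this rfl with e | e
  · exact absurd (congrArg Prod.snd e) (show (1 : ZMod 4) ≠ 0 by decide)
  · exact absurd (congrArg Prod.snd e) (show (1 : ZMod 4) ≠ 0 + 2 by decide)

end Diagram

/-! ### Simple closed paths -/

section HalfOpen

variable {X : Type*} [TopologicalSpace X] {x y z : X}

theorem trans_image_ne_one_subset (γ : Path x y) (δ : Path y z) :
    γ.trans δ '' {t | t ≠ 1} ⊆ γ '' {t | t ≠ 1} ∪ δ '' {t | t ≠ 1} := by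
  rintro _ ⟨t, ht, rfl⟩
  rw [Path.trans_apply]
  have ht1 : (t : ℝ) < 1 := lt_of_le_of_ne t.2.2 fun h => ht (Subtype.ext h)
  split_ifs with h
  · rcases h.lt_or_eq with h' | h'
    · refine Or.inl ⟨_, fun he => ?_, rfl⟩
      have := congrArg Subtype.val he
      simp only [Set.Icc.coe_one] at this
      linarith
    · refine Or.inr ⟨0, zero_ne_one, ?_⟩
      refine δ.source.trans (γ.target.symm.trans (congrArg γ (Subtype.ext ?_)))
      simp only [Set.Icc.coe_one]
      linarith
  · refine Or.inr ⟨_, fun he => ?_, rfl⟩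
    have := congrArg Subtype.val he
    simp only [Set.Icc.coe_one] at this
    linarith

theorem trans_injOn_ne_one {γ : Path x y} {δ : Path y z} (hγ : Set.InjOn γ {t | t ≠ 1})
    (hδ : Set.InjOn δ {t | t ≠ 1}) (h : Disjoint (γ '' {t | t ≠ 1}) (δ '' {t | t ≠ 1})) :
    Set.InjOn (γ.trans δ) {t | t ≠ 1} := by
  -- a point of the concatenation lies on exactly one half, with a parameter different from `1`
  have key : ∀ t : I, t ≠ 1 →
      ((t : ℝ) < 1 / 2 ∧ ∃ u : I, u ≠ 1 ∧ (u : ℝ) = 2 * t ∧ γ.trans δ t = γ u) ∨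
      (1 / 2 ≤ (t : ℝ) ∧ ∃ u : I, u ≠ 1 ∧ (u : ℝ) = 2 * t - 1 ∧ γ.trans δ t = δ u) := by
    intro t ht
    have ht1 : (t : ℝ) < 1 := lt_of_le_of_ne t.2.2 fun h => ht (Subtype.ext h)
    have ht0 := t.2.1
    rcases lt_or_ge (t : ℝ) (1 / 2) with h | h
    · refine Or.inl ⟨h, ⟨2 * t, by constructor <;> linarith⟩, fun he => ?_, rfl, ?_⟩
      · have := congrArg Subtype.val he
        simp only [Set.Icc.coe_one] at this
        linarith
      · rw [Path.trans_apply, dif_pos h.le]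
    · refine Or.inr ⟨h, ⟨2 * t - 1, by constructor <;> linarith⟩, fun he => ?_, rfl, ?_⟩
      · have := congrArg Subtype.val he
        simp only [Set.Icc.coe_one] at this
        linarith
      · rw [Path.trans_apply]
        split_ifs with h'
        · have e : (t : ℝ) = 1 / 2 := le_antisymm h' h
          have e1 : (⟨2 * t, (unitInterval.mul_pos_mem_iff zero_lt_two).2 ⟨t.2.1, h'⟩⟩ : I) = 1 :=
            Subtype.ext (by simp [e])
          have e2 : (⟨2 * t - 1, by constructor <;> linarith⟩ : I) = 0 := Subtype.ext (by simp [e])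
          rw [e2, δ.source]
          exact (congrArg γ e1).trans γ.target
        · rfl
  intro s hs t ht hst
  rcases key s hs with ⟨-, u, hu, hus, eu⟩ | ⟨-, u, hu, hus, eu⟩ <;>
    rcases key t ht with ⟨-, v, hv, hvt, ev⟩ | ⟨-, v, hv, hvt, ev⟩ <;>
    rw [eu, ev] at hst
  · have := hγ hu hv hst
    subst this
    exact Subtype.ext (by linarith)
  · exact absurd ⟨v, hv, hst.symm⟩ (Set.disjoint_left.1 h ⟨u, hu, rfl⟩)
  · exact absurd ⟨u, hu, hst⟩ (Set.disjoint_left.1 h ⟨v, hv, rfl⟩)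
  · have := hδ hu hv hst
    subst this
    exact Subtype.ext (by linarith)

end HalfOpen

namespace Diagram

variable {n : ℕ} {X : PuncturedDisk n} (D : Diagram X)

/-! ### The circles of a resolution are simple closed curves -/

theorem disjoint_arc_smoothArc {ρ : D.Resolution} {c d : D.End} (h : c ≠ d) :
    Disjoint (D.arc c '' {t | t ≠ 1}) (D.smoothArc ρ d '' {t | t ≠ 1}) := by
  rw [Set.disjoint_left]
  rintro z ⟨s, hs, hsz⟩ ⟨t, ht, htz⟩
  have he : (D.arc c s : ℂ) = D.smoothArc ρ d t := congrArg Subtype.val (hsz.trans htz.symm)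
  rcases D.arc_box c s d.1 (he ▸ D.smoothArc_mem_box ρ d t) with rfl | rfl
  · have e : (D.arc c 0 : ℂ) = D.pos c := by rw [(D.arc c).source]; rfl
    rcases D.eq_or_eq_smooth_of_smoothArc_eq_pos ρ (he.symm.trans e) with h' | h'
    · exact h h'
    · apply ht
      apply D.smoothArc_injective ρ d
      rw [(D.smoothArc ρ d).target, htz, ← hsz, (D.arc c).source, h']
  · exact hs rfl

/-- The half-open piece of the circle through `a` between the ends `a` and `next a`. -/
def piece (ρ : D.Resolution) (a : D.End) : Set X.carrier :=
  D.arc a '' {t | t ≠ 1} ∪ D.smoothArc ρ (D.opp a) '' {t | t ≠ 1}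

theorem step_injOn (ρ : D.Resolution) (a : D.End) : Set.InjOn (D.step ρ a) {t | t ≠ 1} :=
  trans_injOn_ne_one (D.arc_injective a).injOn (D.smoothArc_injective ρ _).injOn
    (D.disjoint_arc_smoothArc (D.opp_ne a).symm)

theorem disjoint_piece (ρ : D.Resolution) (a : D.End) {i k : ℕ}
    (h : (D.next ρ)^[i] a ≠ (D.next ρ)^[k] a) :
    Disjoint (D.piece ρ ((D.next ρ)^[i] a)) (D.piece ρ ((D.next ρ)^[k] a)) := by
  refine Set.disjoint_union_left.2 ⟨Set.disjoint_union_right.2 ⟨?_, ?_⟩,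
    Set.disjoint_union_right.2 ⟨?_, ?_⟩⟩
  · exact (D.arc_disjoint _ _ h.symm (D.iterate_next_ne_opp ρ a k i)).mono
      (Set.image_subset_range _ _) (Set.image_subset_range _ _)
  · exact D.disjoint_arc_smoothArc (D.iterate_next_ne_opp ρ a i k)
  · exact (D.disjoint_arc_smoothArc (D.iterate_next_ne_opp ρ a k i)).symm
  · rw [Set.disjoint_left]
    rintro z ⟨s, hs, hsz⟩ ⟨t, ht, htz⟩
    have he : (D.smoothArc ρ _ s : ℂ) = D.smoothArc ρ _ t :=
      congrArg Subtype.val (hsz.trans htz.symm)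
    rcases D.eq_or_eq_smooth_of_smoothArc_eq ρ he with h' | h'
    · apply h
      rw [← D.opp_opp ((D.next ρ)^[k] a), h', D.opp_opp]
    · apply D.iterate_next_ne_opp ρ a (i + 1) k
      rw [Function.iterate_succ_apply', h']
      rfl

theorem walk_image_subset (ρ : D.Resolution) (a : D.End) (m : ℕ) :
    D.walk ρ a m '' {t | t ≠ 1} ⊆ ⋃ i ∈ Set.Iic m, D.piece ρ ((D.next ρ)^[i] a) := by
  induction m with
  | zero =>
    refine (trans_image_ne_one_subset (D.arc a) (D.smoothArc ρ (D.opp a))).trans ?_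
    exact Set.subset_biUnion_of_mem (u := fun i => D.piece ρ ((D.next ρ)^[i] a))
      (Set.mem_Iic.2 (le_refl 0))
  | succ m ih =>
    change (D.walk ρ a m).trans (D.step ρ _) '' {t | t ≠ 1} ⊆ _
    refine (trans_image_ne_one_subset _ _).trans (Set.union_subset ?_ ?_)
    · exact ih.trans (Set.biUnion_subset_biUnion_left (Set.Iic_subset_Iic.2 (Nat.le_succ m)))
    · refine (trans_image_ne_one_subset (D.arc _) (D.smoothArc ρ _)).trans ?_
      exact Set.subset_biUnion_of_mem (u := fun i => D.piece ρ ((D.next ρ)^[i] a))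
        (Set.mem_Iic.2 le_rfl)

theorem walk_injOn (ρ : D.Resolution) (a : D.End) (m : ℕ)
    (hm : m < Function.minimalPeriod (D.next ρ) a) : Set.InjOn (D.walk ρ a m) {t | t ≠ 1} := by
  induction m with
  | zero => exact D.step_injOn ρ a
  | succ m ih =>
    change Set.InjOn ((D.walk ρ a m).trans (D.step ρ _)) {t | t ≠ 1}
    refine trans_injOn_ne_one (ih (by omega)) (D.step_injOn ρ _) ?_
    refine Disjoint.mono (D.walk_image_subset ρ a m)
      (trans_image_ne_one_subset (D.arc _) (D.smoothArc ρ _)) ?_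
    rw [Set.disjoint_iUnion₂_left]
    intro i hi
    refine D.disjoint_piece ρ a (k := m + 1) fun h => ?_
    have := Function.iterate_injOn_Iio_minimalPeriod (Set.mem_Iio.2 (by
      have := Set.mem_Iic.1 hi
      omega)) (Set.mem_Iio.2 hm) h
    have := Set.mem_Iic.1 hi
    omega

theorem loop_injective (ρ : D.Resolution) (a : D.End) : Function.Injective (D.loop ρ a) := by
  apply circleOfPath_injective
  refine D.walk_injOn ρ a _ ?_
  have := Function.minimalPeriod_pos_of_mem_periodicPts ((D.next_injective ρ).mem_periodicPts a)
  omega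

theorem circleCurve_injective (ρ : D.Resolution) (c : D.Circles ρ) :
    Function.Injective (D.circleCurve ρ c) := by
  rcases c with c | i
  · exact D.loop_injective ρ _
  · exact D.free_injective i

end Diagram

/-! ### Path classes -/

section PathClasses

variable {Y : Type*} [TopologicalSpace Y] {x y z w : Y}

theorem quotient_symm_trans_rev (p : Path.Homotopic.Quotient x y)
    (q : Path.Homotopic.Quotient y z) : (p.trans q).symm = q.symm.trans p.symm := by
  obtain ⟨p, rfl⟩ := Path.Homotopic.Quotient.mk_surjective p
  obtain ⟨q, rfl⟩ := Path.Homotopic.Quotient.mk_surjective q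
  rw [← Path.Homotopic.Quotient.mk_trans, ← Path.Homotopic.Quotient.mk_symm, Path.trans_symm]
  rfl

/-- Conjugate closed paths trace freely homotopic closed curves. -/
theorem circleOfPath_conj {γ : Path x x} {δ : Path y y} (u : Path.Homotopic.Quotient x y)
    (h : Path.Homotopic.Quotient.mk γ = u.trans ((Path.Homotopic.Quotient.mk δ).trans u.symm)) :
    (circleOfPath γ).Homotopic (circleOfPath δ) := by
  obtain ⟨u, rfl⟩ := Path.Homotopic.Quotient.mk_surjective u
  have h1 : (circleOfPath γ).Homotopic (circleOfPath (u.trans (δ.trans u.symm))) :=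
    circleOfPath_congr h
  refine (h1.trans (circleOfPath_trans_comm _ _)).trans (circleOfPath_congr ?_)
  simp only [Path.Homotopic.Quotient.mk_trans, Path.Homotopic.Quotient.mk_symm,
    Path.Homotopic.Quotient.trans_assoc, Path.Homotopic.Quotient.symm_trans,
    Path.Homotopic.Quotient.trans_refl]

end PathClasses

namespace Diagram

variable {n : ℕ} {X : PuncturedDisk n} (D : Diagram X)

/-! ### Homotopy classes of walks along a resolved diagram -/

/-- The arc in the box of a resolved crossing that ends a step from `a` to `next a`. -/
def stepArc (ρ : D.Resolution) (a : D.End) : Path (D.pt (D.opp a)) (D.pt (D.next ρ a)) :=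
  D.smoothArc ρ (D.opp a)

theorem mk_step (ρ : D.Resolution) (a : D.End) :
    Path.Homotopic.Quotient.mk (D.step ρ a) = (Path.Homotopic.Quotient.mk (D.arc a)).trans
      (Path.Homotopic.Quotient.mk (D.stepArc ρ a)) :=
  rfl

/-- The path of `m` steps from the end `a` along the resolved diagram. -/
def walkTo (ρ : D.Resolution) (a : D.End) : (m : ℕ) → Path (D.pt a) (D.pt ((D.next ρ)^[m] a))
  | 0 => Path.refl _
  | m + 1 => ((walkTo ρ a m).trans (D.step ρ _)).cast rfl
      (by rw [Function.iterate_succ_apply' (D.next ρ) m a])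

/-- The end `b` is reached from the end `a` after `m` steps, along a path of homotopy class `p`. -/
def IsWalk (ρ : D.Resolution) (a b : D.End) (m : ℕ)
    (p : Path.Homotopic.Quotient (D.pt a) (D.pt b)) : Prop :=
  ∃ h : (D.next ρ)^[m] a = b, p = (Path.Homotopic.Quotient.mk (D.walkTo ρ a m)).cast rfl (congrArg D.pt h.symm)

variable {D}

namespace IsWalk

variable {ρ : D.Resolution} {a b c : D.End} {m k : ℕ}

theorem unique {p q : Path.Homotopic.Quotient (D.pt a) (D.pt b)} (hp : D.IsWalk ρ a b m p)
    (hq : D.IsWalk ρ a b m q) : p = q := by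
  obtain ⟨_, rfl⟩ := hp
  obtain ⟨_, rfl⟩ := hq
  rfl

theorem iterate_eq {p : Path.Homotopic.Quotient (D.pt a) (D.pt b)} (hp : D.IsWalk ρ a b m p) :
    (D.next ρ)^[m] a = b :=
  hp.1

theorem exists_of_iterate_eq (h : (D.next ρ)^[m] a = b) : ∃ p, D.IsWalk ρ a b m p :=
  ⟨_, h, rfl⟩

theorem cast {p : Path.Homotopic.Quotient (D.pt a) (D.pt b)} (hp : D.IsWalk ρ a b m p)
    (h : c = b) : D.IsWalk ρ a c m (p.cast rfl (congrArg D.pt h)) := by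
  subst h
  rwa [Path.Homotopic.Quotient.cast_rfl_rfl]

theorem congr_steps {p : Path.Homotopic.Quotient (D.pt a) (D.pt b)} (hp : D.IsWalk ρ a b m p)
    (h : m = k) : D.IsWalk ρ a b k p := by
  rwa [← h]

variable (D ρ a) in
theorem zero : D.IsWalk ρ a a 0 (Path.Homotopic.Quotient.refl _) :=
  ⟨rfl, (Path.Homotopic.Quotient.cast_rfl_rfl _).symm⟩

theorem snoc {p : Path.Homotopic.Quotient (D.pt a) (D.pt b)} (hp : D.IsWalk ρ a b m p) :
    D.IsWalk ρ a (D.next ρ b) (m + 1) (p.trans (Path.Homotopic.Quotient.mk (D.step ρ b))) := by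
  obtain ⟨rfl, rfl⟩ := hp
  refine ⟨Function.iterate_succ_apply' _ _ _, ?_⟩
  rw [Path.Homotopic.Quotient.cast_rfl_rfl]
  simp only [walkTo, Path.Homotopic.Quotient.mk_cast, Path.Homotopic.Quotient.mk_trans, Path.Homotopic.Quotient.cast_cast,
    Path.Homotopic.Quotient.cast_rfl_rfl]

variable (D ρ a) in
theorem single : D.IsWalk ρ a (D.next ρ a) 1 (Path.Homotopic.Quotient.mk (D.step ρ a)) := by
  have := (zero D ρ a).snoc
  rwa [Path.Homotopic.Quotient.refl_trans] at this

theorem trans {p : Path.Homotopic.Quotient (D.pt a) (D.pt b)}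
    {q : Path.Homotopic.Quotient (D.pt b) (D.pt c)} (hp : D.IsWalk ρ a b m p)
    (hq : D.IsWalk ρ b c k q) : D.IsWalk ρ a c (m + k) (p.trans q) := by
  induction k generalizing c with
  | zero =>
    obtain rfl : b = c := hq.iterate_eq
    rw [hq.unique (zero D ρ b), Path.Homotopic.Quotient.trans_refl]
    exact hp
  | succ k ih =>
    obtain rfl : D.next ρ ((D.next ρ)^[k] b) = c := by
      rw [← Function.iterate_succ_apply' (D.next ρ) k b]
      exact hq.iterate_eq
    obtain ⟨q', hq'⟩ := exists_of_iterate_eq (D := D) (ρ := ρ) (a := b) (m := k) rfl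
    rw [hq.unique hq'.snoc, ← Path.Homotopic.Quotient.trans_assoc]
    exact (ih hq').snoc

end IsWalk

variable (D)

theorem isWalk_walk (ρ : D.Resolution) (a : D.End) (m : ℕ) :
    D.IsWalk ρ a ((D.next ρ)^[m + 1] a) (m + 1) (Path.Homotopic.Quotient.mk (D.walk ρ a m)) := by
  induction m with
  | zero => exact IsWalk.single D ρ a
  | succ m ih => exact ih.snoc.cast (Function.iterate_succ_apply' (D.next ρ) (m + 1) a)

/-- The number of steps of the circle through `a`. -/
abbrev period (ρ : D.Resolution) (a : D.End) : ℕ := Function.minimalPeriod (D.next ρ) a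

theorem period_pos (ρ : D.Resolution) (a : D.End) : 0 < D.period ρ a :=
  minimalPeriod_pos_of_finite (D.next_injective ρ) a

theorem iterate_period' (ρ : D.Resolution) (a : D.End) : (D.next ρ)^[D.period ρ a] a = a :=
  Function.iterate_minimalPeriod

theorem loop_homotopic_of_isWalk {ρ : D.Resolution} {a : D.End} {γ : Path (D.pt a) (D.pt a)}
    (h : D.IsWalk ρ a a (D.period ρ a) (Path.Homotopic.Quotient.mk γ)) :
    (D.loop ρ a).Homotopic (circleOfPath γ) := by
  have h1 := (D.isWalk_walk ρ a (D.period ρ a - 1)).cast (D.iterate_period ρ a).symm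
  exact circleOfPath_congr ((h1.congr_steps (Nat.sub_add_cancel (D.period_pos ρ a))).unique h)

/-- The walk around the circle through `a`. -/
theorem exists_isWalk_loop (ρ : D.Resolution) (a : D.End) :
    ∃ γ : Path (D.pt a) (D.pt a), D.IsWalk ρ a a (D.period ρ a) (Path.Homotopic.Quotient.mk γ) ∧
      (D.loop ρ a).Homotopic (circleOfPath γ) := by
  obtain ⟨p, hp⟩ := IsWalk.exists_of_iterate_eq (D.iterate_period' ρ a)
  obtain ⟨γ, rfl⟩ := Path.Homotopic.Quotient.mk_surjective p
  exact ⟨γ, hp, D.loop_homotopic_of_isWalk hp⟩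

theorem smoothArc_smooth (ρ : D.Resolution) (a : D.End) (t : I) :
    D.smoothArc ρ (D.smooth ρ a) t = D.smoothArc ρ a (unitInterval.symm t) := by
  apply Subtype.ext
  change AffineMap.lineMap (D.pos (D.smooth ρ a)) (D.pos (D.smooth ρ (D.smooth ρ a))) (t : ℝ) =
    AffineMap.lineMap (D.pos a) (D.pos (D.smooth ρ a)) (unitInterval.symm t : ℝ)
  rw [D.smooth_smooth, unitInterval.coe_symm_eq, AffineMap.lineMap_apply_one_sub]

theorem next_opp_next (ρ : D.Resolution) (b : D.End) :
    D.next ρ (D.opp (D.next ρ b)) = D.opp b := by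
  simp only [next, D.opp_opp, D.smooth_smooth]

/-- A step of the walk in the opposite direction. -/
theorem isWalk_opp_next (ρ : D.Resolution) (b : D.End) :
    D.IsWalk ρ (D.opp (D.next ρ b)) (D.opp b) 1
      ((Path.Homotopic.Quotient.mk (D.arc (D.next ρ b))).symm.trans
        (Path.Homotopic.Quotient.mk (D.stepArc ρ b)).symm) := by
  have h := (IsWalk.single D ρ (D.opp (D.next ρ b))).cast (D.next_opp_next ρ b).symm
  have e : (D.step ρ (D.opp (D.next ρ b))).cast rfl
      (congrArg D.pt (D.next_opp_next ρ b).symm) =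
      (D.arc (D.next ρ b)).symm.trans (D.stepArc ρ b).symm := by
    ext t
    change (((D.arc _).trans (D.smoothArc ρ _)) t : ℂ) = _
    rw [Path.trans_apply, Path.trans_apply]
    split_ifs with ht
    · exact congrArg Subtype.val (D.arc_opp _ _)
    · refine congrArg Subtype.val (Eq.trans (b := D.smoothArc ρ (D.next ρ b) _) ?_
        (D.smoothArc_smooth ρ (D.opp b) _))
      exact congrArg (fun x => (D.smoothArc ρ x _ : X.carrier)) (D.opp_opp _)
  rw [← Path.Homotopic.Quotient.mk_cast, e] at h
  exact h

/-- Walking in the opposite direction. -/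
theorem IsWalk.reverse {ρ : D.Resolution} {a b : D.End} {m : ℕ}
    {p : Path.Homotopic.Quotient (D.pt a) (D.pt b)} (hp : D.IsWalk ρ a b m p) :
    D.IsWalk ρ (D.opp b) (D.opp a) m
      ((Path.Homotopic.Quotient.mk (D.arc b)).symm.trans (p.symm.trans (Path.Homotopic.Quotient.mk (D.arc a)))) := by
  induction m generalizing b with
  | zero =>
    obtain rfl : a = b := hp.iterate_eq
    rw [hp.unique (IsWalk.zero D ρ a)]
    have e : (Path.Homotopic.Quotient.refl (D.pt a)).symm = Path.Homotopic.Quotient.refl (D.pt a) := by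
      rw [← Path.Homotopic.Quotient.mk_refl, ← Path.Homotopic.Quotient.mk_symm, Path.refl_symm]
    rw [e, Path.Homotopic.Quotient.refl_trans, Path.Homotopic.Quotient.symm_trans]
    exact IsWalk.zero D ρ _
  | succ m ih =>
    obtain rfl : D.next ρ ((D.next ρ)^[m] a) = b := by
      rw [← Function.iterate_succ_apply' (D.next ρ) m a]
      exact hp.iterate_eq
    obtain ⟨p', hp'⟩ := IsWalk.exists_of_iterate_eq (D := D) (ρ := ρ) (a := a) (m := m) rfl
    have h := (D.isWalk_opp_next ρ _).trans (ih hp')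
    rw [hp.unique hp'.snoc, add_comm m 1, quotient_symm_trans_rev, mk_step,
      quotient_symm_trans_rev]
    simp only [Path.Homotopic.Quotient.trans_assoc] at h ⊢
    exact h

theorem period_opp (ρ : D.Resolution) (a : D.End) : D.period ρ (D.opp a) = D.period ρ a := by
  have key : ∀ a, D.period ρ (D.opp a) ∣ D.period ρ a := fun a => by
    obtain ⟨γ, hγ, -⟩ := D.exists_isWalk_loop ρ a
    exact Function.IsPeriodicPt.minimalPeriod_dvd (IsWalk.reverse D hγ).iterate_eq
  refine Nat.dvd_antisymm (key a) ?_
  have := key (D.opp a)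
  rwa [D.opp_opp] at this

theorem period_next (ρ : D.Resolution) (a : D.End) : D.period ρ (D.next ρ a) = D.period ρ a :=
  Function.minimalPeriod_apply ((D.next_injective ρ).mem_periodicPts a)

theorem loop_next_homotopic (ρ : D.Resolution) (a : D.End) :
    (D.loop ρ a).Homotopic (D.loop ρ (D.next ρ a)) := by
  obtain ⟨γ, hγ, h⟩ := D.exists_isWalk_loop ρ a
  obtain ⟨δ, hδ, h'⟩ := D.exists_isWalk_loop ρ (D.next ρ a)
  refine h.trans (.trans ?_ h'.symm)
  refine circleOfPath_conj (Path.Homotopic.Quotient.mk (D.step ρ a)) ?_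
  rw [period_next] at hδ
  have h1 := hγ.snoc
  have h2 := (IsWalk.single D ρ a).trans hδ
  rw [add_comm] at h2
  have h3 := h1.unique h2
  rw [← Path.Homotopic.Quotient.trans_assoc, ← h3, Path.Homotopic.Quotient.trans_assoc, Path.Homotopic.Quotient.trans_symm, Path.Homotopic.Quotient.trans_refl]

theorem loop_opp_homotopic (ρ : D.Resolution) (a : D.End) :
    (D.loop ρ (D.opp a)).Homotopic ((D.loop ρ a).comp circleNeg) := by
  obtain ⟨γ, hγ, h⟩ := D.exists_isWalk_loop ρ a
  obtain ⟨δ, hδ, h'⟩ := D.exists_isWalk_loop ρ (D.opp a)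
  refine h'.trans (.trans ?_ (circleNeg_homotopic h).symm)
  rw [← circleOfPath_symm]
  refine circleOfPath_conj (Path.Homotopic.Quotient.mk (D.arc a)).symm ?_
  rw [period_opp] at hδ
  rw [hδ.unique (IsWalk.reverse D hγ), Path.Homotopic.Quotient.mk_symm]
  congr 2
  obtain ⟨p, hp⟩ : ∃ p, p = D.arc a := ⟨_, rfl⟩
  rw [← Path.Homotopic.Quotient.mk_symm, ← Path.Homotopic.Quotient.mk_symm, Path.symm_symm]

theorem unorientedHomotopic_trans {f g h : C(UnitAddCircle, X.carrier)}
    (h1 : UnorientedHomotopic f g) (h2 : UnorientedHomotopic g h) : UnorientedHomotopic f h := by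
  rcases h1 with h1 | h1 <;> rcases h2 with h2 | h2
  · exact Or.inl (h1.trans h2)
  · exact Or.inr (h1.trans h2)
  · exact Or.inr (h1.trans (circleNeg_homotopic h2))
  · refine Or.inl (h1.trans ?_)
    have := circleNeg_homotopic h2
    rwa [comp_circleNeg_circleNeg] at this

/-- Up to orientation and homotopy, the closed curve of a circle does not depend on the end where
it starts. -/
theorem loop_unorientedHomotopic {ρ : D.Resolution} {a b : D.End}
    (h : D.circleAt ρ a = D.circleAt ρ b) : UnorientedHomotopic (D.loop ρ a) (D.loop ρ b) := by
  have hopp : ∀ b, UnorientedHomotopic (D.loop ρ b) (D.loop ρ (D.opp b)) := fun b => by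
    have := D.loop_opp_homotopic ρ (D.opp b)
    rw [D.opp_opp] at this
    exact Or.inr this
  refine D.mem_of_circleAt_eq {b | UnorientedHomotopic (D.loop ρ a) (D.loop ρ b)} ?_ ?_ h
    (Or.inl (.refl _))
  · exact fun b hb => unorientedHomotopic_trans hb (hopp b)
  · intro b hb
    have h2 := D.loop_next_homotopic ρ (D.opp b)
    rw [next, D.opp_opp] at h2
    exact unorientedHomotopic_trans hb (unorientedHomotopic_trans (hopp b) (Or.inl h2))

theorem circleCurve_unorientedHomotopic (ρ : D.Resolution) (a : D.End) :
    UnorientedHomotopic (D.circleCurve ρ (D.circleAt ρ a)) (D.loop ρ a) :=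
  D.loop_unorientedHomotopic (congrArg Sum.inl (Quot.out_eq _))

end Diagram

theorem quotient_trans_cast {Y : Type*} [TopologicalSpace Y] {x y z z' : Y}
    (p : Path.Homotopic.Quotient x y) (q : Path.Homotopic.Quotient y z) (h : z' = z) :
    (p.trans q).cast rfl h = p.trans (q.cast rfl h) := by
  subst h
  rw [Path.Homotopic.Quotient.cast_rfl_rfl, Path.Homotopic.Quotient.cast_rfl_rfl]

namespace Diagram

variable {n : ℕ} {X : PuncturedDisk n} (D : Diagram X)

/-! ### Changing the resolution of one crossing -/

/-- The resolutions `ρ` and `ρ'` differ at the crossing `j` and nowhere else. -/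
def DiffersAt (j : Fin D.num) (ρ ρ' : D.Resolution) : Prop :=
  (∀ i, i ≠ j → ρ i = ρ' i) ∧ ρ j ≠ ρ' j

variable {D} {j : Fin D.num} {ρ ρ' : D.Resolution}

theorem DiffersAt.symm (h : D.DiffersAt j ρ ρ') : D.DiffersAt j ρ' ρ :=
  ⟨fun i hi => (h.1 i hi).symm, h.2.symm⟩

theorem differsAt_update (ρ : D.Resolution) {j : Fin D.num} (h : ρ j = false) :
    D.DiffersAt j ρ (Function.update ρ j true) :=
  ⟨fun i hi => by rw [Function.update_of_ne hi], by simp [h]⟩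

theorem DiffersAt.smooth_eq (h : D.DiffersAt j ρ ρ') {a : D.End} (ha : a.1 ≠ j) :
    D.smooth ρ a = D.smooth ρ' a := by
  simp only [Crossings.smooth, h.1 a.1 ha]

theorem DiffersAt.next_eq (h : D.DiffersAt j ρ ρ') {a : D.End} (ha : (D.opp a).1 ≠ j) :
    D.next ρ a = D.next ρ' a :=
  h.smooth_eq ha

theorem DiffersAt.smooth_smooth (h : D.DiffersAt j ρ ρ') (k : ZMod 4) :
    D.smooth ρ' (D.smooth ρ (j, k)) = (j, k + 2) := by
  have e : ∀ k : ZMod 4, (1 : ZMod 4) - (3 - k) = k + 2 ∧ (3 : ZMod 4) - (1 - k) = k + 2 := by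
    decide
  have hj := h.2
  cases h1 : ρ j <;> cases h2 : ρ' j <;> simp only [Crossings.smooth, h1, h2]
  · exact absurd (h1.trans h2.symm) hj
  · exact Prod.ext rfl (e k).1
  · exact Prod.ext rfl (e k).2
  · exact absurd (h1.trans h2.symm) hj

variable (D j ρ) in
/-- Every end of a resolved crossing lies on one of the circles through the ends `1` and `3`. -/
theorem circleAt_eq_or (k : ZMod 4) :
    D.circleAt ρ (j, k) = D.circleAt ρ (j, 1) ∨ D.circleAt ρ (j, k) = D.circleAt ρ (j, 3) := by
  have four : ∀ k : ZMod 4, k = 0 ∨ k = 1 ∨ k = 2 ∨ k = 3 := by decide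
  have e := D.circleAt_smooth ρ (j, k)
  simp only [Crossings.smooth] at e
  rcases four k with rfl | rfl | rfl | rfl
  · cases h : ρ j <;> simp only [h] at e <;> rw [← e]
    · exact Or.inr rfl
    · exact Or.inl rfl
  · exact Or.inl rfl
  · cases h : ρ j <;> simp only [h] at e <;> rw [← e]
    · exact Or.inl rfl
    · exact Or.inr rfl
  · exact Or.inr rfl

/-- If the two strands of a resolved crossing lie on different circles, an end of the crossing and
its neighbour are the only ends of the crossing on their circle. -/
theorem eq_or_eq_smooth_of_circleAt_eq (h : D.circleAt ρ (j, 1) ≠ D.circleAt ρ (j, 3))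
    {k l : ZMod 4} (hkl : D.circleAt ρ (j, l) = D.circleAt ρ (j, k)) :
    ((j, l) : D.End) = (j, k) ∨ ((j, l) : D.End) = D.smooth ρ (j, k) := by
  have h0 := D.circleAt_smooth ρ (j, 0)
  have h2 := D.circleAt_smooth ρ (j, 2)
  have four : ∀ k : ZMod 4, k = 0 ∨ k = 1 ∨ k = 2 ∨ k = 3 := by decide
  simp only [Crossings.smooth, Prod.mk.injEq, true_and] at h0 h2 ⊢
  have a1 : (3 : ZMod 4) - 0 = 3 := rfl
  have a3 : (3 : ZMod 4) - 2 = 1 := rfl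
  have b1 : (1 : ZMod 4) - 0 = 1 := rfl
  have b3 : (1 : ZMod 4) - 2 = 3 := rfl
  cases hρ : ρ j <;> simp only [hρ, if_true, Bool.false_eq_true, if_false] at h0 h2 ⊢ <;>
    simp only [a1, a3, b1, b3] at h0 h2 <;>
    rcases four k with rfl | rfl | rfl | rfl <;> rcases four l with rfl | rfl | rfl | rfl <;>
    first
    | exact Or.inl rfl
    | exact Or.inr rfl
    | (exfalso; grind)

theorem DiffersAt.iterate_next_eq (h : D.DiffersAt j ρ ρ') {a : D.End} {m : ℕ}
    (ha : ∀ i < m, (D.opp ((D.next ρ)^[i] a)).1 ≠ j) :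
    (D.next ρ')^[m] a = (D.next ρ)^[m] a := by
  induction m with
  | zero => rfl
  | succ m ih =>
    rw [Function.iterate_succ_apply', Function.iterate_succ_apply',
      ih fun i hi => ha i (by omega), h.next_eq (ha m (by omega))]

theorem DiffersAt.isWalk_step (h : D.DiffersAt j ρ ρ') {c : D.End} (hc : (D.opp c).1 ≠ j) :
    D.IsWalk ρ' c (D.next ρ c) 1 (Path.Homotopic.Quotient.mk (D.step ρ c)) := by
  have h1 := (IsWalk.single D ρ' c).cast (h.next_eq hc)
  have e : (D.step ρ' c).cast rfl (congrArg D.pt (h.next_eq hc)) = D.step ρ c := by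
    ext t
    change (((D.arc c).trans (D.smoothArc ρ' _)) t : ℂ) =
      (((D.arc c).trans (D.smoothArc ρ _)) t : ℂ)
    rw [Path.trans_apply, Path.trans_apply]
    split_ifs with ht
    · rfl
    · rw [Crossings.smoothArc_coe, Crossings.smoothArc_coe, h.1 _ hc]
  rw [← Path.Homotopic.Quotient.mk_cast, e] at h1
  exact h1

/-- Walks that avoid the box of the crossing do not depend on its resolution. -/
theorem DiffersAt.isWalk (h : D.DiffersAt j ρ ρ') {a b : D.End} {m : ℕ}
    {p : Path.Homotopic.Quotient (D.pt a) (D.pt b)} (hp : D.IsWalk ρ a b m p)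
    (ha : ∀ i < m, (D.opp ((D.next ρ)^[i] a)).1 ≠ j) : D.IsWalk ρ' a b m p := by
  induction m generalizing b with
  | zero =>
    obtain rfl : a = b := hp.iterate_eq
    rw [hp.unique (IsWalk.zero D ρ a)]
    exact IsWalk.zero D ρ' a
  | succ m ih =>
    obtain rfl : D.next ρ ((D.next ρ)^[m] a) = b := by
      rw [← Function.iterate_succ_apply' (D.next ρ) m a]
      exact hp.iterate_eq
    obtain ⟨p', hp'⟩ := IsWalk.exists_of_iterate_eq (D := D) (ρ := ρ) (a := a) (m := m) rfl
    rw [hp.unique hp'.snoc]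
    exact (ih hp' fun i hi => ha i (by omega)).trans (h.isWalk_step (ha m (by omega)))

/-- The closed curve of a circle that avoids a crossing does not depend on its resolution. -/
theorem DiffersAt.loop_homotopic (h : D.DiffersAt j ρ ρ') {a : D.End}
    (ha : ∀ k, D.circleAt ρ a ≠ D.circleAt ρ (j, k)) :
    (D.loop ρ a).Homotopic (D.loop ρ' a) := by
  have hav : ∀ i, (D.opp ((D.next ρ)^[i] a)).1 ≠ j := by
    intro i hi
    have e : D.opp ((D.next ρ)^[i] a) = (j, (D.opp ((D.next ρ)^[i] a)).2) := Prod.ext hi rfl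
    apply ha (D.opp ((D.next ρ)^[i] a)).2
    rw [← e, circleAt_opp, circleAt_iterate]
  have hiter : ∀ m, (D.next ρ')^[m] a = (D.next ρ)^[m] a := fun m =>
    h.iterate_next_eq fun i _ => hav i
  have hper : D.period ρ' a = D.period ρ a := by
    apply Nat.dvd_antisymm
    · exact Function.IsPeriodicPt.minimalPeriod_dvd ((hiter _).trans (D.iterate_period' ρ a))
    · exact Function.IsPeriodicPt.minimalPeriod_dvd ((hiter _).symm.trans (D.iterate_period' ρ' a))
  obtain ⟨γ, hγ, hγ'⟩ := D.exists_isWalk_loop ρ a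
  refine hγ'.trans (D.loop_homotopic_of_isWalk ?_).symm
  rw [hper]
  exact h.isWalk hγ fun i _ => hav i

/-! ### Merging two circles -/

theorem mk_step_cast (σ' : D.Resolution) {c : D.End} {l m : ZMod 4} (hl : D.opp c = (j, l))
    (hm : D.next σ' c = (j, m)) :
    (Path.Homotopic.Quotient.mk (D.step σ' c)).cast rfl (congrArg D.pt hm.symm) =
      ((Path.Homotopic.Quotient.mk (D.arc c)).cast rfl (congrArg D.pt hl.symm)).trans
        (Path.Homotopic.Quotient.mk (D.chord j l m)) := by
  rw [← Path.Homotopic.Quotient.mk_cast, ← Path.Homotopic.Quotient.mk_cast,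
    ← Path.Homotopic.Quotient.mk_trans]
  congr 1
  ext t
  change (((D.arc c).trans (D.smoothArc σ' _)) t : ℂ) = _
  rw [Path.trans_apply, Path.trans_apply]
  split_ifs with ht
  · rfl
  · change AffineMap.lineMap (D.pos (D.opp c)) (D.pos (D.next σ' c)) _ =
      AffineMap.lineMap (D.pos (j, l)) (D.pos (j, m)) _
    rw [hl, hm]

theorem mk_eq_mk_of_mem_box (i : Fin D.num) {x y : X.carrier} (p q : Path x y)
    (hp : ∀ t, (p t : ℂ) ∈ Metric.closedBall (D.center i) ‖D.axis i‖)
    (hq : ∀ t, (q t : ℂ) ∈ Metric.closedBall (D.center i) ‖D.axis i‖) :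
    Path.Homotopic.Quotient.mk p = Path.Homotopic.Quotient.mk q := by
  refine Path.Homotopic.Quotient.eq.2 ⟨⟨⟨⟨fun z => ⟨AffineMap.lineMap (p z.2 : ℂ) (q z.2 : ℂ)
    (z.1 : ℝ), D.box_subset i ((convex_closedBall (D.center i) ‖D.axis i‖).lineMap_mem
      (hp z.2) (hq z.2) z.1.2)⟩, ?_⟩, fun t => ?_, fun t => ?_⟩, fun s t ht => ?_⟩⟩
  · refine Continuous.subtype_mk ?_ _
    simp only [AffineMap.lineMap_apply_module]
    fun_prop
  · exact Subtype.ext (by simp)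
  · exact Subtype.ext (by simp)
  · apply Subtype.ext
    rcases ht with rfl | rfl
    · simp
    · simp

theorem chord_mem_box (i : Fin D.num) (k l : ZMod 4) (t : I) :
    (D.chord i k l t : ℂ) ∈ Metric.closedBall (D.center i) ‖D.axis i‖ :=
  (convex_closedBall (D.center i) ‖D.axis i‖).lineMap_mem (D.pos_mem_box (i, k))
    (D.pos_mem_box (i, l)) t.2

theorem mk_chord_trans (i : Fin D.num) (k l m : ZMod 4) :
    (Path.Homotopic.Quotient.mk (D.chord i k l)).trans
      (Path.Homotopic.Quotient.mk (D.chord i l m)) =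
      Path.Homotopic.Quotient.mk (D.chord i k m) := by
  rw [← Path.Homotopic.Quotient.mk_trans]
  refine mk_eq_mk_of_mem_box i _ _ (fun t => ?_) (chord_mem_box i k m)
  rw [Path.trans_apply]
  split_ifs
  · exact chord_mem_box i k l _
  · exact chord_mem_box i l m _

theorem mk_chord_symm (i : Fin D.num) (k l : ZMod 4) :
    (Path.Homotopic.Quotient.mk (D.chord i k l)).symm =
      Path.Homotopic.Quotient.mk (D.chord i l k) := by
  rw [← Path.Homotopic.Quotient.mk_symm]
  exact mk_eq_mk_of_mem_box i _ _ (fun t => chord_mem_box i k l _) (chord_mem_box i l k)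

/-- If the two strands of a resolved crossing lie on different circles, the circle through the end
`k` consists of a walk outside the box and a single chord, which ends in `k + 2` after the
resolution of the crossing has been changed. -/
theorem DiffersAt.exists_outer_walk (h : D.DiffersAt j ρ ρ')
    (hne : D.circleAt ρ (j, 1) ≠ D.circleAt ρ (j, 3)) (k : ZMod 4) :
    (∀ i < D.period ρ (j, k), (D.next ρ')^[i] (j, k) = (D.next ρ)^[i] (j, k)) ∧
    ∃ (l : ZMod 4) (A : Path.Homotopic.Quotient (D.pt (j, k)) (D.pt (j, l))),
      D.IsWalk ρ (j, k) (j, k) (D.period ρ (j, k))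
        (A.trans (Path.Homotopic.Quotient.mk (D.chord j l k))) ∧
      D.IsWalk ρ' (j, k) (j, k + 2) (D.period ρ (j, k))
        (A.trans (Path.Homotopic.Quotient.mk (D.chord j l (k + 2)))) := by
  obtain ⟨N, hN⟩ : ∃ N, D.period ρ (j, k) = N + 1 :=
    ⟨_, (Nat.sub_add_cancel (D.period_pos ρ (j, k))).symm⟩
  have hper := D.iterate_period' ρ (j, k)
  rw [hN, Function.iterate_succ_apply'] at hper
  obtain ⟨l, hl⟩ : ∃ l, D.smooth ρ (j, k) = (j, l) := ⟨_, rfl⟩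
  have hopp : ∀ c, D.next ρ c = (j, k) → D.opp c = (j, l) := fun c hc => by
    rw [← hl, ← hc, next, D.smooth_smooth]
  -- the walk meets the box for the first time in its last step
  have hav : ∀ i < N, (D.opp ((D.next ρ)^[i] (j, k))).1 ≠ j := by
    intro i hi hij
    have e : D.opp ((D.next ρ)^[i] (j, k)) = (j, (D.opp ((D.next ρ)^[i] (j, k))).2) :=
      Prod.ext hij rfl
    have hc : D.circleAt ρ (j, (D.opp ((D.next ρ)^[i] (j, k))).2) = D.circleAt ρ (j, k) := by
      rw [← e, circleAt_opp, circleAt_iterate]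
    rcases eq_or_eq_smooth_of_circleAt_eq hne hc with h1 | h1
    · exact D.iterate_next_ne_opp ρ (j, k) 0 i (h1.symm.trans e.symm)
    · have h2 : (D.next ρ)^[i + 1] (j, k) = (j, k) := by
        rw [Function.iterate_succ_apply', next, e, h1, D.smooth_smooth]
      refine Function.not_isPeriodicPt_of_pos_of_lt_minimalPeriod (Nat.succ_ne_zero i) ?_ h2
      change i + 1 < D.period ρ (j, k)
      omega
  refine ⟨fun i hi => h.iterate_next_eq fun i' hi' => hav i' (by omega), l, ?_⟩
  obtain ⟨q, hq⟩ := IsWalk.exists_of_iterate_eq (D := D) (ρ := ρ) (a := (j, k)) (m := N) rfl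
  have hq' := h.isWalk hq hav
  generalize (D.next ρ)^[N] (j, k) = c at hper q hq hq'
  have hc := hopp c hper
  have hc' : D.next ρ' c = (j, k + 2) := by
    rw [next, hc, ← hl, h.smooth_smooth]
  refine ⟨q.trans ((Path.Homotopic.Quotient.mk (D.arc c)).cast rfl (congrArg D.pt hc.symm)),
    ?_, ?_⟩
  · have := hq.snoc.cast hper.symm
    rwa [quotient_trans_cast, mk_step_cast ρ hc hper, ← Path.Homotopic.Quotient.trans_assoc,
      ← hN] at this
  · have := hq'.snoc.cast hc'.symm
    rwa [quotient_trans_cast, mk_step_cast ρ' hc hc', ← Path.Homotopic.Quotient.trans_assoc,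
      ← hN] at this

/-- If the two strands of a crossing lie on different circles in one resolution, they lie on the
same circle in the other one. -/
theorem DiffersAt.circleAt_eq (h : D.DiffersAt j ρ ρ')
    (hne : D.circleAt ρ (j, 1) ≠ D.circleAt ρ (j, 3)) :
    D.circleAt ρ' (j, 1) = D.circleAt ρ' (j, 3) := by
  obtain ⟨-, l, A, -, hA⟩ := h.exists_outer_walk hne 1
  have := hA.iterate_eq
  rw [← D.circleAt_iterate ρ' (j, 1) (D.period ρ (j, 1)), this]
  rfl

/-- A change of resolution at `j` merges two circles or splits a circle into two. -/
theorem DiffersAt.circleAt_eq_iff (h : D.DiffersAt j ρ ρ') :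
    D.circleAt ρ' (j, 1) = D.circleAt ρ' (j, 3) ↔
      D.circleAt ρ (j, 1) ≠ D.circleAt ρ (j, 3) :=
  ⟨fun h' h'' => D.circleAt_ne_of_circleAt_eq h.1 h.2 h'' h', h.circleAt_eq⟩

/-- When two circles are merged, the new circle is the union of the old ones, and all the other
circles stay the same. -/
theorem DiffersAt.circleAt_eq_circleAt_iff (h : D.DiffersAt j ρ ρ')
    (hne : D.circleAt ρ (j, 1) ≠ D.circleAt ρ (j, 3)) (a b : D.End) :
    D.circleAt ρ' a = D.circleAt ρ' b ↔ D.circleAt ρ a = D.circleAt ρ b ∨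
      ((D.circleAt ρ a = D.circleAt ρ (j, 1) ∨ D.circleAt ρ a = D.circleAt ρ (j, 3)) ∧
        (D.circleAt ρ b = D.circleAt ρ (j, 1) ∨ D.circleAt ρ b = D.circleAt ρ (j, 3))) := by
  have hmerge := h.circleAt_eq hne
  have hall : ∀ k, D.circleAt ρ' (j, k) = D.circleAt ρ' (j, 1) := fun k => by
    rcases D.circleAt_eq_or j ρ' k with e | e
    · exact e
    · exact e.trans hmerge.symm
  have hsub : ∀ a b, D.circleAt ρ a = D.circleAt ρ b → D.circleAt ρ' a = D.circleAt ρ' b := by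
    intro a b hab
    refine D.mem_of_circleAt_eq {b | D.circleAt ρ' a = D.circleAt ρ' b} ?_ ?_ hab rfl
    · intro x hx
      rwa [Set.mem_ofPred_eq, circleAt_opp]
    · rintro ⟨i, k⟩ hx
      by_cases hi : i = j
      · subst hi
        exact (Eq.trans hx (hall k)).trans (hall _).symm
      · rwa [h.smooth_eq hi, Set.mem_ofPred_eq, circleAt_smooth]
  constructor
  · intro hab
    refine D.mem_of_circleAt_eq {b | D.circleAt ρ a = D.circleAt ρ b ∨
      ((D.circleAt ρ a = D.circleAt ρ (j, 1) ∨ D.circleAt ρ a = D.circleAt ρ (j, 3)) ∧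
        (D.circleAt ρ b = D.circleAt ρ (j, 1) ∨ D.circleAt ρ b = D.circleAt ρ (j, 3)))}
      ?_ ?_ hab (Or.inl rfl)
    · intro x hx
      simpa only [Set.mem_ofPred_eq, circleAt_opp] using hx
    · rintro ⟨i, k⟩ hx
      by_cases hi : i = j
      · subst hi
        refine Or.inr ⟨?_, D.circleAt_eq_or i ρ _⟩
        rcases hx with hx | hx
        · rw [hx]
          exact D.circleAt_eq_or i ρ k
        · exact hx.1
      · rw [← h.smooth_eq hi]
        simpa only [Set.mem_ofPred_eq, circleAt_smooth] using hx
  · have hon : ∀ a, (D.circleAt ρ a = D.circleAt ρ (j, 1) ∨ D.circleAt ρ a = D.circleAt ρ (j, 3)) →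
        D.circleAt ρ' a = D.circleAt ρ' (j, 1) := by
      rintro a (ha | ha)
      · exact hsub _ _ ha
      · exact (hsub _ _ ha).trans hmerge.symm
    rintro (hab | ⟨ha, hb⟩)
    · exact hsub a b hab
    · rw [hon a ha, hon b hb]

/-- The period of a merged circle is the sum of the periods of the two parts. -/
theorem DiffersAt.period_add (h : D.DiffersAt j ρ ρ')
    (hne : D.circleAt ρ (j, 1) ≠ D.circleAt ρ (j, 3)) :
    D.period ρ' (j, 1) = D.period ρ (j, 1) + D.period ρ (j, 3) := by
  obtain ⟨h1, l, A, -, hA⟩ := h.exists_outer_walk hne 1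
  obtain ⟨h3, l', B, -, hB⟩ := h.exists_outer_walk hne 3
  have hA' : (D.next ρ')^[D.period ρ (j, 1)] (j, 1) = (j, 3) := hA.iterate_eq
  have hB' : (D.next ρ')^[D.period ρ (j, 3)] (j, 3) = (j, 1) := hB.iterate_eq
  have hper : (D.next ρ')^[D.period ρ (j, 1) + D.period ρ (j, 3)] (j, 1) = (j, 1) := by
    rw [add_comm, Function.iterate_add_apply, hA', hB']
  refine le_antisymm (Function.IsPeriodicPt.minimalPeriod_le ?_ hper) ?_
  · have := D.period_pos ρ (j, 1)
    omega
  · by_contra! hlt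
    have hpos := D.period_pos ρ' (j, 1)
    have hM := D.iterate_period' ρ' (j, 1)
    rcases lt_or_ge (D.period ρ' (j, 1)) (D.period ρ (j, 1)) with hc | hc
    · rw [h1 _ hc] at hM
      exact Function.not_isPeriodicPt_of_pos_of_lt_minimalPeriod hpos.ne' hc hM
    · obtain ⟨m, hm⟩ := Nat.exists_eq_add_of_le' hc
      rw [hm, Function.iterate_add_apply, hA', h3 m (by omega)] at hM
      apply hne
      rw [← hM, circleAt_iterate]

/-- When two circles are merged, the new closed curve is the product of the old ones: closed paths
at a common base point can be chosen that trace the two old curves and whose concatenation traces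
the new one. -/
theorem DiffersAt.exists_pants (h : D.DiffersAt j ρ ρ')
    (hne : D.circleAt ρ (j, 1) ≠ D.circleAt ρ (j, 3)) :
    ∃ (x : X.carrier) (a b : Path x x), (D.loop ρ (j, 1)).Homotopic (circleOfPath a) ∧
      (D.loop ρ (j, 3)).Homotopic (circleOfPath b) ∧
      (D.loop ρ' (j, 1)).Homotopic (circleOfPath (a.trans b)) := by
  obtain ⟨-, l, A, hA, hA'⟩ := h.exists_outer_walk hne 1
  obtain ⟨-, l', B, hB, hB'⟩ := h.exists_outer_walk hne 3
  have hper := h.period_add hne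
  have hC := hA'.trans hB'
  rw [← hper] at hC
  obtain ⟨a, ha⟩ := Path.Homotopic.Quotient.mk_surjective
    (A.trans (Path.Homotopic.Quotient.mk (D.chord j l 1)))
  obtain ⟨b₀, hb₀⟩ := Path.Homotopic.Quotient.mk_surjective
    (B.trans (Path.Homotopic.Quotient.mk (D.chord j l' 3)))
  obtain ⟨b, hb⟩ := Path.Homotopic.Quotient.mk_surjective
    ((Path.Homotopic.Quotient.mk (D.chord j 1 3)).trans ((Path.Homotopic.Quotient.mk b₀).trans
      (Path.Homotopic.Quotient.mk (D.chord j 1 3)).symm))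
  rw [← ha] at hA
  rw [← hb₀] at hB
  refine ⟨_, a, b, D.loop_homotopic_of_isWalk hA,
    (D.loop_homotopic_of_isWalk hB).trans (circleOfPath_conj _ hb).symm,
    D.loop_homotopic_of_isWalk ?_⟩
  rw [Path.Homotopic.Quotient.mk_trans, ha, hb, hb₀, mk_chord_symm]
  simp only [Path.Homotopic.Quotient.trans_assoc]
  rw [mk_chord_trans, ← Path.Homotopic.Quotient.trans_assoc
    (Path.Homotopic.Quotient.mk (D.chord j l 1)), mk_chord_trans]
  rw [Path.Homotopic.Quotient.trans_assoc] at hC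
  exact hC

end Diagram

section Pants

variable {n : ℕ} {X : PuncturedDisk n}

/-! ### Pairs of pants and triangle inequalities -/

theorem UnorientedHomotopic.symm {γ δ : C(UnitAddCircle, X.carrier)}
    (h : UnorientedHomotopic γ δ) : UnorientedHomotopic δ γ := by
  rcases h with h | h
  · exact Or.inl h.symm
  · have := h.comp (.refl circleNeg)
    rw [comp_circleNeg_circleNeg] at this
    exact Or.inr this.symm

theorem UnorientedHomotopic.nullhomotopic {γ δ : C(UnitAddCircle, X.carrier)}
    (h : UnorientedHomotopic γ δ) (hδ : δ.Nullhomotopic) : γ.Nullhomotopic := by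
  rcases h with h | h
  · exact nullhomotopic_of_homotopic h hδ
  · exact nullhomotopic_of_homotopic h (nullhomotopic_comp_circleNeg hδ)

/-- Three unoriented closed curves that are homotopic to the three boundary curves of a pair of
pants: closed paths `a`, `b` at a common base point and their concatenation. -/
def IsPants (α β γ : C(UnitAddCircle, X.carrier)) : Prop :=
  ∃ (x : X.carrier) (a b : Path x x), UnorientedHomotopic α (circleOfPath a) ∧
    UnorientedHomotopic β (circleOfPath b) ∧ UnorientedHomotopic γ (circleOfPath (a.trans b))

theorem IsPants.positiveClass_le {α β γ : C(UnitAddCircle, X.carrier)} (h : IsPants α β γ) :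
    positiveClass X γ ≤ positiveClass X α + positiveClass X β ∧
    positiveClass X α ≤ positiveClass X β + positiveClass X γ ∧
    positiveClass X β ≤ positiveClass X α + positiveClass X γ := by
  obtain ⟨x, a, b, ha, hb, hc⟩ := h
  rw [positiveClass_congr ha, positiveClass_congr hb, positiveClass_congr hc]
  have key := orientedClass_trans a b
  refine ⟨fun i => ?_, fun i => ?_, fun i => ?_⟩ <;>
    simp only [positiveClass, Pi.add_apply, key] <;>
    generalize orientedClass X (circleOfPath a) i = u <;>
    generalize orientedClass X (circleOfPath b) i = v
  · exact abs_add_le u v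
  · rw [← abs_neg v]
    simpa [add_comm] using abs_add_le (u + v) (-v)
  · rw [← abs_neg u]
    simpa [add_comm] using abs_add_le (u + v) (-u)

/-- If one of the boundary curves of a pair of pants is contractible, the other two agree. -/
theorem IsPants.unorientedHomotopic {α β γ : C(UnitAddCircle, X.carrier)} (h : IsPants α β γ) :
    (α.Nullhomotopic → UnorientedHomotopic β γ) ∧ (β.Nullhomotopic → UnorientedHomotopic α γ) ∧
    (γ.Nullhomotopic → UnorientedHomotopic α β) := by
  obtain ⟨x, a, b, ha, hb, hc⟩ := h
  refine ⟨fun h0 => ?_, fun h0 => ?_, fun h0 => ?_⟩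
  · have e := mk_eq_refl_of_nullhomotopic (ha.symm.nullhomotopic h0)
    refine Diagram.unorientedHomotopic_trans hb
      (Diagram.unorientedHomotopic_trans (Or.inl (circleOfPath_congr ?_)) hc.symm)
    rw [Path.Homotopic.Quotient.mk_trans, e, Path.Homotopic.Quotient.refl_trans]
  · have e := mk_eq_refl_of_nullhomotopic (hb.symm.nullhomotopic h0)
    refine Diagram.unorientedHomotopic_trans ha
      (Diagram.unorientedHomotopic_trans (Or.inl (circleOfPath_congr ?_)) hc.symm)
    rw [Path.Homotopic.Quotient.mk_trans, e, Path.Homotopic.Quotient.trans_refl]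
  · have e := mk_eq_refl_of_nullhomotopic (hc.symm.nullhomotopic h0)
    refine Diagram.unorientedHomotopic_trans ha
      (Diagram.unorientedHomotopic_trans (Or.inr ?_) hb.symm)
    rw [← circleOfPath_symm]
    apply circleOfPath_congr
    rw [Path.Homotopic.Quotient.mk_trans] at e
    rw [Path.Homotopic.Quotient.mk_symm]
    calc Path.Homotopic.Quotient.mk a
        = ((Path.Homotopic.Quotient.mk a).trans (Path.Homotopic.Quotient.mk b)).trans
            (Path.Homotopic.Quotient.mk b).symm := by
          rw [Path.Homotopic.Quotient.trans_assoc, Path.Homotopic.Quotient.trans_symm,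
            Path.Homotopic.Quotient.trans_refl]
      _ = _ := by rw [e, Path.Homotopic.Quotient.refl_trans]

theorem curveElement_of_nullhomotopic {γ : C(UnitAddCircle, X.carrier)} (h : γ.Nullhomotopic) :
    curveElement γ = 0 := by
  rw [curveElement, dif_neg fun h' => h'.2 h]

theorem curveElement_congr {γ δ : C(UnitAddCircle, X.carrier)} (hγ : Function.Injective γ)
    (hδ : Function.Injective δ) (h : UnorientedHomotopic γ δ) :
    curveElement γ = curveElement δ := by
  by_cases h0 : δ.Nullhomotopic
  · rw [curveElement_of_nullhomotopic h0, curveElement_of_nullhomotopic (h.nullhomotopic h0)]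
  · have h1 : ¬ γ.Nullhomotopic := fun h1 => h0 (h.symm.nullhomotopic h1)
    rw [curveElement, curveElement, dif_pos ⟨hγ, h1⟩, dif_pos ⟨hδ, h0⟩]
    exact congrArg CurveGroup.of (Quotient.sound h)

theorem coeffSum_add (a b : CurveGroup X) : (a + b).coeffSum = a.coeffSum + b.coeffSum :=
  Finsupp.sum_add_index' (fun _ => rfl) fun _ _ _ => rfl

theorem coeffSum_curveElement {γ : C(UnitAddCircle, X.carrier)} (hγ : Function.Injective γ)
    (h : ¬ γ.Nullhomotopic) : (curveElement γ).coeffSum = 1 := by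
  rw [curveElement, dif_pos ⟨hγ, h⟩]
  exact Finsupp.sum_single_index rfl

theorem curveElement_nonneg {γ : C(UnitAddCircle, X.carrier)} (hγ : Function.Injective γ) :
    0 ≤ curveElement γ := by
  by_cases h : γ.Nullhomotopic
  · rw [curveElement_of_nullhomotopic h]
  · right
    rw [coeffSum_curveElement hγ h]
    exact Int.one_pos

instance : IsOrderedAddMonoid (CurveGroup X) where
  add_le_add_left := by
    rintro a b (rfl | h) c
    · exact le_rfl
    · right
      rw [coeffSum_add, coeffSum_add]
      exact add_lt_add_left h _

theorem IsPants.curveElement_le {α β γ : C(UnitAddCircle, X.carrier)} (h : IsPants α β γ)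
    (hα : Function.Injective α) (hβ : Function.Injective β) (hγ : Function.Injective γ) :
    curveElement γ ≤ curveElement α + curveElement β ∧
    curveElement α ≤ curveElement β + curveElement γ ∧
    curveElement β ≤ curveElement α + curveElement γ := by
  obtain ⟨h1, h2, h3⟩ := h.unorientedHomotopic
  have pα := curveElement_nonneg hα
  have pβ := curveElement_nonneg hβ
  have pγ := curveElement_nonneg hγ
  by_cases hα0 : α.Nullhomotopic
  · rw [curveElement_congr hβ hγ (h1 hα0), curveElement_of_nullhomotopic hα0, zero_add]
    exact ⟨le_rfl, add_nonneg pγ pγ, le_rfl⟩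
  by_cases hβ0 : β.Nullhomotopic
  · rw [curveElement_congr hα hγ (h2 hβ0), curveElement_of_nullhomotopic hβ0, zero_add, add_zero]
    exact ⟨le_rfl, le_rfl, add_nonneg pγ pγ⟩
  by_cases hγ0 : γ.Nullhomotopic
  · rw [curveElement_congr hα hβ (h3 hγ0), curveElement_of_nullhomotopic hγ0, add_zero]
    exact ⟨add_nonneg pβ pβ, le_rfl, le_rfl⟩
  refine ⟨Or.inr ?_, Or.inr ?_, Or.inr ?_⟩ <;>
    rw [coeffSum_add, coeffSum_curveElement hα hα0, coeffSum_curveElement hβ hβ0,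
      coeffSum_curveElement hγ hγ0] <;> norm_num

theorem hurewicz_curveElement {γ : C(UnitAddCircle, X.carrier)} (hγ : Function.Injective γ) :
    hurewicz X (curveElement γ) = positiveClass X γ := by
  by_cases h : γ.Nullhomotopic
  · rw [curveElement_of_nullhomotopic h, positiveClass_of_nullhomotopic h, map_zero]
  · rw [curveElement, dif_pos ⟨hγ, h⟩]
    refine (Finsupp.linearCombination_single ℤ _ _).trans ?_
    rw [one_smul]
    rfl

end Pants

namespace Diagram

variable {n : ℕ} {X : PuncturedDisk n} {D : Diagram X} {j : Fin D.num} {ρ ρ' : D.Resolution}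

/-! ### Sums over the circles of a resolution -/

variable (D j ρ) in
/-- The circle through the end `a` does not pass through the crossing `j`. -/
def IsAway (a : D.End) : Prop := ∀ k, D.circleAt ρ a ≠ D.circleAt ρ (j, k)

theorem isAway_iff {a : D.End} : D.IsAway j ρ a ↔
    D.circleAt ρ a ≠ D.circleAt ρ (j, 1) ∧ D.circleAt ρ a ≠ D.circleAt ρ (j, 3) := by
  refine ⟨fun h => ⟨h 1, h 3⟩, fun h k hk => ?_⟩
  rcases D.circleAt_eq_or j ρ k with e | e
  · exact h.1 (hk.trans e)
  · exact h.2 (hk.trans e)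

theorem DiffersAt.isAway_iff_isAway (h : D.DiffersAt j ρ ρ') {a : D.End} :
    D.IsAway j ρ a ↔ D.IsAway j ρ' a := by
  have key : ∀ {ρ ρ'}, D.DiffersAt j ρ ρ' → D.circleAt ρ (j, 1) ≠ D.circleAt ρ (j, 3) →
      (D.IsAway j ρ a ↔ D.IsAway j ρ' a) := by
    intro ρ ρ' h hne
    have h1 := h.circleAt_eq_circleAt_iff hne a (j, 1)
    have h3 := h.circleAt_eq_circleAt_iff hne a (j, 3)
    rw [isAway_iff, isAway_iff]
    grind
  by_cases hne : D.circleAt ρ (j, 1) = D.circleAt ρ (j, 3)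
  · exact (key h.symm (h.symm.circleAt_eq_iff.1 hne)).symm
  · exact key h hne

theorem circle_cases (c : D.Circles ρ) :
    (∃ a, c = D.circleAt ρ a) ∨ ∃ i, c = Sum.inr i := by
  rcases c with c | i
  · obtain ⟨a, rfl⟩ := Quot.exists_rep c
    exact Or.inl ⟨a, rfl⟩
  · exact Or.inr ⟨i, rfl⟩

/-- Sums over the circles before and after a merge agree up to the circles at the crossing. -/
theorem DiffersAt.sum_circles (h : D.DiffersAt j ρ ρ')
    (hne : D.circleAt ρ (j, 1) ≠ D.circleAt ρ (j, 3)) {P : Type*} [AddCommGroup P]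
    (F : D.Circles ρ → P) (G : D.Circles ρ' → P)
    (haway : ∀ a, D.IsAway j ρ a → F (D.circleAt ρ a) = G (D.circleAt ρ' a))
    (hfree : ∀ i, F (Sum.inr i) = G (Sum.inr i)) :
    ∑ c, F c + G (D.circleAt ρ' (j, 1)) =
      ∑ c, G c + (F (D.circleAt ρ (j, 1)) + F (D.circleAt ρ (j, 3))) := by
  classical
  have hiff := h.circleAt_eq_circleAt_iff hne
  have hmerge := h.circleAt_eq hne
  let f : D.Circles ρ → D.Circles ρ' := Sum.elim
    (Quot.lift (fun a => D.circleAt ρ' a) fun a b hab =>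
      (hiff a b).2 (Or.inl (congrArg Sum.inl (Quot.sound hab)))) Sum.inr
  have hF : ∑ c, F c = ∑ c ∈ Finset.univ.filter (fun c => c ≠ D.circleAt ρ (j, 1) ∧
      c ≠ D.circleAt ρ (j, 3)), F c + (F (D.circleAt ρ (j, 1)) + F (D.circleAt ρ (j, 3))) := by
    rw [← Finset.sum_filter_add_sum_filter_not Finset.univ
      (fun c => c ≠ D.circleAt ρ (j, 1) ∧ c ≠ D.circleAt ρ (j, 3))]
    congr 1
    rw [← Finset.sum_pair hne]
    refine Finset.sum_congr ?_ fun _ _ => rfl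
    ext c
    simp only [Finset.mem_filter, Finset.mem_univ, true_and, Finset.mem_insert,
      Finset.mem_singleton]
    tauto
  have hG : ∑ c, G c = ∑ c ∈ Finset.univ.filter (fun c => c ≠ D.circleAt ρ' (j, 1)), G c +
      G (D.circleAt ρ' (j, 1)) := by
    rw [← Finset.sum_filter_add_sum_filter_not Finset.univ (fun c => c ≠ D.circleAt ρ' (j, 1))]
    congr 1
    simp only [ne_eq, not_not, Finset.filter_eq', Finset.mem_univ, if_true, Finset.sum_singleton]
  have hFG : ∑ c ∈ Finset.univ.filter (fun c => c ≠ D.circleAt ρ (j, 1) ∧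
      c ≠ D.circleAt ρ (j, 3)), F c =
      ∑ c ∈ Finset.univ.filter (fun c => c ≠ D.circleAt ρ' (j, 1)), G c := by
    have hfa : ∀ a, f (D.circleAt ρ a) = D.circleAt ρ' a := fun _ => rfl
    have hfi : ∀ i, f (Sum.inr i) = Sum.inr i := fun _ => rfl
    refine Finset.sum_nbij f ?_ ?_ ?_ ?_
    · intro c hc
      simp only [Finset.mem_filter, Finset.mem_univ, true_and] at hc ⊢
      obtain ⟨a, rfl⟩ | ⟨i, rfl⟩ := circle_cases c
      · have := hiff a (j, 1)
        rw [hfa]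
        tauto
      · rw [hfi]
        exact Sum.inr_ne_inl
    · intro c hc c' hc' hcc
      simp only [Finset.coe_filter, Finset.mem_univ, true_and, Set.mem_ofPred_eq] at hc hc'
      obtain ⟨a, rfl⟩ | ⟨i, rfl⟩ := circle_cases c <;>
        obtain ⟨b, rfl⟩ | ⟨i', rfl⟩ := circle_cases c'
      · rw [hfa, hfa, hiff] at hcc
        tauto
      · exact absurd hcc.symm Sum.inr_ne_inl
      · exact absurd hcc Sum.inr_ne_inl
      · rwa [hfi, hfi, Sum.inr.injEq, ← Sum.inr.injEq] at hcc
    · intro c hc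
      simp only [Finset.coe_filter, Finset.mem_univ, true_and, Set.mem_ofPred_eq] at hc
      obtain ⟨a, rfl⟩ | ⟨i, rfl⟩ := circle_cases c
      · refine ⟨D.circleAt ρ a, ?_, rfl⟩
        simp only [Finset.coe_filter, Finset.mem_univ, true_and, Set.mem_ofPred_eq]
        have h1 := hiff a (j, 1)
        tauto
      · exact ⟨Sum.inr i, by simp, rfl⟩
    · intro c hc
      simp only [Finset.mem_filter, Finset.mem_univ, true_and] at hc
      obtain ⟨a, rfl⟩ | ⟨i, rfl⟩ := circle_cases c
      · exact haway a (isAway_iff.2 hc)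
      · exact hfree i
  rw [hF, hG, hFG]
  abel

/-! ### The differential and the gradings -/

theorem DiffersAt.agreeAway_symm {x y : D.State} (h : D.DiffersAt j x.1 y.1)
    (hxy : D.AgreeAway j x y) : D.AgreeAway j y x :=
  ⟨fun a ha => (hxy.1 a (h.isAway_iff_isAway.2 ha)).symm, fun i => (hxy.2 i).symm⟩

/-- The degree of an enhanced state that is given by a function of closed curves. -/
def signedSum {P : Type*} [AddCommGroup P] (f : C(UnitAddCircle, X.carrier) → P) (x : D.State) :
    P := ∑ c, (x.2 c : ℤ) • f (D.circleCurve x.1 c)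

section SignedSum

variable {P : Type*} [AddCommGroup P] {f : C(UnitAddCircle, X.carrier) → P}

theorem DiffersAt.signedSum_add {x y : D.State} (h : D.DiffersAt j x.1 y.1)
    (hf : ∀ γ δ : C(UnitAddCircle, X.carrier), Function.Injective γ → Function.Injective δ →
      UnorientedHomotopic γ δ → f γ = f δ)
    (hne : D.circleAt x.1 (j, 1) ≠ D.circleAt x.1 (j, 3)) (hxy : D.AgreeAway j x y) :
    signedSum f x + (y.2 (D.circleAt y.1 (j, 1)) : ℤ) •
        f (D.circleCurve y.1 (D.circleAt y.1 (j, 1))) =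
      signedSum f y + ((x.2 (D.circleAt x.1 (j, 1)) : ℤ) •
        f (D.circleCurve x.1 (D.circleAt x.1 (j, 1))) + (x.2 (D.circleAt x.1 (j, 3)) : ℤ) •
        f (D.circleCurve x.1 (D.circleAt x.1 (j, 3)))) := by
  refine h.sum_circles hne (fun c => (x.2 c : ℤ) • f (D.circleCurve x.1 c))
    (fun c => (y.2 c : ℤ) • f (D.circleCurve y.1 c)) (fun a ha => ?_) fun i => ?_
  · have e : f (D.circleCurve x.1 (D.circleAt x.1 a)) = f (D.circleCurve y.1 (D.circleAt y.1 a)) :=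
      hf _ _ (D.circleCurve_injective _ _) (D.circleCurve_injective _ _)
        (unorientedHomotopic_trans (D.circleCurve_unorientedHomotopic x.1 a)
          (unorientedHomotopic_trans (Or.inl (h.loop_homotopic ha))
            (D.circleCurve_unorientedHomotopic y.1 a).symm))
    simp only [hxy.1 a ha, e]
  · simp only [hxy.2 i]
    rfl

theorem DiffersAt.isPants (h : D.DiffersAt j ρ ρ')
    (hne : D.circleAt ρ (j, 1) ≠ D.circleAt ρ (j, 3)) :
    IsPants (D.circleCurve ρ (D.circleAt ρ (j, 1))) (D.circleCurve ρ (D.circleAt ρ (j, 3)))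
      (D.circleCurve ρ' (D.circleAt ρ' (j, 1))) := by
  obtain ⟨x, a, b, ha, hb, hc⟩ := h.exists_pants hne
  exact ⟨x, a, b,
    unorientedHomotopic_trans (D.circleCurve_unorientedHomotopic ρ _) (Or.inl ha),
    unorientedHomotopic_trans (D.circleCurve_unorientedHomotopic ρ _) (Or.inl hb),
    unorientedHomotopic_trans (D.circleCurve_unorientedHomotopic ρ' _) (Or.inl hc)⟩

theorem mergeCoeff_ne_zero {a b c : ℤˣ} (h : mergeCoeff a b c ≠ 0) :
    (a = 1 ∧ b = 1 ∧ c = 1) ∨ (a = 1 ∧ b = -1 ∧ c = -1) ∨ (a = -1 ∧ b = 1 ∧ c = -1) := by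
  by_contra h'
  exact h (if_neg h')

theorem splitCoeff_ne_zero {a b c : ℤˣ} (h : splitCoeff a b c ≠ 0) :
    (a = 1 ∧ b = 1 ∧ c = -1) ∨ (a = 1 ∧ b = -1 ∧ c = 1) ∨ (a = -1 ∧ b = -1 ∧ c = -1) := by
  by_contra h'
  exact h (if_neg h')

theorem DiffersAt.edgeCoeff_eq_merge {x y : D.State} (h : D.DiffersAt j x.1 y.1)
    (hne : D.circleAt x.1 (j, 1) ≠ D.circleAt x.1 (j, 3)) (hxy : D.AgreeAway j x y) :
    D.edgeCoeff j x y = mergeCoeff (x.2 (D.circleAt x.1 (j, 1))) (x.2 (D.circleAt x.1 (j, 3)))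
        (y.2 (D.circleAt y.1 (j, 1))) := by
  rw [edgeCoeff, if_pos hxy, if_pos ⟨hne, h.circleAt_eq hne⟩]

theorem DiffersAt.edgeCoeff_eq_split {x y : D.State} (h : D.DiffersAt j x.1 y.1)
    (he : D.circleAt x.1 (j, 1) = D.circleAt x.1 (j, 3)) (hxy : D.AgreeAway j x y) :
    D.edgeCoeff j x y = splitCoeff (x.2 (D.circleAt x.1 (j, 1))) (y.2 (D.circleAt y.1 (j, 1)))
        (y.2 (D.circleAt y.1 (j, 3))) := by
  rw [edgeCoeff, if_pos hxy, if_neg fun h' => h'.1 he,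
    if_pos ⟨he, h.symm.circleAt_eq_iff.1 he⟩]

theorem edgeCoeff_of_not_agreeAway {x y : D.State} (hxy : ¬ D.AgreeAway j x y) :
    D.edgeCoeff j x y = 0 := if_neg hxy

/-- A degree that is given by a function of closed curves that satisfies the triangle inequalities
for pairs of pants does not increase along the edges of the cube of resolutions. -/
theorem DiffersAt.signedSum_le [PartialOrder P] [IsOrderedAddMonoid P] {x y : D.State}
    (h : D.DiffersAt j x.1 y.1)
    (hf : ∀ γ δ : C(UnitAddCircle, X.carrier), Function.Injective γ → Function.Injective δ →
      UnorientedHomotopic γ δ → f γ = f δ)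
    (hpants : ∀ α β γ : C(UnitAddCircle, X.carrier), Function.Injective α →
      Function.Injective β → Function.Injective γ →
      IsPants α β γ → f γ ≤ f α + f β ∧ f α ≤ f β + f γ ∧ f β ≤ f α + f γ)
    (hc : D.edgeCoeff j x y ≠ 0) : signedSum f y ≤ signedSum f x := by
  have hxy : D.AgreeAway j x y := by
    by_contra h'
    exact hc (edgeCoeff_of_not_agreeAway h')
  by_cases he : D.circleAt x.1 (j, 1) = D.circleAt x.1 (j, 3)
  · have hne := h.symm.circleAt_eq_iff.1 he
    rw [h.edgeCoeff_eq_split he hxy] at hc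
    have e := h.symm.signedSum_add hf hne (h.agreeAway_symm hxy)
    obtain ⟨h1, h2, h3⟩ := hpants _ _ _ (D.circleCurve_injective _ _) (D.circleCurve_injective _ _)
      (D.circleCurve_injective _ _) (h.symm.isPants hne)
    generalize f (D.circleCurve x.1 (D.circleAt x.1 (j, 1))) = γ at *
    generalize f (D.circleCurve y.1 (D.circleAt y.1 (j, 1))) = α at *
    generalize f (D.circleCurve y.1 (D.circleAt y.1 (j, 3))) = β at *
    rw [← sub_nonneg] at h1 h2 h3 ⊢
    rcases splitCoeff_ne_zero hc with ⟨e1, e2, e3⟩ | ⟨e1, e2, e3⟩ | ⟨e1, e2, e3⟩ <;>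
      rw [e1, e2, e3] at e <;>
      simp only [Units.val_one, Units.val_neg, one_smul, neg_smul] at e
    · convert h2 using 1
      rw [eq_comm, ← sub_eq_zero, ← sub_eq_zero.2 e]; abel
    · convert h3 using 1
      rw [eq_comm, ← sub_eq_zero, ← sub_eq_zero.2 e]; abel
    · convert h1 using 1
      rw [eq_comm, ← sub_eq_zero, ← sub_eq_zero.2 e]; abel
  · rw [h.edgeCoeff_eq_merge he hxy] at hc
    have e := h.signedSum_add hf he hxy
    obtain ⟨h1, h2, h3⟩ := hpants _ _ _ (D.circleCurve_injective _ _) (D.circleCurve_injective _ _)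
      (D.circleCurve_injective _ _) (h.isPants he)
    generalize f (D.circleCurve y.1 (D.circleAt y.1 (j, 1))) = γ at *
    generalize f (D.circleCurve x.1 (D.circleAt x.1 (j, 1))) = α at *
    generalize f (D.circleCurve x.1 (D.circleAt x.1 (j, 3))) = β at *
    rw [← sub_nonneg] at h1 h2 h3 ⊢
    rcases mergeCoeff_ne_zero hc with ⟨e1, e2, e3⟩ | ⟨e1, e2, e3⟩ | ⟨e1, e2, e3⟩ <;>
      rw [e1, e2, e3] at e <;>
      simp only [Units.val_one, Units.val_neg, one_smul, neg_smul] at e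
    · convert h1 using 1
      rw [← sub_eq_zero, ← sub_eq_zero.2 e]; abel
    · convert h3 using 1
      rw [← sub_eq_zero, ← sub_eq_zero.2 e]; abel
    · convert h2 using 1
      rw [← sub_eq_zero, ← sub_eq_zero.2 e]; abel

end SignedSum

/-- The sum of the signs drops by one along the edges of the cube of resolutions. -/
theorem DiffersAt.sum_signs {x y : D.State} (h : D.DiffersAt j x.1 y.1)
    (hc : D.edgeCoeff j x y ≠ 0) : ∑ c, (x.2 c : ℤ) = ∑ c, (y.2 c : ℤ) + 1 := by
  have hxy : D.AgreeAway j x y := by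
    by_contra h'
    exact hc (edgeCoeff_of_not_agreeAway h')
  have hs : ∀ z : D.State, signedSum (fun _ => (1 : ℤ)) z = ∑ c, (z.2 c : ℤ) := fun z => by
    simp [signedSum]
  by_cases he : D.circleAt x.1 (j, 1) = D.circleAt x.1 (j, 3)
  · have hne := h.symm.circleAt_eq_iff.1 he
    rw [h.edgeCoeff_eq_split he hxy] at hc
    have e := h.symm.signedSum_add (f := fun _ => (1 : ℤ)) (fun _ _ _ _ _ => rfl) hne
      (h.agreeAway_symm hxy)
    rw [hs, hs] at e
    rcases splitCoeff_ne_zero hc with ⟨e1, e2, e3⟩ | ⟨e1, e2, e3⟩ | ⟨e1, e2, e3⟩ <;>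
      rw [e1, e2, e3] at e <;> norm_num at e <;> omega
  · rw [h.edgeCoeff_eq_merge he hxy] at hc
    have e := h.signedSum_add (f := fun _ => (1 : ℤ)) (fun _ _ _ _ _ => rfl) he hxy
    rw [hs, hs] at e
    rcases mergeCoeff_ne_zero hc with ⟨e1, e2, e3⟩ | ⟨e1, e2, e3⟩ | ⟨e1, e2, e3⟩ <;>
      rw [e1, e2, e3] at e <;> norm_num at e <;> omega

theorem exists_edge_of_diffCoeff_ne_zero {x y : D.State} (h : D.diffCoeff x y ≠ 0) :
    ∃ j, x.1 j = false ∧ y.1 = Function.update x.1 j true ∧ D.edgeCoeff j x y ≠ 0 := by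
  obtain ⟨j, -, hj⟩ := Finset.exists_ne_zero_of_sum_ne_zero h
  split_ifs at hj with hxy
  · exact ⟨j, hxy.1, hxy.2, right_ne_zero_of_mul hj⟩
  · exact absurd rfl hj

variable (D) in
theorem diff_apply (v : D.CKh) (y : D.State) :
    D.diff v y = ∑ x, v x * D.diffCoeff x y := by
  simp [diff, Finsupp.linearCombination_apply, Finsupp.sum_fintype, Finsupp.finsetSum_apply,
    Finsupp.single_apply]

theorem exists_of_diff_apply_ne_zero {v : D.CKh} {y : D.State} (h : D.diff v y ≠ 0) :
    ∃ x, v x ≠ 0 ∧ D.diffCoeff x y ≠ 0 := by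
  rw [diff_apply] at h
  obtain ⟨x, -, hx⟩ := Finset.exists_ne_zero_of_sum_ne_zero h
  exact ⟨x, left_ne_zero_of_mul hx, right_ne_zero_of_mul hx⟩

theorem isFiltered_diff {P : Type*} [PartialOrder P] {g : D.State → P}
    (h : ∀ x y, D.diffCoeff x y ≠ 0 → g y ≤ g x) : IsFiltered g D.diff := by
  intro a v hv
  rw [filt, Finsupp.mem_supported] at hv ⊢
  intro y hy
  obtain ⟨x, hx, hxy⟩ := exists_of_diff_apply_ne_zero (Finsupp.mem_support_iff.1 hy)
  exact (h x y hxy).trans (hv (Finsupp.mem_support_iff.2 hx))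

theorem signedSum_le_of_diffCoeff_ne_zero {P : Type*} [AddCommGroup P] [PartialOrder P]
    [IsOrderedAddMonoid P] {f : C(UnitAddCircle, X.carrier) → P}
    (hf : ∀ γ δ : C(UnitAddCircle, X.carrier), Function.Injective γ → Function.Injective δ →
      UnorientedHomotopic γ δ → f γ = f δ)
    (hpants : ∀ α β γ : C(UnitAddCircle, X.carrier), Function.Injective α →
      Function.Injective β → Function.Injective γ →
      IsPants α β γ → f γ ≤ f α + f β ∧ f α ≤ f β + f γ ∧ f β ≤ f α + f γ)
    (x y : D.State) (h : D.diffCoeff x y ≠ 0) : signedSum f y ≤ signedSum f x := by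
  obtain ⟨j, h1, h2, h3⟩ := exists_edge_of_diffCoeff_ne_zero h
  have hd : D.DiffersAt j x.1 y.1 := h2 ▸ differsAt_update x.1 h1
  exact hd.signedSum_le hf hpants h3

variable (D) in
/-- The differential respects the multipunctured filtration. -/
theorem isFiltered_homologyDegree : IsFiltered D.homologyDegree D.diff :=
  isFiltered_diff (signedSum_le_of_diffCoeff_ne_zero (f := positiveClass X)
    (fun _ _ _ _ h => positiveClass_congr h) fun _ _ _ _ _ _ h => h.positiveClass_le)

variable (D) in
/-- The differential respects the filtration by classes of curves. -/
theorem isFiltered_curveDegree : IsFiltered D.curveDegree D.diff :=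
  isFiltered_diff (signedSum_le_of_diffCoeff_ne_zero (f := curveElement)
    (fun _ _ hγ hδ h => curveElement_congr hγ hδ h)
    fun _ _ _ hα hβ hγ h => h.curveElement_le hα hβ hγ)

theorem weight_update {x : D.Resolution} (h : x j = false) :
    D.weight (Function.update x j true) = D.weight x + 1 := by
  rw [weight, weight, ← Finset.card_insert_of_notMem (a := j) (by simp [h])]
  congr 1
  ext i
  by_cases hi : i = j
  · subst hi; simp
  · simp [hi]

theorem homDegree_of_diffCoeff_ne_zero {x y : D.State} (h : D.diffCoeff x y ≠ 0) :
    D.homDegree y = D.homDegree x + 1 := by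
  obtain ⟨j, h1, h2, -⟩ := exists_edge_of_diffCoeff_ne_zero h
  rw [homDegree, homDegree, h2, weight_update h1]
  push_cast
  ring

theorem quantumDegree_of_diffCoeff_ne_zero {x y : D.State} (h : D.diffCoeff x y ≠ 0) :
    D.quantumDegree y = D.quantumDegree x := by
  obtain ⟨j, h1, h2, h3⟩ := exists_edge_of_diffCoeff_ne_zero h
  have hd : D.DiffersAt j x.1 y.1 := h2 ▸ differsAt_update x.1 h1
  have hw : D.weight y.1 = D.weight x.1 + 1 := by rw [h2, weight_update h1]
  rw [quantumDegree, quantumDegree, hd.sum_signs h3, hw]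
  push_cast
  ring

/-- The differential has homological degree one and quantum degree zero. -/
theorem diff_mem_bidegree {i k : ℤ} {v : D.CKh} (hv : v ∈ D.bidegree i k) :
    D.diff v ∈ D.bidegree (i + 1) k := by
  rw [bidegree, Finsupp.mem_supported] at hv ⊢
  intro y hy
  obtain ⟨x, hx, hxy⟩ := exists_of_diff_apply_ne_zero (Finsupp.mem_support_iff.1 hy)
  obtain ⟨h1, h2⟩ := hv (Finsupp.mem_support_iff.2 hx)
  exact ⟨by rw [homDegree_of_diffCoeff_ne_zero hxy, h1],
    by rw [quantumDegree_of_diffCoeff_ne_zero hxy, h2]⟩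

theorem hurewicz_curveDegree (x : D.State) :
    hurewicz X (D.curveDegree x) = D.homologyDegree x := by
  rw [curveDegree, homologyDegree, map_sum]
  refine Finset.sum_congr rfl fun c _ => ?_
  rw [map_zsmul, hurewicz_curveElement (D.circleCurve_injective _ _)]

end Diagram

namespace Diagram

variable {n : ℕ} {X : PuncturedDisk n} (D : Diagram X)

/-! ### Multiplication by marked points on the Khovanov complex -/

/-- Points that meet every circle of every resolution: the ends at the crossings, and one point on
each component without crossings. -/
abbrev Point : Type := D.End ⊕ Fin D.numFree

/-- The circle through a point. -/
def circleOf (ρ : D.Resolution) : D.Point → D.Circles ρ := Sum.map (Quot.mk _) id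

theorem circleOf_surjective (ρ : D.Resolution) : Function.Surjective (D.circleOf ρ) :=
  Sum.map_surjective.2 ⟨Quot.mk_surjective, Function.surjective_id⟩

variable {D}

open Classical in
/-- The enhanced state with the sign of the circle through `p` replaced by `e`. -/
abbrev setSign (x : D.State) (p : D.Point) (e : ℤˣ) : D.State :=
  ⟨x.1, Function.update x.2 (D.circleOf x.1 p) e⟩

theorem setSign_self (x : D.State) (p : D.Point) (e : ℤˣ) :
    (setSign x p e).2 (D.circleOf x.1 p) = e := by
  classical
  exact Function.update_self ..

theorem setSign_of_ne (x : D.State) (p : D.Point) (e : ℤˣ) {c : D.Circles x.1}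
    (h : c ≠ D.circleOf x.1 p) : (setSign x p e).2 c = x.2 c := by
  classical
  exact Function.update_of_ne h ..

theorem setSign_setSign (x : D.State) (p : D.Point) (e e' : ℤˣ) :
    setSign (setSign x p e) p e' = setSign x p e' := by
  classical
  simp [setSign]

theorem setSign_eq_self {x : D.State} {p : D.Point} {e : ℤˣ} (h : x.2 (D.circleOf x.1 p) = e) :
    setSign x p e = x := by
  subst h
  classical
  simp [setSign]

theorem setSign_comm (x : D.State) {p q : D.Point} (e e' : ℤˣ)
    (h : D.circleOf x.1 p ≠ D.circleOf x.1 q) :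
    setSign (setSign x p e) q e' = setSign (setSign x q e') p e := by
  classical
  simp only [setSign]
  rw [Function.update_comm h.symm]

theorem setSign_congr (x : D.State) {p q : D.Point} (e : ℤˣ)
    (h : D.circleOf x.1 p = D.circleOf x.1 q) : setSign x p e = setSign x q e := by
  simp only [setSign, h]

/-- Multiplication by `X` in the factor `ℚ[X] / X ^ 2` of the circle through `p`: it sends `v₊` to
`v₋` and `v₋` to zero. -/
def mulPoint (p : D.Point) : D.CKh →ₗ[ℚ] D.CKh :=
  Finsupp.linearCombination ℚ fun x =>
    if x.2 (D.circleOf x.1 p) = 1 then Finsupp.single (setSign x p (-1)) 1 else 0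

theorem mulPoint_single (p : D.Point) (x : D.State) :
    mulPoint p (Finsupp.single x 1) =
      if x.2 (D.circleOf x.1 p) = 1 then Finsupp.single (setSign x p (-1)) 1 else 0 := by
  rw [mulPoint, Finsupp.linearCombination_single, one_smul]

theorem eq_setSign_iff {x z : D.State} {p : D.Point} :
    (x.2 (D.circleOf x.1 p) = 1 ∧ setSign x p (-1) = z) ↔
      (z.2 (D.circleOf z.1 p) = -1 ∧ x = setSign z p 1) := by
  constructor
  · rintro ⟨h, rfl⟩
    exact ⟨setSign_self x p _, by rw [setSign_setSign, setSign_eq_self h]⟩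
  · rintro ⟨h, rfl⟩
    exact ⟨setSign_self z p _, by rw [setSign_setSign, setSign_eq_self h]⟩

theorem mulPoint_apply (p : D.Point) (v : D.CKh) (z : D.State) :
    mulPoint p v z = if z.2 (D.circleOf z.1 p) = -1 then v (setSign z p 1) else 0 := by
  classical
  induction v using Finsupp.induction_linear with
  | zero => simp
  | add v w hv hw =>
    rw [map_add, Finsupp.add_apply, hv, hw]
    split_ifs <;> simp
  | single x r =>
    rw [← mul_one r, ← smul_eq_mul, ← Finsupp.smul_single, map_smul, mulPoint_single,
      Finsupp.smul_apply, Finsupp.smul_apply]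
    have h := eq_setSign_iff (x := x) (z := z) (p := p)
    by_cases h1 : x.2 (D.circleOf x.1 p) = 1 ∧ setSign x p (-1) = z
    · have h2 := h.1 h1
      rw [if_pos h1.1, h1.2, if_pos h2.1, h2.2, Finsupp.single_eq_same, Finsupp.single_eq_same]
    · have h2 : ¬ _ := fun h2 => h1 (h.2 h2)
      have e1 : (if x.2 (D.circleOf x.1 p) = 1 then Finsupp.single (setSign x p (-1)) (1 : ℚ)
          else 0) z = 0 := by
        split_ifs with h3
        · exact Finsupp.single_eq_of_ne fun h4 => h1 ⟨h3, h4.symm⟩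
        · rfl
      rw [e1, smul_zero]
      split_ifs with h3
      · rw [Finsupp.single_eq_of_ne fun h4 => h2 ⟨h3, h4.symm⟩, smul_zero]
      · rfl

theorem mulPoint_comm (p q : D.Point) (v : D.CKh) :
    mulPoint p (mulPoint q v) = mulPoint q (mulPoint p v) := by
  ext z
  simp only [mulPoint_apply]
  by_cases h : D.circleOf z.1 p = D.circleOf z.1 q
  · have h1 := setSign_self z p 1
    have h2 := setSign_self z q 1
    rw [h] at h1
    rw [← h] at h2
    change _ = _ at h1
    have h3 : ¬ (setSign z p 1).2 (D.circleOf z.1 q) = -1 := by rw [h1]; decide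
    have h4 : ¬ (setSign z q 1).2 (D.circleOf z.1 p) = -1 := by rw [h2]; decide
    change (if _ then (if (setSign z p 1).2 (D.circleOf z.1 q) = -1 then _ else _) else _) =
      (if _ then (if (setSign z q 1).2 (D.circleOf z.1 p) = -1 then _ else _) else _)
    rw [if_neg h3, if_neg h4]
    split_ifs <;> rfl
  · have h1 := setSign_of_ne z p 1 (Ne.symm h)
    have h2 := setSign_of_ne z q 1 h
    change (if _ then (if (setSign z p 1).2 (D.circleOf z.1 q) = -1 then _ else _) else _) =
      (if _ then (if (setSign z q 1).2 (D.circleOf z.1 p) = -1 then _ else _) else _)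
    rw [h1, h2, setSign_comm z 1 1 h]
    split_ifs <;> rfl

theorem mulPoint_single_congr {p q : D.Point} {x : D.State}
    (h : D.circleOf x.1 p = D.circleOf x.1 q) :
    mulPoint p (Finsupp.single x 1) = mulPoint q (Finsupp.single x 1) := by
  rw [mulPoint_single, mulPoint_single, h, setSign_congr x _ h]

/-- The enhanced state of a resolution with all signs positive. -/
def plusState (ρ : D.Resolution) : D.State := ⟨ρ, fun _ => 1⟩

/-- The module of a resolution is generated by the state with all signs positive. -/
theorem eq_of_commute_mulPoint {S T : D.CKh →ₗ[ℚ] D.CKh}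
    (hS : ∀ p v, S (mulPoint p v) = mulPoint p (S v))
    (hT : ∀ p v, T (mulPoint p v) = mulPoint p (T v)) {ρ : D.Resolution}
    (h : S (Finsupp.single (plusState ρ) 1) = T (Finsupp.single (plusState ρ) 1)) (x : D.State)
    (hx : x.1 = ρ) : S (Finsupp.single x 1) = T (Finsupp.single x 1) := by
  classical
  obtain ⟨m, hm⟩ : ∃ m, m = (Finset.univ.filter fun c => x.2 c = -1).card := ⟨_, rfl⟩
  induction m generalizing x with
  | zero =>
    have hx' : x = plusState ρ := by
      subst hx
      refine Sigma.ext rfl (heq_of_eq (funext fun c => ?_))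
      rw [eq_comm, Finset.card_eq_zero, Finset.filter_eq_empty_iff] at hm
      exact (Int.units_eq_one_or _).resolve_right (hm (Finset.mem_univ c))
    rw [hx', h]
  | succ m ih =>
    obtain ⟨c, hc⟩ : (Finset.univ.filter fun c => x.2 c = -1).Nonempty := by
      rw [← Finset.card_pos]; omega
    obtain ⟨p, rfl⟩ := D.circleOf_surjective x.1 c
    have hxp : x.2 (D.circleOf x.1 p) = -1 := (Finset.mem_filter.1 hc).2
    obtain ⟨h1, h2⟩ := eq_setSign_iff.2 ⟨hxp, rfl⟩
    have e : Finsupp.single x 1 = mulPoint p (Finsupp.single (setSign x p 1) 1) := by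
      rw [mulPoint_single, if_pos h1, h2]
    have hcard : (Finset.univ.filter fun c => (setSign x p 1).2 c = -1) =
        (Finset.univ.filter fun c => x.2 c = -1).erase (D.circleOf x.1 p) := by
      ext c
      simp only [Finset.mem_filter, Finset.mem_erase, Finset.mem_univ, true_and]
      by_cases hcp : c = D.circleOf x.1 p
      · subst hcp
        rw [Function.update_self]
        simp
      · rw [Function.update_of_ne hcp]
        tauto
    rw [e, hS, hT, ih (setSign x p 1) hx]
    rw [hcard, Finset.card_erase_of_mem hc, ← hm, Nat.add_sub_cancel]

/-! ### The edge maps of the cube of resolutions -/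

variable {j k : Fin D.num}

/-- The matrix entries of the edge maps in direction `j`. -/
def edgeEntry (j : Fin D.num) (x y : D.State) : ℚ :=
  if x.1 j = false ∧ y.1 = Function.update x.1 j true then D.edgeCoeff j x y else 0

/-- The sum of the edge maps in direction `j`. -/
def edgeMap (j : Fin D.num) : D.CKh →ₗ[ℚ] D.CKh :=
  Finsupp.linearCombination ℚ fun x => ∑ y, Finsupp.single y (edgeEntry j x y)

theorem edgeMap_apply (v : D.CKh) (y : D.State) :
    edgeMap j v y = ∑ x, v x * edgeEntry j x y := by
  simp [edgeMap, Finsupp.linearCombination_apply, Finsupp.sum_fintype, Finsupp.finsetSum_apply,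
    Finsupp.single_apply]

theorem edgeMap_single_apply (x y : D.State) :
    edgeMap j (Finsupp.single x 1) y = edgeEntry j x y := by
  classical
  simp [edgeMap_apply, Finsupp.single_apply]

theorem DiffersAt.circleOf_eq_iff {ρ ρ' : D.Resolution} (h : D.DiffersAt j ρ ρ') {p q : D.Point}
    (hp : D.circleOf ρ p ≠ D.circleAt ρ (j, 1) ∧ D.circleOf ρ p ≠ D.circleAt ρ (j, 3)) :
    (D.circleOf ρ q = D.circleOf ρ p ↔ D.circleOf ρ' q = D.circleOf ρ' p) ∧
    D.circleOf ρ' p ≠ D.circleAt ρ' (j, 1) ∧ D.circleOf ρ' p ≠ D.circleAt ρ' (j, 3) := by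
  rcases p with a | i
  · have ha : D.IsAway j ρ a := isAway_iff.2 hp
    refine ⟨?_, isAway_iff.1 (h.isAway_iff_isAway.1 ha)⟩
    rcases q with b | i
    · change D.circleAt ρ b = D.circleAt ρ a ↔ D.circleAt ρ' b = D.circleAt ρ' a
      by_cases hne : D.circleAt ρ (j, 1) = D.circleAt ρ (j, 3)
      · have h1 := h.symm.circleAt_eq_circleAt_iff (h.symm.circleAt_eq_iff.1 hne) b a
        have h2 := isAway_iff.1 (h.isAway_iff_isAway.1 ha)
        tauto
      · have h1 := h.circleAt_eq_circleAt_iff hne b a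
        have h2 := isAway_iff.1 ha
        tauto
    · exact ⟨fun e => absurd e Sum.inr_ne_inl, fun e => absurd e Sum.inr_ne_inl⟩
  · refine ⟨?_, Sum.inr_ne_inl, Sum.inr_ne_inl⟩
    rcases q with b | i
    · exact ⟨fun e => absurd e Sum.inl_ne_inr, fun e => absurd e Sum.inl_ne_inr⟩
    · change Sum.inr i = Sum.inr _ ↔ Sum.inr i = Sum.inr _
      rw [Sum.inr.injEq, Sum.inr.injEq]

theorem agreeAway_iff {x y : D.State} : D.AgreeAway j x y ↔
    ∀ p : D.Point, D.circleOf x.1 p ≠ D.circleAt x.1 (j, 1) →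
      D.circleOf x.1 p ≠ D.circleAt x.1 (j, 3) →
      x.2 (D.circleOf x.1 p) = y.2 (D.circleOf y.1 p) := by
  constructor
  · rintro ⟨h1, h2⟩ (a | i) e1 e3
    · exact h1 a (isAway_iff.2 ⟨e1, e3⟩)
    · exact h2 i
  · intro h
    exact ⟨fun a ha => h (Sum.inl a) (isAway_iff.1 ha).1 (isAway_iff.1 ha).2,
      fun i => h (Sum.inr i) Sum.inr_ne_inl Sum.inr_ne_inl⟩

theorem mergeCoeff_left (a b c : ℤˣ) : (if a = 1 then mergeCoeff (-1) b c else 0) =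
    if c = -1 then mergeCoeff a b 1 else 0 := by
  rcases Int.units_eq_one_or a with rfl | rfl <;> rcases Int.units_eq_one_or b with rfl | rfl <;>
    rcases Int.units_eq_one_or c with rfl | rfl <;> simp [mergeCoeff]

theorem mergeCoeff_right (a b c : ℤˣ) : (if b = 1 then mergeCoeff a (-1) c else 0) =
    if c = -1 then mergeCoeff a b 1 else 0 := by
  rcases Int.units_eq_one_or a with rfl | rfl <;> rcases Int.units_eq_one_or b with rfl | rfl <;>
    rcases Int.units_eq_one_or c with rfl | rfl <;> simp [mergeCoeff]

theorem splitCoeff_left (a b c : ℤˣ) : (if a = 1 then splitCoeff (-1) b c else 0) =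
    if b = -1 then splitCoeff a 1 c else 0 := by
  rcases Int.units_eq_one_or a with rfl | rfl <;> rcases Int.units_eq_one_or b with rfl | rfl <;>
    rcases Int.units_eq_one_or c with rfl | rfl <;> simp [splitCoeff]

theorem splitCoeff_right (a b c : ℤˣ) : (if a = 1 then splitCoeff (-1) b c else 0) =
    if c = -1 then splitCoeff a b 1 else 0 := by
  rcases Int.units_eq_one_or a with rfl | rfl <;> rcases Int.units_eq_one_or b with rfl | rfl <;>
    rcases Int.units_eq_one_or c with rfl | rfl <;> simp [splitCoeff]

/-- The entrywise form of `edgeMap_mulPoint` for a point on a circle that stays unchanged. -/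
theorem DiffersAt.edgeCoeff_setSign_away {x z : D.State} (h : D.DiffersAt j x.1 z.1) (p : D.Point)
    (hp : D.circleOf x.1 p ≠ D.circleAt x.1 (j, 1) ∧ D.circleOf x.1 p ≠ D.circleAt x.1 (j, 3)) :
    (if x.2 (D.circleOf x.1 p) = 1 then D.edgeCoeff j (setSign x p (-1)) z else 0) =
      if z.2 (D.circleOf z.1 p) = -1 then D.edgeCoeff j x (setSign z p 1) else 0 := by
  obtain ⟨-, hp'⟩ := h.circleOf_eq_iff (q := p) hp
  have hq : ∀ q, D.circleOf x.1 q = D.circleOf x.1 p ↔ D.circleOf z.1 q = D.circleOf z.1 p :=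
    fun q => (h.circleOf_eq_iff (q := q) hp).1
  have hiff : (x.2 (D.circleOf x.1 p) = 1 ∧ D.AgreeAway j (setSign x p (-1)) z) ↔
      (z.2 (D.circleOf z.1 p) = -1 ∧ D.AgreeAway j x (setSign z p 1)) := by
    rw [agreeAway_iff, agreeAway_iff]
    constructor
    · rintro ⟨h1, hA⟩
      refine ⟨(hA p hp.1 hp.2).symm.trans (setSign_self x p _), fun q h3 h4 => ?_⟩
      by_cases hqp : D.circleOf x.1 q = D.circleOf x.1 p
      · rw [hqp, (hq q).1 hqp, h1]
        exact (setSign_self z p 1).symm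
      · refine (setSign_of_ne x p (-1) hqp).symm.trans ((hA q h3 h4).trans ?_)
        exact (setSign_of_ne z p 1 fun e => hqp ((hq q).2 e)).symm
    · rintro ⟨h1, hA⟩
      refine ⟨(hA p hp.1 hp.2).trans (setSign_self z p _), fun q h3 h4 => ?_⟩
      by_cases hqp : D.circleOf x.1 q = D.circleOf x.1 p
      · rw [(hq q).1 hqp, h1]
        change (setSign x p (-1)).2 (D.circleOf x.1 q) = _
        rw [hqp]
        exact setSign_self x p (-1)
      · refine (setSign_of_ne x p (-1) hqp).trans ((hA q h3 h4).trans ?_)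
        exact setSign_of_ne z p 1 fun e => hqp ((hq q).2 e)
  by_cases hA : x.2 (D.circleOf x.1 p) = 1 ∧ D.AgreeAway j (setSign x p (-1)) z
  · have hA' := hiff.1 hA
    rw [if_pos hA.1, if_pos hA'.1]
    have e1 := setSign_of_ne x p (-1) hp.1.symm
    have e2 := setSign_of_ne x p (-1) hp.2.symm
    have e3 := setSign_of_ne z p 1 hp'.1.symm
    have e4 := setSign_of_ne z p 1 hp'.2.symm
    by_cases he : D.circleAt x.1 (j, 1) = D.circleAt x.1 (j, 3)
    · rw [DiffersAt.edgeCoeff_eq_split (x := setSign x p (-1)) h he hA.2,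
        DiffersAt.edgeCoeff_eq_split (y := setSign z p 1) h he hA'.2]
      exact congr (congr (congrArg splitCoeff e1) e3.symm) e4.symm
    · rw [DiffersAt.edgeCoeff_eq_merge (x := setSign x p (-1)) h he hA.2,
        DiffersAt.edgeCoeff_eq_merge (y := setSign z p 1) h he hA'.2]
      exact congr (congr (congrArg mergeCoeff e1) e2) e3.symm
  · have hA' := fun hA' => hA (hiff.2 hA')
    trans 0
    · split_ifs with h1
      · exact edgeCoeff_of_not_agreeAway fun h2 => hA ⟨h1, h2⟩
      · rfl
    · split_ifs with h1
      · exact (edgeCoeff_of_not_agreeAway fun h2 => hA' ⟨h1, h2⟩).symm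
      · rfl

/-- The entrywise form of `edgeMap_mulPoint` for a point on a circle that passes through the
crossing: the merge and the split are linear over each of their factors. -/
theorem DiffersAt.edgeCoeff_setSign_on {x z : D.State} (h : D.DiffersAt j x.1 z.1) (p : D.Point)
    (hp : ¬ (D.circleOf x.1 p ≠ D.circleAt x.1 (j, 1) ∧
      D.circleOf x.1 p ≠ D.circleAt x.1 (j, 3))) :
    (if x.2 (D.circleOf x.1 p) = 1 then D.edgeCoeff j (setSign x p (-1)) z else 0) =
      if z.2 (D.circleOf z.1 p) = -1 then D.edgeCoeff j x (setSign z p 1) else 0 := by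
  have hp' : ¬ (D.circleOf z.1 p ≠ D.circleAt z.1 (j, 1) ∧
      D.circleOf z.1 p ≠ D.circleAt z.1 (j, 3)) := fun hp' =>
    hp (h.symm.circleOf_eq_iff (q := p) hp').2
  have hx : D.AgreeAway j (setSign x p (-1)) z ↔ D.AgreeAway j x z := by
    rw [agreeAway_iff, agreeAway_iff]
    refine forall_congr' fun q => forall_congr' fun h1 => forall_congr' fun h3 => ?_
    rw [← setSign_of_ne x p (-1) (c := D.circleOf x.1 q) fun e => hp (e ▸ ⟨h1, h3⟩)]
  have hz : D.AgreeAway j x (setSign z p 1) ↔ D.AgreeAway j x z := by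
    rw [agreeAway_iff, agreeAway_iff]
    refine forall_congr' fun q => forall_congr' fun h1 => forall_congr' fun h3 => ?_
    have hq := (h.circleOf_eq_iff (q := q) ⟨h1, h3⟩).2
    rw [← setSign_of_ne z p 1 (c := D.circleOf z.1 q) fun e => hp' (e ▸ hq)]
  by_cases hA : D.AgreeAway j x z
  · rw [← not_or, not_not] at hp hp'
    have sx := setSign_self x p (-1)
    have sz := setSign_self z p 1
    by_cases he : D.circleAt x.1 (j, 1) = D.circleAt x.1 (j, 3)
    · rw [DiffersAt.edgeCoeff_eq_split (x := setSign x p (-1)) h he (hx.2 hA),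
        DiffersAt.edgeCoeff_eq_split (y := setSign z p 1) h he (hz.2 hA)]
      have hne := h.symm.circleAt_eq_iff.1 he
      rw [← he, or_self] at hp
      rw [hp] at sx ⊢
      change (if _ then splitCoeff ((setSign x p (-1)).2 _) _ _ else _) =
        (if _ then splitCoeff _ ((setSign z p 1).2 (D.circleAt z.1 (j, 1)))
          ((setSign z p 1).2 (D.circleAt z.1 (j, 3))) else _)
      rw [sx]
      rcases hp' with e | e
      · have e3 := setSign_of_ne z p 1 (e ▸ hne.symm)
        rw [e] at sz ⊢
        rw [sz, e3]
        exact splitCoeff_left _ _ _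
      · have e1 := setSign_of_ne z p 1 (e ▸ hne)
        rw [e] at sz ⊢
        rw [sz, e1]
        exact splitCoeff_right _ _ _
    · rw [DiffersAt.edgeCoeff_eq_merge (x := setSign x p (-1)) h he (hx.2 hA),
        DiffersAt.edgeCoeff_eq_merge (y := setSign z p 1) h he (hz.2 hA)]
      have heq := h.circleAt_eq he
      rw [← heq, or_self] at hp'
      rw [hp'] at sz ⊢
      change (if _ then mergeCoeff ((setSign x p (-1)).2 (D.circleAt x.1 (j, 1)))
        ((setSign x p (-1)).2 (D.circleAt x.1 (j, 3))) _ else _) =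
        (if _ then mergeCoeff _ _ ((setSign z p 1).2 _) else _)
      rw [sz]
      rcases hp with e | e
      · have e3 := setSign_of_ne x p (-1) (e ▸ Ne.symm he)
        rw [e] at sx ⊢
        rw [sx, e3]
        exact mergeCoeff_left _ _ _
      · have e1 := setSign_of_ne x p (-1) (e ▸ he)
        rw [e] at sx ⊢
        rw [sx, e1]
        exact mergeCoeff_right _ _ _
  · rw [edgeCoeff_of_not_agreeAway (mt hx.1 hA), edgeCoeff_of_not_agreeAway (mt hz.1 hA)]
    simp

theorem CKh.hom_ext {S T : D.CKh →ₗ[ℚ] D.CKh}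
    (h : ∀ x : D.State, S (Finsupp.single x 1) = T (Finsupp.single x 1)) : S = T :=
  Finsupp.lhom_ext' fun x => LinearMap.ext_ring (h x)

/-- The edge maps are linear over the multiplications by points. -/
theorem edgeMap_mulPoint (p : D.Point) (v : D.CKh) :
    edgeMap j (mulPoint p v) = mulPoint p (edgeMap j v) := by
  suffices h : edgeMap j ∘ₗ mulPoint p = mulPoint p ∘ₗ edgeMap j from LinearMap.congr_fun h v
  refine CKh.hom_ext fun x => ?_
  ext z
  rw [LinearMap.comp_apply, LinearMap.comp_apply, mulPoint_apply, edgeMap_single_apply,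
    mulPoint_single, apply_ite (edgeMap j), map_zero]
  have e : (if x.2 (D.circleOf x.1 p) = 1 then edgeMap j (Finsupp.single (setSign x p (-1)) 1)
      else 0) z = if x.2 (D.circleOf x.1 p) = 1 then edgeEntry j (setSign x p (-1)) z else 0 := by
    split_ifs
    · exact edgeMap_single_apply _ _
    · rfl
  rw [e]
  by_cases hxz : x.1 j = false ∧ z.1 = Function.update x.1 j true
  · have h : D.DiffersAt j x.1 z.1 := hxz.2 ▸ differsAt_update x.1 hxz.1
    have e1 : edgeEntry j (setSign x p (-1)) z = D.edgeCoeff j (setSign x p (-1)) z := if_pos hxz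
    have e2 : edgeEntry j x (setSign z p 1) = D.edgeCoeff j x (setSign z p 1) := if_pos hxz
    rw [e1, e2]
    by_cases hp : D.circleOf x.1 p ≠ D.circleAt x.1 (j, 1) ∧
        D.circleOf x.1 p ≠ D.circleAt x.1 (j, 3)
    · exact h.edgeCoeff_setSign_away p hp
    · exact h.edgeCoeff_setSign_on p hp
  · have e1 : edgeEntry j (setSign x p (-1)) z = 0 := if_neg hxz
    have e2 : edgeEntry j x (setSign z p 1) = 0 := if_neg hxz
    rw [e1, e2]
    simp

end Diagram

namespace Diagram

variable {n : ℕ} {X : PuncturedDisk n} {D : Diagram X} {j k : Fin D.num}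

/-! ### The edge maps on positive states, and the faces of the cube -/

/-- Signs on the circles away from `j` and on those through its ends `1` and `3` are all signs. -/
theorem DiffersAt.eq_plusState_iff {ρ : D.Resolution} {z : D.State} (h : D.DiffersAt j ρ z.1) :
    z = plusState z.1 ↔ D.AgreeAway j (plusState ρ) z ∧ z.2 (D.circleAt z.1 (j, 1)) = 1 ∧
      z.2 (D.circleAt z.1 (j, 3)) = 1 := by
  constructor
  · intro e
    rw [e]
    exact ⟨⟨fun _ _ => rfl, fun _ => rfl⟩, rfl, rfl⟩
  · rintro ⟨hA, h1, h3⟩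
    refine Sigma.ext rfl (heq_of_eq (funext fun c => ?_))
    obtain ⟨a, rfl⟩ | ⟨i, rfl⟩ := circle_cases c
    · by_cases ha : D.IsAway j z.1 a
      · exact (hA.1 a (h.isAway_iff_isAway.2 ha)).symm
      · rw [isAway_iff] at ha
        by_cases e1 : D.circleAt z.1 a = D.circleAt z.1 (j, 1)
        · rw [e1, h1]
          rfl
        · have e3 : D.circleAt z.1 a = D.circleAt z.1 (j, 3) := by tauto
          rw [e3, h3]
          rfl
    · exact (hA.2 i).symm

theorem agreeAway_setSign {x z : D.State} (h : D.DiffersAt j x.1 z.1) (l : ZMod 4) (e : ℤˣ) :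
    D.AgreeAway j x (setSign z (Sum.inl (j, l)) e) ↔ D.AgreeAway j x z := by
  rw [agreeAway_iff, agreeAway_iff]
  refine forall_congr' fun q => forall_congr' fun h1 => forall_congr' fun h3 => ?_
  have hq := (h.circleOf_eq_iff (q := q) ⟨h1, h3⟩).2
  rw [← setSign_of_ne z (Sum.inl (j, l)) e (c := D.circleOf z.1 q) fun e' => ?_]
  rw [e'] at hq
  rcases D.circleAt_eq_or j z.1 l with h' | h'
  · exact hq.1 h'
  · exact hq.2 h'

theorem mergeCoeff_one_one (t : ℤˣ) : mergeCoeff 1 1 t = if t = 1 then 1 else 0 := by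
  rcases Int.units_eq_one_or t with rfl | rfl <;> simp [mergeCoeff]

theorem edgeMap_plusState_merge {ρ : D.Resolution} (hρ : ρ j = false)
    (hne : D.circleAt ρ (j, 1) ≠ D.circleAt ρ (j, 3)) :
    edgeMap j (Finsupp.single (plusState ρ) 1) =
      Finsupp.single (plusState (Function.update ρ j true)) 1 := by
  classical
  ext z
  rw [edgeMap_single_apply, Finsupp.single_apply, edgeEntry]
  by_cases hz : z.1 = Function.update ρ j true
  · have h : D.DiffersAt j (plusState ρ).1 z.1 := hz ▸ differsAt_update ρ hρ
    rw [if_pos ⟨hρ, hz⟩, ← hz]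
    have hiff := DiffersAt.eq_plusState_iff (ρ := ρ) h
    have heq := h.circleAt_eq hne
    rw [← heq, and_self] at hiff
    by_cases hA : D.AgreeAway j (plusState ρ) z
    · rw [h.edgeCoeff_eq_merge hne hA]
      refine (mergeCoeff_one_one _).trans ?_
      refine if_congr ?_ rfl rfl
      rw [eq_comm (a := plusState z.1)]
      tauto
    · rw [edgeCoeff_of_not_agreeAway hA, if_neg]
      rw [eq_comm]
      tauto
  · rw [if_neg fun h => hz h.2, if_neg]
    rintro rfl
    exact hz rfl

theorem edgeMap_plusState_split {ρ : D.Resolution} (hρ : ρ j = false)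
    (he : D.circleAt ρ (j, 1) = D.circleAt ρ (j, 3)) :
    edgeMap j (Finsupp.single (plusState ρ) 1) =
      mulPoint (Sum.inl (j, 1)) (Finsupp.single (plusState (Function.update ρ j true)) 1) +
      mulPoint (Sum.inl (j, 3)) (Finsupp.single (plusState (Function.update ρ j true)) 1) := by
  classical
  ext z
  rw [Finsupp.add_apply, edgeMap_single_apply, mulPoint_apply, mulPoint_apply,
    Finsupp.single_apply, Finsupp.single_apply, edgeEntry]
  by_cases hz : z.1 = Function.update ρ j true
  · have h : D.DiffersAt j (plusState ρ).1 z.1 := hz ▸ differsAt_update ρ hρ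
    rw [if_pos ⟨hρ, hz⟩, ← hz]
    have hne := h.symm.circleAt_eq_iff.1 he
    have e1 := DiffersAt.eq_plusState_iff (ρ := ρ) (z := setSign z (Sum.inl (j, 1)) 1) h
    have e3 := DiffersAt.eq_plusState_iff (ρ := ρ) (z := setSign z (Sum.inl (j, 3)) 1) h
    rw [agreeAway_setSign (x := plusState ρ) h] at e1 e3
    have s11 := setSign_self z (Sum.inl (j, 1)) 1
    have s33 := setSign_self z (Sum.inl (j, 3)) 1
    have s13 := setSign_of_ne z (Sum.inl (j, 1)) 1 hne.symm
    have s31 := setSign_of_ne z (Sum.inl (j, 3)) 1 hne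
    change (setSign z (Sum.inl (j, 1)) 1).2 (D.circleAt z.1 (j, 1)) = 1 at s11
    change (setSign z (Sum.inl (j, 3)) 1).2 (D.circleAt z.1 (j, 3)) = 1 at s33
    have e1' : plusState z.1 = setSign z (Sum.inl (j, 1)) 1 ↔
        D.AgreeAway j (plusState ρ) z ∧ z.2 (D.circleAt z.1 (j, 3)) = 1 := by
      rw [eq_comm, ← s13]
      exact e1.trans ⟨fun h => ⟨h.1, h.2.2⟩, fun h => ⟨h.1, s11, h.2⟩⟩
    have e3' : plusState z.1 = setSign z (Sum.inl (j, 3)) 1 ↔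
        D.AgreeAway j (plusState ρ) z ∧ z.2 (D.circleAt z.1 (j, 1)) = 1 := by
      rw [eq_comm, ← s31]
      exact e3.trans ⟨fun h => ⟨h.1, h.2.1⟩, fun h => ⟨h.1, h.2, s33⟩⟩
    by_cases hA : D.AgreeAway j (plusState ρ) z
    · rw [h.edgeCoeff_eq_split he hA]
      simp only [e1', e3', hA, true_and]
      change splitCoeff 1 _ _ = (if z.2 (D.circleAt z.1 (j, 1)) = -1 then _ else _) +
        (if z.2 (D.circleAt z.1 (j, 3)) = -1 then _ else _)
      rcases Int.units_eq_one_or (z.2 (D.circleAt z.1 (j, 1))) with h1 | h1 <;>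
        rcases Int.units_eq_one_or (z.2 (D.circleAt z.1 (j, 3))) with h3 | h3 <;>
        rw [h1, h3] <;> simp [splitCoeff]
    · rw [edgeCoeff_of_not_agreeAway hA, if_neg fun h => hA (e1'.1 h).1,
        if_neg fun h => hA (e3'.1 h).1]
      simp
  · have hz' : ∀ p, plusState (Function.update ρ j true) ≠ setSign z p 1 := fun p h =>
      hz (congrArg Sigma.fst h).symm
    rw [if_neg fun h => hz h.2, if_neg (hz' _), if_neg (hz' _)]
    simp

section Face

variable {ρ ρj ρk ρf : D.Resolution}

/-- If the change at `j` merges before and splits after the change at `k`, then the change at `k`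
merges before and splits after the change at `j`, and in the end both crossings meet the same two
circles. -/
theorem face_merge_split (h1 : D.DiffersAt j ρ ρj) (h2 : D.DiffersAt k ρ ρk)
    (h3 : D.DiffersAt k ρj ρf) (h4 : D.DiffersAt j ρk ρf)
    (hm : D.circleAt ρ (j, 1) ≠ D.circleAt ρ (j, 3))
    (hs : D.circleAt ρk (j, 1) = D.circleAt ρk (j, 3)) :
    D.circleAt ρ (k, 1) ≠ D.circleAt ρ (k, 3) ∧ D.circleAt ρj (k, 1) = D.circleAt ρj (k, 3) ∧
    ((D.circleAt ρf (j, 1) = D.circleAt ρf (k, 1) ∧ D.circleAt ρf (j, 3) = D.circleAt ρf (k, 3)) ∨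
      (D.circleAt ρf (j, 1) = D.circleAt ρf (k, 3) ∧
        D.circleAt ρf (j, 3) = D.circleAt ρf (k, 1))) := by
  have i1 := h1.circleAt_eq_circleAt_iff hm
  have hk : D.circleAt ρ (k, 1) ≠ D.circleAt ρ (k, 3) := by
    intro hk
    exact hm ((h2.symm.circleAt_eq_circleAt_iff (h2.symm.circleAt_eq_iff.1 hk) _ _).2 (Or.inl hs))
  have i2 := h2.circleAt_eq_circleAt_iff hk
  have hkj : D.circleAt ρj (k, 1) = D.circleAt ρj (k, 3) := by
    have := (i2 _ _).1 hs
    refine (i1 _ _).2 ?_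
    grind
  have hkf := h3.symm.circleAt_eq_iff.1 hkj
  have hjf := h4.symm.circleAt_eq_iff.1 hs
  have i3 := h3.symm.circleAt_eq_circleAt_iff hkf
  refine ⟨hk, hkj, ?_⟩
  have a1 := (i2 _ _).1 hs
  have b1 := i3 (j, 1) (k, 1)
  have b3 := i3 (j, 3) (k, 1)
  have c1 := i1 (j, 1) (k, 1)
  have c3 := i1 (j, 3) (k, 1)
  grind

/-- If the change at `j` splits before and merges after the change at `k`, then the change at `k`
splits before and merges after the change at `j`, and in the end both crossings meet a single
circle. -/
theorem face_split_merge (h2 : D.DiffersAt k ρ ρk)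
    (h3 : D.DiffersAt k ρj ρf) (h4 : D.DiffersAt j ρk ρf)
    (hs : D.circleAt ρ (j, 1) = D.circleAt ρ (j, 3))
    (hm : D.circleAt ρk (j, 1) ≠ D.circleAt ρk (j, 3)) :
    D.circleAt ρ (k, 1) = D.circleAt ρ (k, 3) ∧ D.circleAt ρj (k, 1) ≠ D.circleAt ρj (k, 3) ∧
    D.circleAt ρf (j, 1) = D.circleAt ρf (j, 3) ∧ D.circleAt ρf (k, 1) = D.circleAt ρf (j, 1) ∧
    D.circleAt ρf (k, 3) = D.circleAt ρf (j, 1) := by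
  have hk : D.circleAt ρ (k, 1) = D.circleAt ρ (k, 3) := by
    by_contra hk
    exact hm ((h2.circleAt_eq_circleAt_iff hk _ _).2 (Or.inl hs))
  have hkk := h2.symm.circleAt_eq_iff.1 hk
  have i2 := h2.symm.circleAt_eq_circleAt_iff hkk
  have i4 := h4.circleAt_eq_circleAt_iff hm
  have a1 := (i2 (j, 1) (j, 3)).1 hs
  have c1 := i4 (k, 1) (j, 1)
  have c3 := i4 (k, 3) (j, 1)
  have d1 : D.circleAt ρf (k, 1) = D.circleAt ρf (j, 1) := by grind
  have d3 : D.circleAt ρf (k, 3) = D.circleAt ρf (j, 1) := by grind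
  exact ⟨hk, h3.circleAt_eq_iff.1 (d1.trans d3.symm), h4.circleAt_eq hm, d1, d3⟩

end Face

variable (D) in
/-- The two ways around a face of the cube of resolutions agree on the positive state of `ρ`. -/
def FaceCommutes (j k : Fin D.num) (ρ : D.Resolution) : Prop :=
  edgeMap k (edgeMap j (Finsupp.single (plusState ρ) 1)) =
    edgeMap j (edgeMap k (Finsupp.single (plusState ρ) (1 : ℚ)))

/-- The faces on which the type (merge or split) of the change at `j` depends on the order. -/
theorem faceCommutes_of_differs {ρ : D.Resolution} (hjk : j ≠ k) (hj : ρ j = false)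
    (hk : ρ k = false) (hd : ¬ (D.circleAt ρ (j, 1) = D.circleAt ρ (j, 3) ↔
      D.circleAt (Function.update ρ k true) (j, 1) =
        D.circleAt (Function.update ρ k true) (j, 3))) : D.FaceCommutes j k ρ := by
  have hk' : Function.update ρ j true k = false := by rw [Function.update_of_ne hjk.symm, hk]
  have hj' : Function.update ρ k true j = false := by rw [Function.update_of_ne hjk, hj]
  have hcomm : Function.update (Function.update ρ k true) j true =
      Function.update (Function.update ρ j true) k true := Function.update_comm hjk.symm _ _ _
  have h1 := differsAt_update ρ hj
  have h2 := differsAt_update ρ hk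
  have h3 := differsAt_update _ hk'
  have h4 := differsAt_update _ hj'
  rw [hcomm] at h4
  rw [FaceCommutes]
  by_cases hs : D.circleAt ρ (j, 1) = D.circleAt ρ (j, 3)
  · obtain ⟨e1, e2, e3, e4, e5⟩ := face_split_merge h2 h3 h4 hs (by tauto)
    rw [edgeMap_plusState_split hj hs, edgeMap_plusState_split hk e1, map_add, map_add,
      edgeMap_mulPoint, edgeMap_mulPoint, edgeMap_mulPoint, edgeMap_mulPoint,
      edgeMap_plusState_merge hk' e2, edgeMap_plusState_merge hj' (by tauto), hcomm]
    exact congrArg₂ (· + ·) (mulPoint_single_congr e4.symm)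
      (mulPoint_single_congr (e3.symm.trans e5.symm))
  · obtain ⟨e1, e2, e3⟩ := face_merge_split h1 h2 h3 h4 hs (by tauto)
    rw [edgeMap_plusState_merge hj hs, edgeMap_plusState_merge hk e1,
      edgeMap_plusState_split hk' e2, edgeMap_plusState_split hj' (by tauto), hcomm]
    rcases e3 with ⟨e3, e4⟩ | ⟨e3, e4⟩
    · exact congrArg₂ (· + ·) (mulPoint_single_congr e3.symm) (mulPoint_single_congr e4.symm)
    · rw [add_comm]
      exact congrArg₂ (· + ·) (mulPoint_single_congr e3.symm) (mulPoint_single_congr e4.symm)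

theorem faceCommutes {ρ : D.Resolution} (hjk : j ≠ k) (hj : ρ j = false) (hk : ρ k = false) :
    D.FaceCommutes j k ρ := by
  by_cases hdj : D.circleAt ρ (j, 1) = D.circleAt ρ (j, 3) ↔
      D.circleAt (Function.update ρ k true) (j, 1) = D.circleAt (Function.update ρ k true) (j, 3)
  swap
  · exact faceCommutes_of_differs hjk hj hk hdj
  by_cases hdk : D.circleAt ρ (k, 1) = D.circleAt ρ (k, 3) ↔
      D.circleAt (Function.update ρ j true) (k, 1) = D.circleAt (Function.update ρ j true) (k, 3)
  swap
  · exact (faceCommutes_of_differs hjk.symm hk hj hdk).symm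
  have hk' : Function.update ρ j true k = false := by rw [Function.update_of_ne hjk.symm, hk]
  have hj' : Function.update ρ k true j = false := by rw [Function.update_of_ne hjk, hj]
  have hcomm : Function.update (Function.update ρ k true) j true =
      Function.update (Function.update ρ j true) k true := Function.update_comm hjk.symm _ _ _
  rw [FaceCommutes]
  by_cases hsj : D.circleAt ρ (j, 1) = D.circleAt ρ (j, 3) <;>
    by_cases hsk : D.circleAt ρ (k, 1) = D.circleAt ρ (k, 3)
  · rw [edgeMap_plusState_split hj hsj, edgeMap_plusState_split hk hsk]
    simp only [map_add, edgeMap_mulPoint]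
    rw [edgeMap_plusState_split hk' (hdk.1 hsk), edgeMap_plusState_split hj' (hdj.1 hsj), hcomm]
    simp only [map_add]
    rw [mulPoint_comm (Sum.inl (k, 1)) (Sum.inl (j, 1)), mulPoint_comm (Sum.inl (k, 1)),
      mulPoint_comm (Sum.inl (k, 3)) (Sum.inl (j, 1)), mulPoint_comm (Sum.inl (k, 3))]
    abel
  · rw [edgeMap_plusState_split hj hsj, edgeMap_plusState_merge hk hsk]
    simp only [map_add, edgeMap_mulPoint]
    rw [edgeMap_plusState_merge hk' (mt hdk.2 hsk), edgeMap_plusState_split hj' (hdj.1 hsj), hcomm]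
  · rw [edgeMap_plusState_merge hj hsj, edgeMap_plusState_split hk hsk]
    simp only [map_add, edgeMap_mulPoint]
    rw [edgeMap_plusState_split hk' (hdk.1 hsk), edgeMap_plusState_merge hj' (mt hdj.2 hsj), hcomm]
  · rw [edgeMap_plusState_merge hj hsj, edgeMap_plusState_merge hk hsk,
      edgeMap_plusState_merge hk' (mt hdk.2 hsk), edgeMap_plusState_merge hj' (mt hdj.2 hsj), hcomm]

/-- The faces of the cube of resolutions commute. -/
theorem edgeMap_comm {x : D.State} (hjk : j ≠ k) (hj : x.1 j = false) (hk : x.1 k = false) :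
    edgeMap k (edgeMap j (Finsupp.single x 1)) = edgeMap j (edgeMap k (Finsupp.single x 1)) :=
  eq_of_commute_mulPoint (S := edgeMap k ∘ₗ edgeMap j) (T := edgeMap j ∘ₗ edgeMap k)
    (fun p v => by simp only [LinearMap.comp_apply, edgeMap_mulPoint])
    (fun p v => by simp only [LinearMap.comp_apply, edgeMap_mulPoint])
    (faceCommutes hjk hj hk) x rfl

/-! ### The differential squares to zero -/

/-- The exponent of the sign of the edge in direction `j` at the resolution `ρ`. -/
def signExp (j : Fin D.num) (ρ : D.Resolution) : ℕ :=
  (Finset.univ.filter fun i => i < j ∧ ρ i = true).card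

theorem signExp_update_of_lt {ρ : D.Resolution} (hjk : j < k) (hj : ρ j = false) :
    signExp k (Function.update ρ j true) = signExp k ρ + 1 := by
  rw [signExp, signExp, ← Finset.card_insert_of_notMem (a := j) (by simp [hj])]
  congr 1
  ext i
  by_cases hi : i = j
  · subst hi; simp [hjk]
  · simp [hi]

theorem signExp_update_of_gt {ρ : D.Resolution} (hjk : k < j) :
    signExp k (Function.update ρ j true) = signExp k ρ := by
  rw [signExp, signExp]
  congr 1
  ext i
  by_cases hi : i = j
  · subst hi; simp [hjk.le]
  · simp [hi]

theorem sign_anticomm {ρ : D.Resolution} (hjk : j ≠ k) (hj : ρ j = false) (hk : ρ k = false) :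
    (-1 : ℚ) ^ signExp j ρ * (-1) ^ signExp k (Function.update ρ j true) =
      -((-1) ^ signExp k ρ * (-1) ^ signExp j (Function.update ρ k true)) := by
  rcases lt_or_gt_of_ne hjk with h | h
  · rw [signExp_update_of_lt h hj, signExp_update_of_gt h]
    ring
  · rw [signExp_update_of_lt h hk, signExp_update_of_gt h]
    ring

theorem diffCoeff_eq (x y : D.State) :
    D.diffCoeff x y = ∑ j, (-1) ^ signExp j x.1 * edgeEntry j x y := by
  refine Finset.sum_congr rfl fun j _ => ?_
  rw [edgeEntry]
  split_ifs
  · rfl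
  · rw [mul_zero]

theorem diff_single (x : D.State) :
    D.diff (Finsupp.single x 1) = ∑ j, (-1 : ℚ) ^ signExp j x.1 • edgeMap j (Finsupp.single x 1) := by
  classical
  ext y
  rw [diff_apply, Finsupp.finsetSum_apply]
  simp only [Finsupp.smul_apply, edgeMap_single_apply, smul_eq_mul, ← diffCoeff_eq]
  simp [Finsupp.single_apply]

/-- The contribution of the directions `j` and `k` to the square of the differential. -/
def doubleEdge (x : D.State) (j k : Fin D.num) : D.CKh :=
  ((-1 : ℚ) ^ signExp j x.1 * (-1) ^ signExp k (Function.update x.1 j true)) •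
    edgeMap k (edgeMap j (Finsupp.single x 1))

theorem diff_edgeMap_single (x : D.State) (j : Fin D.num) :
    D.diff (edgeMap j (Finsupp.single x 1)) =
      ∑ k, (-1 : ℚ) ^ signExp k (Function.update x.1 j true) •
        edgeMap k (edgeMap j (Finsupp.single x 1)) := by
  have e : edgeMap j (Finsupp.single x 1) = ∑ y, edgeEntry j x y • Finsupp.single y (1 : ℚ) := by
    simp [edgeMap]
  rw [e]
  simp only [map_sum, map_smul, Finset.smul_sum]
  rw [Finset.sum_comm]
  refine Finset.sum_congr rfl fun y _ => ?_
  rw [diff_single, Finset.smul_sum]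
  refine Finset.sum_congr rfl fun k _ => ?_
  by_cases h : x.1 j = false ∧ y.1 = Function.update x.1 j true
  · rw [h.2, smul_comm]
  · rw [edgeEntry, if_neg h, zero_smul, zero_smul, smul_zero]

theorem edgeMap_of_true {x : D.State} (hj : x.1 j = true) :
    edgeMap j (Finsupp.single x 1) = 0 := by
  ext y
  rw [edgeMap_single_apply, edgeEntry, if_neg]
  · rfl
  · simp [hj]

theorem edgeMap_edgeMap_of_true {x : D.State} (hk : Function.update x.1 j true k = true) :
    edgeMap k (edgeMap j (Finsupp.single x 1)) = 0 := by
  have e : edgeMap j (Finsupp.single x 1) = ∑ y, edgeEntry j x y • Finsupp.single y (1 : ℚ) := by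
    simp [edgeMap]
  rw [e, map_sum]
  refine Finset.sum_eq_zero fun y _ => ?_
  rw [map_smul]
  by_cases h : x.1 j = false ∧ y.1 = Function.update x.1 j true
  · rw [edgeMap_of_true (h.2 ▸ hk), smul_zero]
  · rw [edgeEntry, if_neg h, zero_smul]

theorem doubleEdge_anticomm (x : D.State) (j k : Fin D.num) :
    doubleEdge x j k = -doubleEdge x k j := by
  by_cases hjk : j = k
  · subst hjk
    rw [doubleEdge, edgeMap_edgeMap_of_true (Function.update_self ..), smul_zero, neg_zero]
  · rw [doubleEdge, doubleEdge]
    rcases Bool.eq_false_or_eq_true (x.1 j) with hj | hj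
    · have hj' : Function.update x.1 k true j = true := by rw [Function.update_of_ne hjk, hj]
      rw [edgeMap_of_true hj, edgeMap_edgeMap_of_true hj', map_zero, smul_zero, smul_zero, neg_zero]
    rcases Bool.eq_false_or_eq_true (x.1 k) with hk | hk
    · have hk' : Function.update x.1 j true k = true := by
        rw [Function.update_of_ne (Ne.symm hjk), hk]
      rw [edgeMap_of_true hk, edgeMap_edgeMap_of_true hk', map_zero, smul_zero, smul_zero, neg_zero]
    rw [sign_anticomm hjk hj hk, edgeMap_comm hjk hj hk, neg_smul]

variable (D) in
theorem diff_comp_diff : D.diff ∘ₗ D.diff = 0 := by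
  refine CKh.hom_ext fun x => ?_
  have e : D.diff (D.diff (Finsupp.single x 1)) = ∑ j, ∑ k, doubleEdge x j k := by
    rw [diff_single, map_sum]
    refine Finset.sum_congr rfl fun j _ => ?_
    rw [map_smul, diff_edgeMap_single, Finset.smul_sum]
    refine Finset.sum_congr rfl fun k _ => ?_
    rw [smul_smul]
    rfl
  have h : ∑ j, ∑ k, doubleEdge x j k = -∑ j, ∑ k, doubleEdge x j k := by
    conv_lhs => rw [Finset.sum_comm]
    rw [← Finset.sum_neg_distrib]
    refine Finset.sum_congr rfl fun j _ => ?_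
    rw [← Finset.sum_neg_distrib]
    exact Finset.sum_congr rfl fun k _ => doubleEdge_anticomm x k j
  rw [LinearMap.comp_apply, e, LinearMap.zero_apply]
  exact self_eq_neg.1 h

variable (D) in
theorem isComplex : D.IsComplex := ⟨D.diff_comp_diff, fun _ _ _ hv => diff_mem_bidegree hv⟩

end Diagram

/-! ### The induced map of Laurent polynomial rings -/

section Laurent

variable {V W : Type*} [AddCommGroup V] [AddCommGroup W]

/-- The ring map of Laurent polynomial rings that is induced by a homomorphism of the groups of
exponents. -/
def laurentMap (h : V →+ W) : Laurent V →+* Laurent W :=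
  AddMonoidAlgebra.mapDomainRingHom ℤ ((AddMonoidHom.id ℤ).prodMap h)

theorem laurentMap_monomial (h : V →+ W) (j : ℤ) (v : V) :
    laurentMap h (monomial j v) = monomial j (h v) :=
  AddMonoidAlgebra.mapDomain_single

theorem monomial_mul (i j : ℤ) (v w : V) :
    monomial i v * monomial j w = monomial (i + j) (v + w) := by
  simp [monomial, AddMonoidAlgebra.single_mul_single]

theorem laurent_ringHom_ext {R : Type*} [Semiring R] {φ ψ : Laurent V →+* R}
    (h : ∀ j v, φ (monomial j v) = ψ (monomial j v)) : φ = ψ :=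
  AddMonoidAlgebra.ringHom_ext (fun r => by
    change φ.comp AddMonoidAlgebra.singleZeroRingHom r = ψ.comp AddMonoidAlgebra.singleZeroRingHom r
    exact RingHom.congr_fun (RingHom.ext_int _ _) r) fun x => h x.1 x.2

/-- Two multiplicative functions into a monoid that agree on a generating set of a group agree. -/
theorem eqOn_closure {A R : Type*} [AddGroup A] [Monoid R] {φ ψ : A → R} (hφ0 : φ 0 = 1)
    (hψ0 : ψ 0 = 1) (hφ : ∀ a b, φ (a + b) = φ a * φ b) (hψ : ∀ a b, ψ (a + b) = ψ a * ψ b)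
    {S : Set A} (hS : ∀ a ∈ S, φ a = ψ a) : ∀ a ∈ AddSubgroup.closure S, φ a = ψ a := by
  intro a ha
  induction ha using AddSubgroup.closure_induction with
  | mem a ha => exact hS a ha
  | zero => rw [hφ0, hψ0]
  | add a b _ _ ha hb => rw [hφ, hψ, ha, hb]
  | neg a _ ha =>
    have h1 : φ (-a) * φ a = 1 := by rw [← hφ, neg_add_cancel, hφ0]
    have h2 : φ a * ψ (-a) = 1 := by rw [ha, ← hψ, add_neg_cancel, hψ0]
    exact left_inv_eq_right_inv h1 h2

end Laurent

section CurveGroup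

variable {n : ℕ} {X : PuncturedDisk n}

theorem closure_generators :
    AddSubgroup.closure (insert ((1 : ℤ), (0 : CurveGroup X))
      (Set.range fun c : CurveClass X => ((0 : ℤ), CurveGroup.of c))) = ⊤ := by
  rw [eq_top_iff]
  rintro ⟨j, v⟩ -
  set G := AddSubgroup.closure (insert ((1 : ℤ), (0 : CurveGroup X))
      (Set.range fun c : CurveClass X => ((0 : ℤ), CurveGroup.of c))) with hG
  have hj : ((j, 0) : ℤ × CurveGroup X) ∈ G := by
    have h := G.zsmul_mem (AddSubgroup.subset_closure (Set.mem_insert _ _) :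
      ((1 : ℤ), (0 : CurveGroup X)) ∈ G) j
    simpa using h
  have hv : ((0, v) : ℤ × CurveGroup X) ∈ G := by
    induction v using Finsupp.induction_linear with
    | zero => exact G.zero_mem
    | add v w hv hw =>
      exact G.add_mem hv hw
    | single c m =>
      have h := G.zsmul_mem (AddSubgroup.subset_closure (Set.mem_insert_of_mem _ ⟨c, rfl⟩) :
        ((0 : ℤ), CurveGroup.of c) ∈ G) m
      have e : m • CurveGroup.of c = Finsupp.single c m := by
        refine (Finsupp.smul_single m c (1 : ℤ)).trans ?_
        rw [smul_eq_mul, mul_one]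
      rw [Prod.smul_mk, smul_zero, e] at h
      exact h
  have := G.add_mem hj hv
  rwa [Prod.mk_add_mk, add_zero, zero_add] at this

/-- A ring map from the Laurent polynomial ring over the free abelian group on the classes of curves
is determined by its values on `q` and on the variables. -/
theorem laurent_curveGroup_ringHom_ext {R : Type*} [Semiring R]
    {φ ψ : Laurent (CurveGroup X) →+* R} (hq : φ (monomial 1 0) = ψ (monomial 1 0))
    (hx : ∀ c, φ (monomial 0 (CurveGroup.of c)) = ψ (monomial 0 (CurveGroup.of c))) : φ = ψ := by
  refine laurent_ringHom_ext fun j v => ?_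
  refine eqOn_closure (φ := fun a : ℤ × CurveGroup X => φ (monomial a.1 a.2))
    (ψ := fun a => ψ (monomial a.1 a.2)) ?_ ?_ (fun a b => ?_) (fun a b => ?_) ?_ (j, v)
    (closure_generators (X := X) ▸ AddSubgroup.mem_top _)
  · exact map_one φ
  · exact map_one ψ
  · simp only [← map_mul, monomial_mul, Prod.fst_add, Prod.snd_add]
  · simp only [← map_mul, monomial_mul, Prod.fst_add, Prod.snd_add]
  · rintro a (rfl | ⟨c, rfl⟩)
    · exact hq
    · exact hx c

end CurveGroup

end

end Multipunctured

theorem theorem2 {n : ℕ} (X : Multipunctured.PuncturedDisk n) :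
    ∃ χ : Multipunctured.Laurent (Multipunctured.CurveGroup X) →+*
        Multipunctured.Laurent (Fin n → ℤ),
      -- the ring map is induced by `h`, and it is the only one
      (χ (Multipunctured.monomial 1 0) = Multipunctured.monomial 1 0 ∧
        ∀ c : Multipunctured.CurveClass X,
          χ (Multipunctured.monomial 0 (Multipunctured.CurveGroup.of c)) =
            Multipunctured.monomial 0
              (Multipunctured.hurewicz X (Multipunctured.CurveGroup.of c))) ∧
      (∀ χ₁ : Multipunctured.Laurent (Multipunctured.CurveGroup X) →+*
          Multipunctured.Laurent (Fin n → ℤ),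
        (χ₁ (Multipunctured.monomial 1 0) = Multipunctured.monomial 1 0 ∧
          ∀ c : Multipunctured.CurveClass X,
            χ₁ (Multipunctured.monomial 0 (Multipunctured.CurveGroup.of c)) =
              Multipunctured.monomial 0
                (Multipunctured.hurewicz X (Multipunctured.CurveGroup.of c))) → χ₁ = χ) ∧
      -- for every diagram, both homologies are well defined, and `χ` relates the Euler
      -- characteristics
      ∀ D : Multipunctured.Diagram X, D.IsComplex ∧
        ∃ (hA : Multipunctured.IsFiltered D.curveDegree D.diff)
          (hM : Multipunctured.IsFiltered D.homologyDegree D.diff),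
          Multipunctured.FinitelySupported (D.rankAPS hA) ∧
          Multipunctured.FinitelySupported (D.rankMKh hM) ∧
          χ (Multipunctured.eulerChar (D.rankAPS hA)) =
            Multipunctured.eulerChar (D.rankMKh hM) := by

  refine ⟨Multipunctured.laurentMap (Multipunctured.hurewicz X),
    ⟨(Multipunctured.laurentMap_monomial _ _ _).trans (by rw [map_zero]),
      fun c => Multipunctured.laurentMap_monomial _ _ _⟩, fun χ₁ hχ₁ => ?_, fun D => ?_⟩
  · refine Multipunctured.laurent_curveGroup_ringHom_ext ?_ fun c => ?_
    · rw [hχ₁.1, Multipunctured.laurentMap_monomial, map_zero]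
    · rw [hχ₁.2, Multipunctured.laurentMap_monomial]
  · have h2 := D.diff_comp_diff
    have hW : ∀ i j, ∀ x ∈ Multipunctured.bigraded D.homDegree D.quantumDegree i j,
        D.diff x ∈ Multipunctured.bigraded D.homDegree D.quantumDegree (i + 1) j :=
      D.isComplex.2
    refine ⟨D.isComplex, D.isFiltered_curveDegree, D.isFiltered_homologyDegree,
      Multipunctured.finitelySupported_grHomology _ h2 hW,
      Multipunctured.finitelySupported_grHomology _ h2 hW, ?_⟩
    -- both Euler characteristics are sums over the enhanced states
    have eA := Multipunctured.eulerChar_grHomology D.isFiltered_curveDegree h2 hW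
    have eM := Multipunctured.eulerChar_grHomology D.isFiltered_homologyDegree h2 hW
    refine (congrArg _ eA).trans (Eq.trans ?_ eM.symm)
    rw [map_sum]
    refine Finset.sum_congr rfl fun x _ => ?_
    rw [map_zsmul, Multipunctured.laurentMap_monomial, D.hurewicz_curveDegree x]
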